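/- **Setting.** Trading takes place on $[0,1]$, with order size $1$. Let $2\le N<\infty$, $v_1<\dots<v_N$ and $\beta>0$. The noise buy and sell orders $Z^B,Z^S$ are independent Poisson processes with intensity $\beta$, jointly independent of the fundamental value $\tilde v$. Let $-\infty=a_1<a_2<\dots<a_{N+1}=\infty$ with $a_n\in\mathbb Z\cup\{\pm\infty\}$ be such that $\mathbb P(\tilde v=v_n)=\mathbb P(Z^B_1-Z^S_1\in[a_n,a_{n+1}))$ for all $n$, and assume that no middle level $m_n=(a_n+a_{n+1}-1)/2$ is an integer ($m_1=-\infty$, $m_N=+\infty$). Put $\underline m_n=\lfloor m_n\rfloor$, $\overline m_n=\lceil m_n\rceil$, with $\lfloor\pm\infty\rfloor=\lceil\pm\infty\rceil=\pm\infty$. The pricing rule is $p(y,t)=\sum_{n} v_n\,\mathbb P(y+Z^B_{1-t}-Z^S_{1-t}\in[a_n,a_{n+1}))$, and $P(y)=v_n$ for $y\in[a_n,a_{n+1})$. For $y\in\mathbb Z$, $$U(v_n,y,1)=\mathbf 1_{\{y\le\underline m_n\}}\sum_{j=y}^{a_n-1}(v_n-P(j+1))+\mathbf 1_{\{y\ge\overline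 m_n\}}\sum_{j=a_{n+1}}^{y}(P(j-1)-v_n),$$ and, for $t\in[0,1)$, $U(v_n,y,t)=U(v_n,y,1)+\beta\int_t^1(p(y,r)-p(y-1,r))\,dr$ if $y\ge\overline m_n$, $U(v_n,y,t)=U(v_n,y,1)+\beta\int_t^1(p(y+1,r)-p(y,r))\,dr$ if $y\le\underline m_n$. **Strategies.** An admissible strategy $(X^B,X^S;\mathcal F^I)$ consists of the filtration $\mathcal F^I$ satisfying the usual conditions generated by $\tilde v$, the noise orders and some filtration $\mathcal H$ independent of $\tilde v$ and the noise orders, and of $\mathcal F^I$-adapted integrable point processes $X^B,X^S$ (cumulative buy and sell orders) with unit jumps, started at $0$, a.s. without common jumps, which have $\mathcal F^I$-intensities $\theta^B,\theta^S$ and satisfy $\mathbb E\int_0^1|p(Y_t,t)|\,|dX^i_t-\theta^i_t\,dt|<\infty$, $i\in\{B,S\}$. Here $Y=Y_0+Z^B-Z^S+X^B-X^S$ is the total demand, started at an integer $Y_0$. Decompose $X^B=X^{B,B}+X^{B,T}+X^{B,S}$ and $X^S=X^{S,S}+X^{S,T}+X^{S,B}$: $X^{B,T},X^{B,S}$ collect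 the jumps of $X^B$ at jump times of $Z^B$, $Z^S$ respectively, $X^{S,T},X^{S,B}$ those of $X^S$ at jump times of $Z^S$, $Z^B$ respectively, and $X^{B,B},X^{S,S}$ the remaining ones. Let $\theta^{i,j}$ be $\mathcal F^I$-intensities of $X^{i,j}$. For $n\in\{1,\dots,N\}$, $y\in\mathbb Z$, $t\in[0,1]$ with $\mathbb P(\tilde v=v_n,Y_t=y)>0$, write $\mathbb E_{n,y,t}$ for the expectation conditional on $\{\tilde v=v_n,\,Y_t=y\}$. The expected profit is $$\mathcal J(v_n,y,t)=\mathbb E_{n,y,t}\Big[\int_t^1(\tilde v-p(Y_{r-}+1,r))dX^{B,B}_r+\int_t^1(\tilde v-p(Y_{r-}+2,r))dX^{B,T}_r+\int_t^1(\tilde v-p(Y_{r-},r))dX^{B,S}_r$$ $$\qquad-\int_t^1(\tilde v-p(Y_{r-}-1,r))dX^{S,S}_r-\int_t^1(\tilde v-p(Y_{r-}-2,r))dX^{S,T}_r-\int_t^1(\tilde v-p(Y_{r-},r))dX^{S,B}_r\Big],$$ with all integrals over $(t,1]$, and $$L(v_n,y,t)=\mathbb E_{n,y,t}\int_t^1(v_n-p(\underline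 m_n,r))\big[(\beta-\theta^{B,S}_r+\theta^{S,S}_r)\mathbf 1_{\{Y_{r-}=\overline m_n\}}+\theta^{S,T}_r\mathbf 1_{\{Y_{r-}=\overline m_n+1\}}\big]dr$$ $$\qquad-\mathbb E_{n,y,t}\int_t^1(v_n-p(\overline m_n,r))\big[(\beta-\theta^{S,B}_r+\theta^{B,B}_r)\mathbf 1_{\{Y_{r-}=\underline m_n\}}+\theta^{B,T}_r\mathbf 1_{\{Y_{r-}=\underline m_n-1\}}\big]dr$$ (so $L=0$ for $n\in\{1,N\}$). **Proposition.** For every admissible strategy and all $n,y,t$ as above, the random variables inside these expectations are integrable, and $$\mathcal J(v_n,y,t)\le U(v_n,y,t)-L(v_n,y,t).$$ Equality holds if, a.s. on $\{\tilde v=v_n,\,Y_t=y\}$, 1. $Y_1\in[a_n-1,a_{n+1}+1)$; and 2. for $r\in(t,1]$: $X^{S,S}$ and $X^{S,B}$ do not jump at $r$ when $Y_{r-}\le\underline m_n$; $X^{B,B}$ and $X^{B,S}$ do not jump at $r$ when $Y_{r-}\ge\overline m_n$; and, for almost every $r\in(t,1]$, $\theta^{B,T}_r=0$ when $Y_{r-}\ge\underline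 m_n$, and $\theta^{S,T}_r=0$ when $Y_{r-}\le\overline m_n$. -/

import Mathlib

open MeasureTheory ProbabilityTheory
open scoped NNReal ENNReal

noncomputable section

namespace GlostenMilgrom

/-- The trading period `[0,1]`. -/
abbrev Time := unitInterval

/-! ### Levels, pricing rule and the function `U` -/

/-- An integer demand level, seen in `[-∞, ∞]`. -/
def lvl (k : ℤ) : EReal := ((k : ℝ) : EReal)

/-- The integers in `[a_n, a_{n+1})`; the index `n : Fin N` counts from `0`. -/
def interval {N : ℕ} (a : Fin (N + 1) → EReal) (n : Fin N) : Set ℤ :=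
  {k | a n.castSucc ≤ lvl k ∧ lvl k < a n.succ}

/-- The middle level `m_n = (a_n + a_{n+1} - 1) / 2`. It is `-∞` for the first and `+∞` for the last
interval when there are at least two intervals. -/
def mid {N : ℕ} (a : Fin (N + 1) → EReal) (n : Fin N) : EReal :=
  (a n.castSucc + a n.succ - 1) / 2

/-- `⌊m_n⌋` as an integer (meaningful when `m_n` is finite). -/
def lowMidInt {N : ℕ} (a : Fin (N + 1) → EReal) (n : Fin N) : ℤ := ⌊(mid a n).toReal⌋

/-- `⌈m_n⌉` as an integer (meaningful when `m_n` is finite). -/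
def upMidInt {N : ℕ} (a : Fin (N + 1) → EReal) (n : Fin N) : ℤ := ⌈(mid a n).toReal⌉

/-- The level `⌊m_n⌋` just below `m_n`, with `⌊±∞⌋ = ±∞`. -/
def lowMid {N : ℕ} (a : Fin (N + 1) → EReal) (n : Fin N) : EReal :=
  open Classical in
  if mid a n = ⊥ ∨ mid a n = ⊤ then mid a n else lvl (lowMidInt a n)

/-- The level `⌈m_n⌉` just above `m_n`, with `⌈±∞⌉ = ±∞`. -/
def upMid {N : ℕ} (a : Fin (N + 1) → EReal) (n : Fin N) : EReal :=
  open Classical in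
  if mid a n = ⊥ ∨ mid a n = ⊤ then mid a n else lvl (upMidInt a n)

/-- The law of the difference of two independent Poisson variables of parameter `r`. -/
def skellam (r : ℝ≥0) : Measure ℤ :=
  ((poissonMeasure r).prod (poissonMeasure r)).map (fun q : ℕ × ℕ => (q.1 : ℤ) - (q.2 : ℤ))

/-- `h_n(y,t)`, the probability that the noise demand started from `y` lies in `[a_n, a_{n+1})` after
a time `1 - t`. -/
def h {N : ℕ} (a : Fin (N + 1) → EReal) (β : ℝ≥0) (n : Fin N) (y : ℤ) (t : ℝ) : ℝ :=
  (skellam (β * Real.toNNReal (1 - t))).real {k | y + k ∈ interval a n}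

/-- The pricing rule `p(y,t) = ∑ v_n h_n(y,t)`. -/
def price {N : ℕ} (v : Fin N → ℝ) (a : Fin (N + 1) → EReal) (β : ℝ≥0) (y : ℤ) (t : ℝ) : ℝ :=
  ∑ n, v n * h a β n y t

/-- The terminal pricing function: `v_n` on `[a_n, a_{n+1})`. -/
def terminalPrice {N : ℕ} (v : Fin N → ℝ) (a : Fin (N + 1) → EReal) (y : ℤ) : ℝ :=
  ∑ n, (interval a n).indicator (fun _ => v n) y

/-- `U(v_n, y, 1)`. The first (second) sum is only used when `a_n` (`a_{n+1}`) is finite, because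
`y ≤ ⌊m_n⌋` (`y ≥ ⌈m_n⌉`) fails otherwise. -/
def terminalU {N : ℕ} (v : Fin N → ℝ) (a : Fin (N + 1) → EReal) (n : Fin N) (y : ℤ) : ℝ :=
  open Classical in
  (if lvl y ≤ lowMid a n then
    ∑ j ∈ Finset.Icc y (⌊(a n.castSucc).toReal⌋ - 1), (v n - terminalPrice v a (j + 1)) else 0) +
  (if upMid a n ≤ lvl y then
    ∑ j ∈ Finset.Icc ⌊(a n.succ).toReal⌋ y, (terminalPrice v a (j - 1) - v n) else 0)

/-- `U(v_n, y, t)`. -/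
def U {N : ℕ} (v : Fin N → ℝ) (a : Fin (N + 1) → EReal) (β : ℝ≥0) (n : Fin N) (y : ℤ) (t : ℝ) : ℝ :=
  open Classical in
  terminalU v a n y + β * ∫ r in t..1,
    if upMid a n ≤ lvl y then price v a β y r - price v a β (y - 1) r
    else price v a β (y + 1) r - price v a β y r

/-- The standing assumption on the law of the fundamental value `vt` and the levels `a`: `a` is
strictly increasing, with values in `ℤ ∪ {±∞}`, from `-∞` to `+∞`; `vt` takes the value `v_n` with the
probability that the noise demand started from `0` lies in `[a_n, a_{n+1})` at time `1`; and no `m_n`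
is an integer. -/
structure MiddleLevelAssumption {Ω : Type*} [MeasurableSpace Ω] (P : Measure Ω) {N : ℕ}
    (v : Fin N → ℝ) (a : Fin (N + 1) → EReal) (β : ℝ≥0) (vt : Ω → ℝ) : Prop where
  strictMono : StrictMono a
  integral : ∀ i, a i = ⊥ ∨ a i = ⊤ ∨ ∃ k : ℤ, a i = lvl k
  first : a 0 = ⊥
  last : a (Fin.last N) = ⊤
  law : ∀ n, P {ω | vt ω = v n} = skellam β (interval a n)
  mid_not_int : ∀ n, ∀ k : ℤ, mid a n ≠ lvl k

/-! ### Point processes -/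

/-- A path of a point process with jumps of size one, started from `0`. -/
structure IsCountingPath (f : Time → ℕ) : Prop where
  zero : f 0 = 0
  mono : Monotone f
  rightCts : ∀ t, ContinuousWithinAt f (Set.Ici t) t
  jump_le : ∀ t, f t ≤ Function.leftLim f t + 1

/-- The jump times of the path at `ω` of a point process. -/
def jumpTimes {Ω : Type*} (X : Time → Ω → ℕ) (ω : Ω) : Set Time :=
  {s | Function.leftLim (fun u => X u ω) s ≠ X s ω}

/-- A Poisson process of intensity `β` on `[0,1]`. -/
structure IsPoissonProcess {Ω : Type*} [MeasurableSpace Ω] (P : Measure Ω) (β : ℝ≥0)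
    (Z : Time → Ω → ℕ) : Prop where
  measurable : ∀ t, Measurable (Z t)
  path : ∀ ω, IsCountingPath (fun t => Z t ω)
  indep : HasIndepIncrements Z P
  law : ∀ s t : Time, s ≤ t →
    HasLaw (fun ω => Z t ω - Z s ω) (poissonMeasure (β * Real.toNNReal ((t : ℝ) - s))) P

/-- The usual conditions: right-continuity and completeness. -/
structure IsUsual {Ω : Type*} {mΩ : MeasurableSpace Ω} (P : Measure Ω)
    (F : Filtration Time mΩ) : Prop where
  rightCts : F.IsRightContinuous
  complete : ∀ s : Set Ω, P s = 0 → MeasurableSet[F 0] s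

/-- The point process with jump times `T` has the `F`-intensity `θ`: the measure `θ_t dt` is its
`F`-dual predictable projection. -/
structure HasIntensity {Ω : Type*} {mΩ : MeasurableSpace Ω} (P : Measure Ω)
    (F : Filtration Time mΩ) (T : Ω → Set Time) (θ : Time → Ω → ℝ) : Prop where
  nonneg : ∀ t ω, 0 ≤ θ t ω
  progressive : IsStronglyProgressive F θ
  projection : ∀ C : Time × Ω → ℝ≥0∞, Measurable[F.predictable] C →
    ∫⁻ ω, (∑' s : T ω, C (s, ω)) ∂P = ∫⁻ ω, (∫⁻ s, C (s, ω) * ENNReal.ofReal (θ s ω)) ∂P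

/-! ### The market -/

/-- The cumulative noise buy and sell orders, the insider's cumulative buy and sell orders (all in
units of the order size), and the total demand at time `0`. -/
structure OrderFlow (Ω : Type*) where
  start : ℤ
  ZB : Time → Ω → ℕ
  ZS : Time → Ω → ℕ
  XB : Time → Ω → ℕ
  XS : Time → Ω → ℕ

namespace OrderFlow

variable {Ω : Type*} (o : OrderFlow Ω)

/-- The total demand `Y = Z + X`. -/
def Y (t : Time) (ω : Ω) : ℤ :=
  o.start + ((o.ZB t ω : ℤ) - o.ZS t ω) + ((o.XB t ω : ℤ) - o.XS t ω)

/-- The left limit `Y_{t-}`. -/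
def Yleft (t : Time) (ω : Ω) : ℤ := Function.leftLim (fun s => o.Y s ω) t

/-- Jump times of `X^{B,B}`: insider's buy orders apart from the noise orders. -/
def timesBB (ω : Ω) : Set Time :=
  jumpTimes o.XB ω \ (jumpTimes o.ZB ω ∪ jumpTimes o.ZS ω)

/-- Jump times of `X^{B,T}`: insider's buy orders topping up noise buy orders. -/
def timesBT (ω : Ω) : Set Time := jumpTimes o.XB ω ∩ jumpTimes o.ZB ω

/-- Jump times of `X^{B,S}`: insider's buy orders cancelling noise sell orders. -/
def timesBS (ω : Ω) : Set Time := jumpTimes o.XB ω ∩ jumpTimes o.ZS ω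

/-- Jump times of `X^{S,S}`: insider's sell orders apart from the noise orders. -/
def timesSS (ω : Ω) : Set Time :=
  jumpTimes o.XS ω \ (jumpTimes o.ZB ω ∪ jumpTimes o.ZS ω)

/-- Jump times of `X^{S,T}`: insider's sell orders topping up noise sell orders. -/
def timesST (ω : Ω) : Set Time := jumpTimes o.XS ω ∩ jumpTimes o.ZS ω

/-- Jump times of `X^{S,B}`: insider's sell orders cancelling noise buy orders. -/
def timesSB (ω : Ω) : Set Time := jumpTimes o.XS ω ∩ jumpTimes o.ZB ω

/-- The noise orders are independent Poisson processes of intensity `β`, independent of `vt`. -/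
structure IsNoise [MeasurableSpace Ω] (P : Measure Ω) (β : ℝ≥0) (vt : Ω → ℝ) : Prop where
  buy : IsPoissonProcess P β o.ZB
  sell : IsPoissonProcess P β o.ZS
  indep : IndepFun (fun ω t => o.ZB t ω) (fun ω t => o.ZS t ω) P
  indep_value : IndepFun vt (fun ω => ((fun t => o.ZB t ω), (fun t => o.ZS t ω))) P

/-- The information in the noise orders up to time `t`. Almost surely `ZB` and `ZS` never jump
together, so up to null sets this is also the information in `Z = ZB - ZS`. -/
abbrev noiseInfo (t : Time) : MeasurableSpace Ω :=
  ⨆ s : Set.Iic t, (MeasurableSpace.comap (o.ZB s) ⊤ ⊔ MeasurableSpace.comap (o.ZS s) ⊤)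

/-- `F` is the filtration satisfying the usual conditions generated by `vt`, the noise orders, and some
filtration `H` independent of them. -/
def IsInsiderFiltration {mΩ : MeasurableSpace Ω} (P : Measure Ω) (vt : Ω → ℝ)
    (F : Filtration Time mΩ) : Prop :=
  ∃ H : Filtration Time mΩ,
    Indep (⨆ t, H t) (MeasurableSpace.comap vt inferInstance ⊔ o.noiseInfo 1) P ∧
    IsLeast {G : Filtration Time mΩ | IsUsual P G ∧
      ∀ t, MeasurableSpace.comap vt inferInstance ⊔ o.noiseInfo t ⊔ H t ≤ G t} F

/-- The conditions on `X^B` (or `X^S`) in the definition of an admissible strategy: an `F`-adapted,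
integrable point process with jumps of size one, which has an `F`-intensity `θ`, such that
`|p(Y_t,t)|` is integrable against the variation of the compensated process `X - ∫ θ dt`. That
variation is `dX + θ dt`, since `dX` is purely atomic. -/
structure IsAdmissibleSide {mΩ : MeasurableSpace Ω} (P : Measure Ω) {N : ℕ} (v : Fin N → ℝ)
    (a : Fin (N + 1) → EReal) (β : ℝ≥0) (F : Filtration Time mΩ) (X : Time → Ω → ℕ) : Prop where
  path : ∀ ω, IsCountingPath (fun t => X t ω)
  adapted : ∀ t, Measurable[F t] (X t)
  integrable : Integrable (fun ω => (X 1 ω : ℝ)) P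
  intensity : ∃ θ : Time → Ω → ℝ, HasIntensity P F (jumpTimes X) θ ∧
    ∫⁻ ω, ((∑' s : jumpTimes X ω, ENNReal.ofReal |price v a β (o.Y s ω) (s : Time)|) +
      ∫⁻ s : Time, ENNReal.ofReal (|price v a β (o.Y s ω) s| * θ s ω)) ∂P < ⊤

/-- Admissible insider's strategies `(X^B, X^S; F)`. The insider does not buy and sell at the same
instant, so that `Y` moves by `+1, +2, 0, -1, -2, 0` at the jumps of `X^{B,B}`, `X^{B,T}`, `X^{B,S}`,
`X^{S,S}`, `X^{S,T}`, `X^{S,B}`. -/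
structure IsAdmissible {mΩ : MeasurableSpace Ω} (P : Measure Ω) {N : ℕ} (v : Fin N → ℝ)
    (a : Fin (N + 1) → EReal) (β : ℝ≥0) (vt : Ω → ℝ) (F : Filtration Time mΩ) : Prop where
  filtration : o.IsInsiderFiltration P vt F
  buy : o.IsAdmissibleSide P v a β F o.XB
  sell : o.IsAdmissibleSide P v a β F o.XS
  disjoint : ∀ᵐ ω ∂P, Disjoint (jumpTimes o.XB ω) (jumpTimes o.XS ω)

end OrderFlow

/-- Six intensities `θ^{i,j}`, `i ∈ {B,S}`, `j ∈ {B,T,S}`. -/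
structure Rates (Ω : Type*) where
  BB : Time → Ω → ℝ
  BT : Time → Ω → ℝ
  BS : Time → Ω → ℝ
  SS : Time → Ω → ℝ
  ST : Time → Ω → ℝ
  SB : Time → Ω → ℝ

namespace OrderFlow

variable {Ω : Type*} (o : OrderFlow Ω)

/-- `θ^{i,j}` is an `F`-intensity of `X^{i,j}` for all `i, j`. -/
structure HasRates {mΩ : MeasurableSpace Ω} (P : Measure Ω) (F : Filtration Time mΩ)
    (θ : Rates Ω) : Prop where
  BB : HasIntensity P F o.timesBB θ.BB
  BT : HasIntensity P F o.timesBT θ.BT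
  BS : HasIntensity P F o.timesBS θ.BS
  SS : HasIntensity P F o.timesSS θ.SS
  ST : HasIntensity P F o.timesST θ.ST
  SB : HasIntensity P F o.timesSB θ.SB

/-- `∫_{(t,1]} f dN` for the point process `N` with the finite set of jump times `T`. -/
def jumpSum (T : Set Time) (t : Time) (f : Time → ℝ) : ℝ := ∑ᶠ s ∈ T ∩ Set.Ioc t 1, f s

/-- The insider's profit over `(t,1]`. -/
def profit {N : ℕ} (v : Fin N → ℝ) (a : Fin (N + 1) → EReal) (β : ℝ≥0) (vt : Ω → ℝ) (t : Time)
    (ω : Ω) : ℝ :=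
  jumpSum (o.timesBB ω) t (fun s => vt ω - price v a β (o.Yleft s ω + 1) s) +
  jumpSum (o.timesBT ω) t (fun s => vt ω - price v a β (o.Yleft s ω + 2) s) +
  jumpSum (o.timesBS ω) t (fun s => vt ω - price v a β (o.Yleft s ω) s) -
  jumpSum (o.timesSS ω) t (fun s => vt ω - price v a β (o.Yleft s ω - 1) s) -
  jumpSum (o.timesST ω) t (fun s => vt ω - price v a β (o.Yleft s ω - 2) s) -
  jumpSum (o.timesSB ω) t (fun s => vt ω - price v a β (o.Yleft s ω) s)

/-- `P` conditioned on `vt = v_n` and `Y_t = y`. -/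
def condLaw [MeasurableSpace Ω] (P : Measure Ω) {N : ℕ} (v : Fin N → ℝ) (vt : Ω → ℝ) (n : Fin N)
    (y : ℤ) (t : Time) : Measure Ω :=
  ProbabilityTheory.cond P {ω | vt ω = v n ∧ o.Y t ω = y}

/-- The expected profit `J(v_n, y, t; X^B, X^S)`. -/
def expectedProfit [MeasurableSpace Ω] (P : Measure Ω) {N : ℕ} (v : Fin N → ℝ)
    (a : Fin (N + 1) → EReal) (β : ℝ≥0) (vt : Ω → ℝ) (n : Fin N) (y : ℤ) (t : Time) : ℝ :=
  ∫ ω, o.profit v a β vt t ω ∂(o.condLaw P v vt n y t)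

/-- The pathwise integral over `(t,1]` in the first term of `L`. -/
def lossUp {N : ℕ} (v : Fin N → ℝ) (a : Fin (N + 1) → EReal) (β : ℝ≥0) (θ : Rates Ω) (n : Fin N)
    (t : Time) (ω : Ω) : ℝ :=
  open Classical in
  ∫ r : Time in Set.Ioc t 1, (v n - price v a β (lowMidInt a n) r) *
    ((β - θ.BS r ω + θ.SS r ω) * (if lvl (o.Yleft r ω) = upMid a n then 1 else 0) +
      θ.ST r ω * (if lvl (o.Yleft r ω) = upMid a n + 1 then 1 else 0))

/-- The pathwise integral over `(t,1]` in the second term of `L`. -/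
def lossDown {N : ℕ} (v : Fin N → ℝ) (a : Fin (N + 1) → EReal) (β : ℝ≥0) (θ : Rates Ω) (n : Fin N)
    (t : Time) (ω : Ω) : ℝ :=
  open Classical in
  ∫ r : Time in Set.Ioc t 1, (v n - price v a β (upMidInt a n) r) *
    ((β - θ.SB r ω + θ.BB r ω) * (if lvl (o.Yleft r ω) = lowMid a n then 1 else 0) +
      θ.BT r ω * (if lvl (o.Yleft r ω) = lowMid a n - 1 then 1 else 0))

/-- `L(v_n, y, t)`. -/
def L [MeasurableSpace Ω] (P : Measure Ω) {N : ℕ} (v : Fin N → ℝ) (a : Fin (N + 1) → EReal)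
    (β : ℝ≥0) (vt : Ω → ℝ) (θ : Rates Ω) (n : Fin N) (y : ℤ) (t : Time) : ℝ :=
  ∫ ω, o.lossUp v a β θ n t ω ∂(o.condLaw P v vt n y t) -
  ∫ ω, o.lossDown v a β θ n t ω ∂(o.condLaw P v vt n y t)

/-- The terminal demand `Y_1` is a.s. in `[a_n - 1, a_{n+1} + 1)`. -/
def LandsInInterval [MeasurableSpace Ω] (P : Measure Ω) {N : ℕ} (v : Fin N → ℝ)
    (a : Fin (N + 1) → EReal) (vt : Ω → ℝ) (n : Fin N) (y : ℤ) (t : Time) : Prop :=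
  ∀ᵐ ω ∂(o.condLaw P v vt n y t),
    a n.castSucc - 1 ≤ lvl (o.Y 1 ω) ∧ lvl (o.Y 1 ω) < a n.succ + 1

/-- After time `t`, `X^{S,S}` and `X^{S,B}` do not jump when `Y_{r-} ≤ ⌊m_n⌋`, `X^{B,B}` and `X^{B,S}`
do not jump when `Y_{r-} ≥ ⌈m_n⌉`, `θ^{B,T}` vanishes when `Y_{r-} ≥ ⌊m_n⌋`, and `θ^{S,T}` vanishes
when `Y_{r-} ≤ ⌈m_n⌉`. -/
def TradesTowardsMiddle [MeasurableSpace Ω] (P : Measure Ω) {N : ℕ} (v : Fin N → ℝ)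
    (a : Fin (N + 1) → EReal) (vt : Ω → ℝ) (θ : Rates Ω) (n : Fin N) (y : ℤ) (t : Time) : Prop :=
  ∀ᵐ ω ∂(o.condLaw P v vt n y t),
    (∀ r ∈ Set.Ioc t 1,
      (lvl (o.Yleft r ω) ≤ lowMid a n → r ∉ o.timesSS ω ∧ r ∉ o.timesSB ω) ∧
      (upMid a n ≤ lvl (o.Yleft r ω) → r ∉ o.timesBB ω ∧ r ∉ o.timesBS ω)) ∧
    (∀ᵐ r : Time, r ∈ Set.Ioc t 1 →
      (lowMid a n ≤ lvl (o.Yleft r ω) → θ.BT r ω = 0) ∧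
      (lvl (o.Yleft r ω) ≤ upMid a n → θ.ST r ω = 0))

end OrderFlow

end GlostenMilgrom

end

/-!
The proof is a verification argument with `U` as the candidate for the value function: `U` is
evaluated along the total demand `Y`, and every order is compared with the change of `U` which it
causes.

*The function `U`.* The price `p(y, t)` is the expectation of the terminal price under a Skellam
law, so it is the exponential of a bounded difference operator applied to the terminal price
(`Bdd.integral_skellam`) and solves the backward equation `price_sub_terminalPrice`. The integral
term in `U` is built such that this equation turns into exact formulas for the increments of `U`:
below the middle level, a purchase changes `U` by `p(y + 1, t) - v_n`, above it a sale changes `U`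
by `v_n - p(y - 1, t)`, and across the middle level `U` does not change
(`U_add_one_of_low`, `U_add_one_of_up`, `U_mid`). So a purchase below the middle level and a sale
above it gain nothing on top of the change of `U`. A purchase above and a sale below the middle
level have an excess gain `p(y, t) - p(y + 1, t) ≤ 0` or `p(y - 1, t) - p(y, t) ≤ 0`, and similarly
for orders which cancel a noise order. The one step across the middle level adds the terms
`lossAtLow` and `lossAtUp` (`gain_buy`, `gain_sell`, `gain_cancelSell`, `gain_cancelBuy`). The same
identities show that the noise orders, with rates `β`, and the time derivative of `U` cancel up to
these two terms (`generator_U`).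

*From paths to expectations.* Since `Y` is a step path, the change of variables formula for `U` is
elementary, and gives the profit on every path as `U(v_n, Y_t, t) - U(v_n, Y_1, 1)` plus sums of
bounded functions of `(Y_{s-}, s)` over the eight kinds of jump times (`profit_add_terminalU`).
The left limit of `Y` is predictable, so these sums have the same expectations, given an event
known at time `t`, as their compensators (`IsJumpPart.compensation`). For the insider's orders
this is the definition of an intensity. For the noise orders it has to be shown that `β` is their
intensity in the insider's filtration, which is only given as the least usual filtration containing
the information (`hasIntensity_noise`): its events agree before any later time, up to null sets,
with events of the raw filtration, of which the later increments of the noise are independent.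
Adding up, the compensators of the terms `lossAtLow`, `lossAtUp` are the two parts of `L`, and

  `J = U - L + E[sum of the excess gains] - E[U(v_n, Y_1, 1)]`

(`AreCompensators.expectation_identity`). The excess gains are nonpositive and the terminal `U` is
nonnegative, which is the inequality. Both vanish under the conditions for equality. For the orders
topping up noise orders these conditions concern the intensities only, and so the compensators are
used once more.
-/

namespace GlostenMilgrom

open Filter Topology

/-! ### Skellam averages as an operator semigroup -/

/-- The Banach space of bounded functions on `ℤ`. It is a type synonym, for which only the
normed structure is visible to instance search. -/
def Bdd : Type := BoundedContinuousFunction ℤ ℝ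

noncomputable instance : NormedAddCommGroup Bdd :=
  inferInstanceAs (NormedAddCommGroup (BoundedContinuousFunction ℤ ℝ))

noncomputable instance : NormedSpace ℝ Bdd :=
  inferInstanceAs (NormedSpace ℝ (BoundedContinuousFunction ℤ ℝ))

instance : CompleteSpace Bdd :=
  inferInstanceAs (CompleteSpace (BoundedContinuousFunction ℤ ℝ))

namespace Bdd

/-- Evaluation at an integer. -/
noncomputable def eval (k : ℤ) : Bdd →L[ℝ] ℝ := BoundedContinuousFunction.evalCLM ℝ k

lemma abs_eval_le (k : ℤ) (f : Bdd) : |eval k f| ≤ ‖f‖ :=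
  BoundedContinuousFunction.norm_coe_le_norm (α := ℤ) (β := ℝ) f k

/-- A bounded function on `ℤ`, as an element of `Bdd`. -/
noncomputable def ofBound (f : ℤ → ℝ) (C : ℝ) (hf : ∀ k, |f k| ≤ C) : Bdd :=
  BoundedContinuousFunction.ofNormedAddCommGroup f continuous_of_discreteTopology C hf

@[simp] lemma eval_ofBound (f : ℤ → ℝ) (C : ℝ) (hf : ∀ k, |f k| ≤ C) (k : ℤ) :
    eval k (ofBound f C hf) = f k := rfl

/-- Translation by `d`. -/
noncomputable def shift (d : ℤ) : Bdd →L[ℝ] Bdd :=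
  LinearMap.mkContinuous
    { toFun := fun f => BoundedContinuousFunction.compContinuous f
        ⟨fun k => k + d, continuous_of_discreteTopology⟩
      map_add' := fun _ _ => rfl
      map_smul' := fun _ _ => rfl } 1 (fun f => by
        rw [one_mul]
        exact (BoundedContinuousFunction.norm_le (norm_nonneg _)).2 fun k => abs_eval_le _ f)

@[simp] lemma eval_shift (d : ℤ) (f : Bdd) (k : ℤ) : eval k (shift d f) = eval (k + d) f := rfl

@[ext] lemma ext {f g : Bdd} (hfg : ∀ k, eval k f = eval k g) : f = g :=
  BoundedContinuousFunction.ext hfg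

lemma eval_shift_pow (d : ℤ) (i : ℕ) (f : Bdd) (k : ℤ) :
    eval k (((shift d) ^ i) f) = eval (k + i * d) f := by
  induction i generalizing k with
  | zero => simp
  | succ i ih =>
    rw [pow_succ', mul_apply_eq_comp, eval_shift, ih]
    congr 2; push_cast; ring

lemma commute_shift (d e : ℤ) : Commute (shift d) (shift e) := by
  ext f k
  simp only [mul_apply_eq_comp, eval_shift]
  congr 2; ring

lemma hasSum_eval_exp (A : Bdd →L[ℝ] Bdd) (f : Bdd) (k : ℤ) :
    HasSum (fun i : ℕ => ((i.factorial : ℝ)⁻¹) * eval k ((A ^ i) f))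
      (eval k (NormedSpace.exp A f)) := by
  have h := NormedSpace.exp_series_hasSum_exp' (𝕂 := ℝ) A
  have h2 := h.mapL (eval k ∘L ContinuousLinearMap.apply ℝ _ f)
  simpa using h2

/-- The generator of the noise demand. -/
noncomputable def noiseGenerator : Bdd →L[ℝ] Bdd := (shift 1 - 1) + (shift (-1) - 1)

/-- Averaging over a Poisson number of translations is the exponential of a difference operator. -/
lemma eval_exp_shift (r : ℝ≥0) (d : ℤ) (f : Bdd) (k : ℤ) :
    eval k (NormedSpace.exp ((r : ℝ) • (shift d - 1)) f)
      = ∫ i : ℕ, eval (k + i * d) f ∂(poissonMeasure r) := by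
  have h1 : (r : ℝ) • (shift d - 1) = (r : ℝ) • shift d + (-r : ℝ) • 1 := by
    rw [smul_sub, neg_smul, sub_eq_add_neg]
  let : NormedAlgebra ℚ (Bdd →L[ℝ] Bdd) := NormedAlgebra.restrictScalars ℚ ℝ _
  have h2 : NormedSpace.exp ((-r : ℝ) • (1 : Bdd →L[ℝ] Bdd)) = Real.exp (-r) • 1 := by
    rw [← Algebra.algebraMap_eq_smul_one, ← Algebra.algebraMap_eq_smul_one,
      ← NormedSpace.algebraMap_exp_comm, Real.exp_eq_exp_ℝ]
  rw [h1, NormedSpace.exp_add_of_commute ((Commute.one_right _).smul_left _ |>.smul_right _), h2,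
    mul_apply_eq_comp, smul_apply,
    one_apply_eq_self, integral_poissonMeasure]
  rw [map_smul, map_smul, smul_eq_mul, ← (hasSum_eval_exp _ f k).tsum_eq, ← tsum_mul_left]
  congr 1; ext i
  rw [smul_pow, smul_apply, map_smul, eval_shift_pow]
  simp only [smul_eq_mul]; field_simp

lemma integral_skellam (r : ℝ≥0) (f : Bdd) (y : ℤ) :
    ∫ k, eval (y + k) f ∂(skellam r) = eval y (NormedSpace.exp ((r : ℝ) • noiseGenerator) f) := by
  let : NormedAlgebra ℚ (Bdd →L[ℝ] Bdd) := NormedAlgebra.restrictScalars ℚ ℝ _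
  have hc : Commute ((r : ℝ) • (shift 1 - 1)) ((r : ℝ) • (shift (-1) - 1)) := by
    refine Commute.smul_left (Commute.smul_right ?_ _) _
    exact ((commute_shift 1 (-1)).sub_left (Commute.one_left _)).sub_right (Commute.one_right _)
  rw [noiseGenerator, smul_add, NormedSpace.exp_add_of_commute hc,
    mul_apply_eq_comp, eval_exp_shift]
  simp_rw [eval_exp_shift]
  rw [skellam, integral_map Measurable.of_discrete.aemeasurable
    (Measurable.of_discrete (f := fun k => eval (y + k) f)).aestronglyMeasurable, integral_prod]
  · congr 1; ext i; congr 1; ext j; congr 2; ring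
  · refine Integrable.of_bound Measurable.of_discrete.aestronglyMeasurable ‖f‖ ?_
    exact Filter.Eventually.of_forall fun q => abs_eval_le _ f

/-- The expectation of a bounded function of the noise demand solves the forward equation. -/
lemma hasDerivAt_exp_noiseGenerator (f : Bdd) (y : ℤ) (r : ℝ) :
    HasDerivAt (fun r : ℝ => eval y (NormedSpace.exp (r • noiseGenerator) f))
      (eval (y + 1) (NormedSpace.exp (r • noiseGenerator) f)
        - 2 * eval y (NormedSpace.exp (r • noiseGenerator) f)
        + eval (y - 1) (NormedSpace.exp (r • noiseGenerator) f)) r := by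
  have h := hasDerivAt_exp_smul_const' noiseGenerator r
  have h2 := (eval y ∘L ContinuousLinearMap.apply ℝ _ f).hasFDerivAt.comp_hasDerivAt r h
  refine HasDerivAt.congr_deriv
    (f := fun r : ℝ => eval y (NormedSpace.exp (r • noiseGenerator) f)) h2 ?_
  change eval y (noiseGenerator (NormedSpace.exp (r • noiseGenerator) f)) = _
  generalize NormedSpace.exp (r • noiseGenerator) f = g
  simp [noiseGenerator, ← sub_eq_add_neg]
  ring

end Bdd

instance (r : ℝ≥0) : IsProbabilityMeasure (skellam r) :=
  Measure.isProbabilityMeasure_map Measurable.of_discrete.aemeasurable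

/-! ### Levels and the terminal price -/

section Levels

variable {N : ℕ} {v : Fin N → ℝ} {a : Fin (N + 1) → EReal}

@[simp] lemma lvl_le_lvl {j k : ℤ} : lvl j ≤ lvl k ↔ j ≤ k := by
  simp [lvl]

@[simp] lemma lvl_lt_lvl {j k : ℤ} : lvl j < lvl k ↔ j < k := by
  simp [lvl]

@[simp] lemma lvl_inj {j k : ℤ} : lvl j = lvl k ↔ j = k := by
  simp [lvl]

lemma bot_lt_lvl (k : ℤ) : ⊥ < lvl k := EReal.bot_lt_coe _

lemma lvl_lt_top (k : ℤ) : lvl k < ⊤ := EReal.coe_lt_top _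

lemma exists_mem_interval (h0 : a 0 = ⊥) (h1 : a (Fin.last N) = ⊤) (y : ℤ) :
    ∃ m, y ∈ interval a m := by
  by_contra! hcon
  have key : ∀ i : Fin (N + 1), a i ≤ lvl y := by
    intro i
    induction i using Fin.induction with
    | zero => rw [h0]; exact bot_le
    | succ i ih =>
      by_contra! hlt
      exact hcon i ⟨ih, hlt⟩
  exact absurd (key (Fin.last N)) (by rw [h1]; exact not_le.2 (lvl_lt_top y))

/-- The index of the interval is monotone in the demand level. -/
lemma interval_index_mono (hs : StrictMono a) {y y' : ℤ} {m m' : Fin N} (hy : y ∈ interval a m)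
    (hy' : y' ∈ interval a m') (h : y ≤ y') : m ≤ m' := by
  by_contra! hlt
  have h1 : a m'.succ ≤ a m.castSucc := hs.monotone (Fin.succ_le_castSucc_iff.2 hlt)
  have h2 := hy'.2.trans_le (h1.trans hy.1)
  simp at h2; omega

lemma terminalPrice_eq (hs : StrictMono a) {y : ℤ} {m : Fin N} (hy : y ∈ interval a m) :
    terminalPrice v a y = v m := by
  rw [terminalPrice, Finset.sum_eq_single m]
  · simp [hy]
  · intro b _ hb
    rw [Set.indicator_of_notMem]
    intro hyb
    exact hb (le_antisymm (interval_index_mono hs hyb hy le_rfl)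
      (interval_index_mono hs hy hyb le_rfl))
  · simp

lemma terminalPrice_mono (hs : StrictMono a) (h0 : a 0 = ⊥) (h1 : a (Fin.last N) = ⊤)
    (hv : StrictMono v) : Monotone (terminalPrice v a) := by
  intro y y' hyy
  obtain ⟨m, hm⟩ := exists_mem_interval h0 h1 y
  obtain ⟨m', hm'⟩ := exists_mem_interval h0 h1 y'
  rw [terminalPrice_eq hs hm, terminalPrice_eq hs hm']
  exact hv.monotone (interval_index_mono hs hm hm' hyy)

lemma abs_terminalPrice_le (y : ℤ) : |terminalPrice v a y| ≤ ∑ n, |v n| := by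
  refine (Finset.abs_sum_le_sum_abs _ _).trans (Finset.sum_le_sum fun n _ => ?_)
  by_cases h : y ∈ interval a n <;> simp [h]

end Levels

/-! ### The pricing rule -/

section Price

variable {N : ℕ} {v : Fin N → ℝ} {a : Fin (N + 1) → EReal} {β : ℝ≥0}

lemma integrable_terminalPrice (y : ℤ) (r : ℝ≥0) :
    Integrable (fun k => terminalPrice v a (y + k)) (skellam r) :=
  Integrable.of_bound Measurable.of_discrete.aestronglyMeasurable (∑ n, |v n|)
    (Filter.Eventually.of_forall fun _ => abs_terminalPrice_le _)

lemma price_eq_integral (y : ℤ) (t : ℝ) :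
    price v a β y t = ∫ k, terminalPrice v a (y + k) ∂(skellam (β * Real.toNNReal (1 - t))) := by
  simp only [price, terminalPrice, h]
  rw [integral_finsetSum]
  · refine Finset.sum_congr rfl fun n _ => ?_
    have : (fun k : ℤ => (interval a n).indicator (fun _ => v n) (y + k))
        = {k | y + k ∈ interval a n}.indicator (fun _ => v n) := by
      ext k; simp [Set.indicator]
    rw [this, integral_indicator (by measurability), setIntegral_const, smul_eq_mul, mul_comm]
  · intro n _
    refine Integrable.of_bound Measurable.of_discrete.aestronglyMeasurable |v n|
      (Filter.Eventually.of_forall fun k => ?_)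
    by_cases h : y + k ∈ interval a n <;> simp [h]

/-- The terminal price as a bounded function on `ℤ`. -/
noncomputable def bddPrice (v : Fin N → ℝ) (a : Fin (N + 1) → EReal) : Bdd :=
  Bdd.ofBound (terminalPrice v a) (∑ n, |v n|) fun _ => abs_terminalPrice_le _

lemma price_eq_exp (y : ℤ) {t : ℝ} (ht : t ≤ 1) :
    price v a β y t =
      Bdd.eval y (NormedSpace.exp ((β * (1 - t)) • Bdd.noiseGenerator) (bddPrice v a)) := by
  rw [price_eq_integral]
  have := Bdd.integral_skellam (β * Real.toNNReal (1 - t)) (bddPrice v a) y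
  rw [NNReal.coe_mul, Real.coe_toNNReal _ (by linarith)] at this
  rw [← this]; rfl

lemma abs_price_le (y : ℤ) (t : ℝ) : |price v a β y t| ≤ ∑ n, |v n| := by
  rw [price_eq_integral]
  have := norm_integral_le_of_norm_le_const (μ := skellam (β * Real.toNNReal (1 - t)))
    (f := fun k => terminalPrice v a (y + k)) (C := ∑ n, |v n|)
    (Filter.Eventually.of_forall fun _ => abs_terminalPrice_le _)
  simpa using this

lemma price_mono (hs : StrictMono a) (h0 : a 0 = ⊥) (h1 : a (Fin.last N) = ⊤)
    (hv : StrictMono v) (t : ℝ) : Monotone fun y => price v a β y t := by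
  intro y y' hyy
  simp only [price_eq_integral]
  exact integral_mono (integrable_terminalPrice _ _) (integrable_terminalPrice _ _)
    fun k => terminalPrice_mono hs h0 h1 hv (by omega)

lemma price_one (y : ℤ) : price v a β y 1 = terminalPrice v a y := by
  rw [price_eq_exp y le_rfl]
  simp [bddPrice]

lemma continuous_price (y : ℤ) : Continuous (price v a β y) := by
  have h1 : price v a β y = fun t : ℝ => Bdd.eval y
      (NormedSpace.exp ((β * (1 - min t 1)) • Bdd.noiseGenerator) (bddPrice v a)) := by
    ext t
    rcases le_total t 1 with ht | ht
    · rw [price_eq_exp y ht, min_eq_left ht]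
    · rw [min_eq_right ht, ← price_eq_exp y le_rfl, price_eq_integral, price_eq_integral]
      rw [Real.toNNReal_of_nonpos (by linarith), sub_self, Real.toNNReal_zero]
  rw [h1]
  have h2 : Continuous fun r : ℝ =>
      Bdd.eval y (NormedSpace.exp (r • Bdd.noiseGenerator) (bddPrice v a)) :=
    continuous_iff_continuousAt.2 fun r =>
      (Bdd.hasDerivAt_exp_noiseGenerator (bddPrice v a) y r).continuousAt
  exact h2.comp (by fun_prop)

/-- The backward equation for the pricing rule, integrated up to the terminal time. -/
lemma price_sub_terminalPrice (y : ℤ) {t : ℝ} (ht : t ≤ 1) :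
    price v a β y t - terminalPrice v a y = β * ∫ r in t..1,
      (price v a β (y + 1) r - 2 * price v a β y r + price v a β (y - 1) r) := by
  have hd : ∀ r ∈ Set.Ioo t 1, HasDerivAt (price v a β y) (-(β : ℝ) *
      (price v a β (y + 1) r - 2 * price v a β y r + price v a β (y - 1) r)) r := by
    intro r hr
    have h1 := (Bdd.hasDerivAt_exp_noiseGenerator (bddPrice v a) y (β * (1 - r))).comp r
      (((hasDerivAt_id r).const_sub 1).const_mul (β : ℝ))
    have h2 : (fun s => price v a β y s) =ᶠ[nhds r] fun s => Bdd.eval y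
        (NormedSpace.exp ((β * (1 - s)) • Bdd.noiseGenerator) (bddPrice v a)) := by
      filter_upwards [Iio_mem_nhds hr.2] with s hs
      exact price_eq_exp y (le_of_lt hs)
    refine (h1.congr_of_eventuallyEq h2).congr_deriv ?_
    rw [price_eq_exp _ hr.2.le, price_eq_exp _ hr.2.le, price_eq_exp _ hr.2.le]
    simp; ring
  have h3 := intervalIntegral.integral_eq_sub_of_hasDerivAt_of_le ht
    (continuous_price y).continuousOn hd (Continuous.intervalIntegrable
      (((continuous_price (v := v) (a := a) (β := β) (y + 1)).sub
        ((continuous_price y).const_smul (2 : ℝ))).add (continuous_price (y - 1)) |>.const_smul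
          (-(β : ℝ))) _ _)
  rw [intervalIntegral.integral_const_mul, price_one] at h3
  linarith

end Price

/-! ### Middle levels -/

section Middle

variable {Ω : Type*} [MeasurableSpace Ω] {P : Measure Ω} {N : ℕ} {v : Fin N → ℝ}
  {a : Fin (N + 1) → EReal} {β : ℝ≥0} {vt : Ω → ℝ}

/-- The possible shapes of the `n`-th interval: unbounded below, unbounded above, or finite with an
even number of elements, in which case the two middle elements are `m - 1` and `m`. -/
lemma MiddleLevelAssumption.cases (ha : MiddleLevelAssumption P v a β vt) (hN : 2 ≤ N)
    (n : Fin N) :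
    (∃ c : ℤ, a n.castSucc = ⊥ ∧ a n.succ = lvl c ∧ lowMid a n = ⊥ ∧ upMid a n = ⊥) ∨
    (∃ b : ℤ, a n.castSucc = lvl b ∧ a n.succ = ⊤ ∧ lowMid a n = ⊤ ∧ upMid a n = ⊤) ∨
    (∃ b c m : ℤ, a n.castSucc = lvl b ∧ a n.succ = lvl c ∧ b < m ∧ m < c ∧
      lowMid a n = lvl (m - 1) ∧ upMid a n = lvl m ∧ lowMidInt a n = m - 1 ∧
      upMidInt a n = m) := by
  have hlt : a n.castSucc < a n.succ := ha.strictMono Fin.castSucc_lt_succ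
  have hinf : a n.castSucc = ⊥ → a n.succ = ⊤ → False := by
    intro h0 h1
    have e0 : n.castSucc = 0 := ha.strictMono.injective (h0.trans ha.first.symm)
    have e1 : n.succ = Fin.last N := ha.strictMono.injective (h1.trans ha.last.symm)
    simp only [Fin.ext_iff, Fin.val_castSucc, Fin.val_zero, Fin.val_succ, Fin.val_last] at e0 e1
    omega
  have h2 : (2 : EReal) = ((2 : ℝ) : EReal) := rfl
  have h3 : (1 : EReal) = ((1 : ℝ) : EReal) := rfl
  rcases ha.integral n.castSucc with hb | hb | ⟨b, hb⟩
  · rcases ha.integral n.succ with hc | hc | ⟨c, hc⟩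
    · rw [hb, hc] at hlt; exact absurd hlt (lt_irrefl _)
    · exact (hinf hb hc).elim
    · have hm : mid a n = ⊥ := by
        rw [mid, hb, hc, EReal.bot_add, EReal.bot_sub, h2, EReal.bot_div_of_pos_ne_top (by norm_num)
          (EReal.coe_ne_top _)]
      exact Or.inl ⟨c, hb, hc, by simp [lowMid, hm], by simp [upMid, hm]⟩
  · rw [hb] at hlt; exact absurd hlt not_top_lt
  · rcases ha.integral n.succ with hc | hc | ⟨c, hc⟩
    · rw [hc] at hlt; exact absurd hlt not_lt_bot
    · have hm : mid a n = ⊤ := by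
        rw [mid, hb, hc, lvl, EReal.coe_add_top, h3, EReal.top_sub_coe, h2,
          EReal.top_div_of_pos_ne_top (by norm_num) (EReal.coe_ne_top _)]
      exact Or.inr (Or.inl ⟨b, hb, hc, by simp [lowMid, hm], by simp [upMid, hm]⟩)
    · have hm : mid a n = (((b + c - 1) / 2 : ℝ) : EReal) := by
        rw [mid, hb, hc, lvl, lvl, h2, h3, ← EReal.coe_add, ← EReal.coe_sub, ← EReal.coe_div]
      rw [hb, hc, lvl_lt_lvl] at hlt
      rcases Int.even_or_odd' (b + c) with ⟨m, hbc | hbc⟩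
      · have hbc' : (b + c : ℝ) = 2 * m := by exact_mod_cast hbc
        have hm' : mid a n = ((m - 1 / 2 : ℝ) : EReal) := by
          rw [hm, hbc']; congr 1; ring
        have hnb : ¬ (mid a n = ⊥ ∨ mid a n = ⊤) := by
          rw [hm']; simp only [EReal.coe_ne_bot, EReal.coe_ne_top, or_self, not_false_eq_true]
        have hl : lowMidInt a n = m - 1 := by
          rw [lowMidInt, hm', EReal.toReal_coe, Int.floor_eq_iff]
          push_cast; constructor <;> linarith
        have hu : upMidInt a n = m := by
          rw [upMidInt, hm', EReal.toReal_coe, Int.ceil_eq_iff]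
          constructor <;> linarith
        refine Or.inr (Or.inr ⟨b, c, m, hb, hc, by omega, by omega, ?_, ?_, hl, hu⟩)
        · rw [lowMid, if_neg hnb, hl]
        · rw [upMid, if_neg hnb, hu]
      · exfalso
        refine ha.mid_not_int n m ?_
        have hbc' : (b + c : ℝ) = 2 * m + 1 := by exact_mod_cast hbc
        rw [hm, hbc', lvl]; congr 1; ring

/-- No demand level lies strictly between `⌊m_n⌋` and `⌈m_n⌉`, also when `m_n` is infinite. -/
lemma MiddleLevelAssumption.not_low_iff (ha : MiddleLevelAssumption P v a β vt) (hN : 2 ≤ N)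
    (n : Fin N) (y : ℤ) : ¬ lvl y ≤ lowMid a n ↔ upMid a n ≤ lvl y := by
  rcases ha.cases hN n with ⟨c, -, -, hl, hu⟩ | ⟨b, -, -, hl, hu⟩ | ⟨b, c, m, -, -, -, -, hl, hu, -⟩
  · simp [hl, hu, (bot_lt_lvl y).ne']
  · simp [hl, hu, (lvl_lt_top y).ne]
  · simp only [hl, hu, lvl_le_lvl]; omega

lemma low_of_le {n : Fin N} {y y' : ℤ} (h : y ≤ y') (hy : lvl y' ≤ lowMid a n) :
    lvl y ≤ lowMid a n := (lvl_le_lvl.2 h).trans hy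

lemma up_of_le {n : Fin N} {y y' : ℤ} (h : y ≤ y') (hy : upMid a n ≤ lvl y) :
    upMid a n ≤ lvl y' := hy.trans (lvl_le_lvl.2 h)

lemma MiddleLevelAssumption.eq_upMid_iff (ha : MiddleLevelAssumption P v a β vt) (hN : 2 ≤ N)
    (n : Fin N) (y : ℤ) :
    lvl y = upMid a n ↔ upMid a n ≤ lvl y ∧ lvl (y - 1) ≤ lowMid a n := by
  rcases ha.cases hN n with ⟨c, -, -, hl, hu⟩ | ⟨b, -, -, hl, hu⟩ | ⟨b, c, m, -, -, -, -, hl, hu, -⟩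
  · simp [hl, hu, (bot_lt_lvl _).ne']
  · simp [hl, hu, (lvl_lt_top _).ne]
  · simp only [hl, hu, lvl_le_lvl, lvl_inj]; omega

lemma MiddleLevelAssumption.eq_lowMid_iff (ha : MiddleLevelAssumption P v a β vt) (hN : 2 ≤ N)
    (n : Fin N) (y : ℤ) :
    lvl y = lowMid a n ↔ lvl y ≤ lowMid a n ∧ upMid a n ≤ lvl (y + 1) := by
  rcases ha.cases hN n with ⟨c, -, -, hl, hu⟩ | ⟨b, -, -, hl, hu⟩ | ⟨b, c, m, -, -, -, -, hl, hu, -⟩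
  · simp [hl, hu, (bot_lt_lvl _).ne']
  · simp [hl, hu, (lvl_lt_top _).ne]
  · simp only [hl, hu, lvl_le_lvl, lvl_inj]; omega

lemma MiddleLevelAssumption.eq_upMid_add_one_iff (ha : MiddleLevelAssumption P v a β vt)
    (hN : 2 ≤ N) (n : Fin N) (y : ℤ) :
    lvl y = upMid a n + 1 ↔ lvl (y - 1) = upMid a n := by
  have h3 : (1 : EReal) = ((1 : ℝ) : EReal) := rfl
  rcases ha.cases hN n with ⟨c, -, -, hl, hu⟩ | ⟨b, -, -, hl, hu⟩ | ⟨b, c, m, -, -, -, -, hl, hu, -⟩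
  · simp [hu, (bot_lt_lvl _).ne']
  · have h4 : (⊤ : EReal) + 1 = ⊤ := EReal.top_add_coe 1
    rw [hu, h4]; simp [(lvl_lt_top _).ne]
  · have : lvl m + 1 = lvl (m + 1) := by rw [h3, lvl, lvl]; norm_cast
    rw [hu, this, lvl_inj, lvl_inj]; omega

lemma MiddleLevelAssumption.eq_lowMid_sub_one_iff (ha : MiddleLevelAssumption P v a β vt)
    (hN : 2 ≤ N) (n : Fin N) (y : ℤ) :
    lvl y = lowMid a n - 1 ↔ lvl (y + 1) = lowMid a n := by
  have h3 : (1 : EReal) = ((1 : ℝ) : EReal) := rfl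
  rcases ha.cases hN n with ⟨c, -, -, hl, hu⟩ | ⟨b, -, -, hl, hu⟩ | ⟨b, c, m, -, -, -, -, hl, hu, -⟩
  · simp [hl, (bot_lt_lvl _).ne']
  · have h4 : (⊤ : EReal) - 1 = ⊤ := EReal.top_sub_coe 1
    rw [hl, h4]; simp [(lvl_lt_top _).ne]
  · have : lvl (m - 1) - 1 = lvl (m - 1 - 1) := by
      rw [h3, lvl, lvl, ← EReal.coe_sub]; push_cast; rfl
    rw [hl, this, lvl_inj, lvl_inj]; omega

lemma MiddleLevelAssumption.midInt_of_eq_upMid (ha : MiddleLevelAssumption P v a β vt)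
    (hN : 2 ≤ N) {n : Fin N} {y : ℤ} (hy : lvl y = upMid a n) :
    lowMidInt a n = y - 1 ∧ upMidInt a n = y := by
  rcases ha.cases hN n with ⟨c, -, -, hl, hu⟩ | ⟨b, -, -, hl, hu⟩ |
    ⟨b, c, m, -, -, -, -, hl, hu, hli, hui⟩
  · exact absurd (hy.trans hu) (bot_lt_lvl _).ne'
  · exact absurd (hy.trans hu) (lvl_lt_top _).ne
  · rw [hu, lvl_inj] at hy; subst hy; exact ⟨hli, hui⟩

lemma MiddleLevelAssumption.midInt_of_eq_lowMid (ha : MiddleLevelAssumption P v a β vt)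
    (hN : 2 ≤ N) {n : Fin N} {y : ℤ} (hy : lvl y = lowMid a n) :
    lowMidInt a n = y ∧ upMidInt a n = y + 1 := by
  rcases ha.cases hN n with ⟨c, -, -, hl, hu⟩ | ⟨b, -, -, hl, hu⟩ |
    ⟨b, c, m, -, -, -, -, hl, hu, hli, hui⟩
  · exact absurd (hy.trans hl) (bot_lt_lvl _).ne'
  · exact absurd (hy.trans hl) (lvl_lt_top _).ne
  · rw [hl, lvl_inj] at hy; subst hy; exact ⟨hli, by omega⟩

/-! ### The terminal values of `U` -/

lemma MiddleLevelAssumption.exists_left (ha : MiddleLevelAssumption P v a β vt) (hN : 2 ≤ N)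
    {n : Fin N} {y : ℤ} (hy : lvl y ≤ lowMid a n) :
    ∃ b : ℤ, a n.castSucc = lvl b ∧ lvl y < a n.succ := by
  rcases ha.cases hN n with ⟨c, -, -, hl, hu⟩ | ⟨b, hb, hc, hl, hu⟩ |
    ⟨b, c, m, hb, hc, hbm, hmc, hl, hu, -⟩
  · rw [hl] at hy; exact absurd hy (not_le.2 (bot_lt_lvl _))
  · exact ⟨b, hb, hc ▸ lvl_lt_top _⟩
  · refine ⟨b, hb, ?_⟩
    rw [hl, lvl_le_lvl] at hy
    rw [hc, lvl_lt_lvl]; omega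

lemma MiddleLevelAssumption.exists_right (ha : MiddleLevelAssumption P v a β vt) (hN : 2 ≤ N)
    {n : Fin N} {y : ℤ} (hy : upMid a n ≤ lvl y) :
    ∃ c : ℤ, a n.succ = lvl c ∧ a n.castSucc ≤ lvl y := by
  rcases ha.cases hN n with ⟨c, hb, hc, hl, hu⟩ | ⟨b, hb, hc, hl, hu⟩ |
    ⟨b, c, m, hb, hc, hbm, hmc, hl, hu, -⟩
  · exact ⟨c, hc, hb ▸ bot_le⟩
  · rw [hu] at hy; exact absurd hy (not_le.2 (lvl_lt_top _))
  · refine ⟨c, hc, ?_⟩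
    rw [hu, lvl_le_lvl] at hy
    rw [hb, lvl_le_lvl]; omega

lemma MiddleLevelAssumption.terminalU_of_low (ha : MiddleLevelAssumption P v a β vt) (hN : 2 ≤ N)
    {n : Fin N} {y b : ℤ} (hy : lvl y ≤ lowMid a n) (hb : a n.castSucc = lvl b) :
    terminalU v a n y = ∑ j ∈ Finset.Icc y (b - 1), (v n - terminalPrice v a (j + 1)) := by
  have hu : ¬ upMid a n ≤ lvl y := by rwa [← ha.not_low_iff hN, not_not]
  rw [terminalU, if_pos hy, if_neg hu, add_zero, hb]
  simp [lvl]

lemma MiddleLevelAssumption.terminalU_of_up (ha : MiddleLevelAssumption P v a β vt) (hN : 2 ≤ N)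
    {n : Fin N} {y c : ℤ} (hy : upMid a n ≤ lvl y) (hc : a n.succ = lvl c) :
    terminalU v a n y = ∑ j ∈ Finset.Icc c y, (terminalPrice v a (j - 1) - v n) := by
  have hl : ¬ lvl y ≤ lowMid a n := (ha.not_low_iff hN n y).2 hy
  rw [terminalU, if_pos hy, if_neg hl, zero_add, hc]
  simp [lvl]

lemma MiddleLevelAssumption.terminalU_add_one_of_low (ha : MiddleLevelAssumption P v a β vt)
    (hN : 2 ≤ N) {n : Fin N} {y : ℤ} (hy : lvl (y + 1) ≤ lowMid a n) :
    terminalU v a n (y + 1) - terminalU v a n y = terminalPrice v a (y + 1) - v n := by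
  obtain ⟨b, hb, hlt⟩ := ha.exists_left hN hy
  rw [ha.terminalU_of_low hN hy hb, ha.terminalU_of_low hN (low_of_le (by omega) hy) hb]
  rcases le_or_gt b y with h | h
  · rw [Finset.Icc_eq_empty (by omega), Finset.Icc_eq_empty (by omega)]
    rw [terminalPrice_eq ha.strictMono (m := n) ⟨by rw [hb, lvl_le_lvl]; omega, hlt⟩]
    simp
  · rw [← Finset.insert_Icc_add_one_left_eq_Icc (a := y) (b := b - 1) (by omega),
      Finset.sum_insert (by simp)]
    ring

lemma MiddleLevelAssumption.terminalU_add_one_of_up (ha : MiddleLevelAssumption P v a β vt)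
    (hN : 2 ≤ N) {n : Fin N} {y : ℤ} (hy : upMid a n ≤ lvl y) :
    terminalU v a n (y + 1) - terminalU v a n y = terminalPrice v a y - v n := by
  obtain ⟨c, hc, hle⟩ := ha.exists_right hN hy
  rw [ha.terminalU_of_up hN hy hc, ha.terminalU_of_up hN (up_of_le (by omega) hy) hc]
  rcases le_or_gt c (y + 1) with h | h
  · rw [← Finset.insert_Icc_right_eq_Icc_add_one (a := c) (b := y) (by omega),
      Finset.sum_insert (by simp)]
    simp
  · rw [Finset.Icc_eq_empty (by omega), Finset.Icc_eq_empty (by omega)]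
    rw [terminalPrice_eq ha.strictMono (m := n) ⟨hle, by rw [hc, lvl_lt_lvl]; omega⟩]
    simp

/-- The terminal `U` vanishes on the enlarged interval `[a_n - 1, a_{n+1} + 1)`, because only the
one price `P(a_n) = v_n` or `P(a_{n+1} - 1) = v_n` enters the sum at its end points. -/
lemma MiddleLevelAssumption.terminalU_eq_zero (ha : MiddleLevelAssumption P v a β vt)
    (hN : 2 ≤ N) {n : Fin N} {y : ℤ} (h0 : a n.castSucc - 1 ≤ lvl y) (h1 : lvl y < a n.succ + 1) :
    terminalU v a n y = 0 := by
  have h3 : (1 : EReal) = ((1 : ℝ) : EReal) := rfl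
  by_cases hy : lvl y ≤ lowMid a n
  · obtain ⟨b, hb, hlt⟩ := ha.exists_left hN hy
    rw [ha.terminalU_of_low hN hy hb]
    have h0' : b - 1 ≤ y := by
      rw [hb, lvl, lvl, h3, ← EReal.coe_sub, EReal.coe_le_coe_iff] at h0
      exact_mod_cast h0
    refine Finset.sum_eq_zero fun j hj => ?_
    rw [Finset.mem_Icc] at hj
    have : j + 1 = b := by omega
    rw [this, terminalPrice_eq ha.strictMono (m := n) ⟨hb.le, ?_⟩, sub_self]
    rw [← hb]; exact ha.strictMono Fin.castSucc_lt_succ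
  · rw [ha.not_low_iff hN] at hy
    obtain ⟨c, hc, hlt⟩ := ha.exists_right hN hy
    rw [ha.terminalU_of_up hN hy hc]
    have h1' : y < c + 1 := by
      rw [hc, lvl, lvl, h3, ← EReal.coe_add, EReal.coe_lt_coe_iff] at h1
      exact_mod_cast h1
    refine Finset.sum_eq_zero fun j hj => ?_
    rw [Finset.mem_Icc] at hj
    have hjc : j - 1 = c - 1 := by omega
    have hac : a n.castSucc ≤ lvl (c - 1) := by
      have := ha.strictMono (Fin.castSucc_lt_succ (i := n))
      rcases ha.integral n.castSucc with hb | hb | ⟨b, hb⟩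
      · rw [hb]; exact bot_le
      · rw [hb] at this; exact absurd this not_top_lt
      · rw [hb, hc, lvl_lt_lvl] at this
        rw [hb, lvl_le_lvl]; omega
    rw [hjc, terminalPrice_eq ha.strictMono (m := n) ⟨hac, by rw [hc, lvl_lt_lvl]; omega⟩, sub_self]

lemma MiddleLevelAssumption.terminalU_nonneg (ha : MiddleLevelAssumption P v a β vt)
    (hN : 2 ≤ N) (hv : StrictMono v) (n : Fin N) (y : ℤ) : 0 ≤ terminalU v a n y := by
  have hmono := terminalPrice_mono ha.strictMono ha.first ha.last hv
  by_cases hy : lvl y ≤ lowMid a n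
  · obtain ⟨b, hb, hlt⟩ := ha.exists_left hN hy
    rw [ha.terminalU_of_low hN hy hb]
    refine Finset.sum_nonneg fun j hj => ?_
    rw [Finset.mem_Icc] at hj
    rw [sub_nonneg, ← terminalPrice_eq (v := v) ha.strictMono (y := b) (m := n) ⟨hb.le, ?_⟩]
    · exact hmono (by omega)
    · rw [← hb]; exact ha.strictMono Fin.castSucc_lt_succ
  · rw [ha.not_low_iff hN] at hy
    obtain ⟨c, hc, hlt⟩ := ha.exists_right hN hy
    rw [ha.terminalU_of_up hN hy hc]
    refine Finset.sum_nonneg fun j hj => ?_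
    rw [Finset.mem_Icc] at hj
    have hac : a n.castSucc ≤ lvl (c - 1) := by
      have := ha.strictMono (Fin.castSucc_lt_succ (i := n))
      rcases ha.integral n.castSucc with hb | hb | ⟨b, hb⟩
      · rw [hb]; exact bot_le
      · rw [hb] at this; exact absurd this not_top_lt
      · rw [hb, hc, lvl_lt_lvl] at this
        rw [hb, lvl_le_lvl]; omega
    rw [sub_nonneg, ← terminalPrice_eq (v := v) ha.strictMono (y := c - 1) (m := n)
      ⟨hac, by rw [hc, lvl_lt_lvl]; omega⟩]
    exact hmono (by omega)

lemma MiddleLevelAssumption.terminalU_mid (ha : MiddleLevelAssumption P v a β vt)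
    (hN : 2 ≤ N) {n : Fin N} {y : ℤ} (hy : lvl y ≤ lowMid a n) (hy' : upMid a n ≤ lvl (y + 1)) :
    terminalU v a n (y + 1) - terminalU v a n y = 0 := by
  rcases ha.cases hN n with ⟨c, -, -, hl, hu⟩ | ⟨b, -, -, hl, hu⟩ |
    ⟨b, c, m, hb, hc, hbm, hmc, hl, hu, hli, hui⟩
  · rw [hl] at hy; exact absurd hy (not_le.2 (bot_lt_lvl _))
  · rw [hu] at hy'; exact absurd hy' (not_le.2 (lvl_lt_top _))
  · have hu' := hy'
    rw [hu, lvl_le_lvl] at hu'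
    have hl' := hy
    rw [hl, lvl_le_lvl] at hl'
    rw [ha.terminalU_of_low hN hy hb, ha.terminalU_of_up hN hy' hc, Finset.Icc_eq_empty (by omega),
      Finset.Icc_eq_empty (by omega)]
    simp

/-! ### Increments of `U` -/

lemma U_of_up {n : Fin N} {y : ℤ} (t : ℝ) (hy : upMid a n ≤ lvl y) :
    U v a β n y t = terminalU v a n y +
      β * ∫ r in t..1, (price v a β y r - price v a β (y - 1) r) := by
  simp [U, hy]

lemma MiddleLevelAssumption.U_of_low (ha : MiddleLevelAssumption P v a β vt) (hN : 2 ≤ N)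
    {n : Fin N} {y : ℤ} (t : ℝ) (hy : lvl y ≤ lowMid a n) :
    U v a β n y t = terminalU v a n y +
      β * ∫ r in t..1, (price v a β (y + 1) r - price v a β y r) := by
  have hu : ¬ upMid a n ≤ lvl y := by rwa [← ha.not_low_iff hN, not_not]
  simp [U, hu]

lemma intervalIntegrable_price (y : ℤ) (s t : ℝ) :
    IntervalIntegrable (price v a β y) volume s t := (continuous_price y).intervalIntegrable _ _

lemma integral_price_secondDiff (y : ℤ) (t : ℝ) :
    ∫ r in t..1, (price v a β (y + 1) r - 2 * price v a β y r + price v a β (y - 1) r) =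
      (∫ r in t..1, price v a β (y + 1) r) - 2 * (∫ r in t..1, price v a β y r) +
      ∫ r in t..1, price v a β (y - 1) r := by
  have hi := fun y => intervalIntegrable_price (v := v) (a := a) (β := β) y t 1
  rw [intervalIntegral.integral_add ((hi _).sub ((hi _).const_mul 2)) (hi _),
    intervalIntegral.integral_sub (hi _) ((hi _).const_mul 2), intervalIntegral.integral_const_mul]

lemma integral_price_sub (y z : ℤ) (t : ℝ) :
    ∫ r in t..1, (price v a β y r - price v a β z r) =
      (∫ r in t..1, price v a β y r) - ∫ r in t..1, price v a β z r :=
  intervalIntegral.integral_sub (intervalIntegrable_price _ _ _) (intervalIntegrable_price _ _ _)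

/-- Below the middle level, `U` decreases by the insider's gain `v_n - p` from a purchase. -/
lemma MiddleLevelAssumption.U_add_one_of_low (ha : MiddleLevelAssumption P v a β vt)
    (hN : 2 ≤ N) {n : Fin N} {y : ℤ} {t : ℝ} (ht : t ≤ 1) (hy : lvl (y + 1) ≤ lowMid a n) :
    U v a β n (y + 1) t - U v a β n y t = price v a β (y + 1) t - v n := by
  have h1 := ha.terminalU_add_one_of_low hN hy
  have h2 := price_sub_terminalPrice (v := v) (a := a) (β := β) (y + 1) ht
  rw [ha.U_of_low hN t hy, ha.U_of_low hN t (low_of_le (by omega) hy)]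
  rw [integral_price_secondDiff] at h2
  simp only [integral_price_sub] at h2 ⊢
  rw [add_sub_cancel_right] at h2
  linarith

/-- Above the middle level, `U` grows by the insider's gain `p - v_n` from the sale which leads
back. -/
lemma MiddleLevelAssumption.U_add_one_of_up (ha : MiddleLevelAssumption P v a β vt)
    (hN : 2 ≤ N) {n : Fin N} {y : ℤ} {t : ℝ} (ht : t ≤ 1) (hy : upMid a n ≤ lvl y) :
    U v a β n (y + 1) t - U v a β n y t = price v a β y t - v n := by
  have h1 := ha.terminalU_add_one_of_up hN hy
  have h2 := price_sub_terminalPrice (v := v) (a := a) (β := β) y ht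
  rw [U_of_up t hy, U_of_up t (up_of_le (by omega) hy)]
  rw [integral_price_secondDiff] at h2
  simp only [integral_price_sub] at h2 ⊢
  rw [add_sub_cancel_right]
  linarith

/-- `U` takes the same value at the two levels next to the middle level. -/
lemma MiddleLevelAssumption.U_mid (ha : MiddleLevelAssumption P v a β vt)
    (hN : 2 ≤ N) {n : Fin N} {y : ℤ} (t : ℝ) (hy : lvl y ≤ lowMid a n)
    (hy' : upMid a n ≤ lvl (y + 1)) :
    U v a β n (y + 1) t - U v a β n y t = 0 := by
  have h1 := ha.terminalU_mid hN hy hy'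
  rw [U_of_up t hy', ha.U_of_low hN t hy, add_sub_cancel_right]
  linarith

end Middle

/-! ### Counting paths and their jump times -/

section Paths

variable {f : Time → ℕ}

/-- The first time at which the path `f` reaches `k`, and `1` if it does not. -/
noncomputable def hit (f : Time → ℕ) (k : ℕ) : Time := sInf {s | k ≤ f s}

namespace IsCountingPath

lemma leftLim_zero (hf : IsCountingPath f) : Function.leftLim f 0 = 0 := by
  rw [leftLim_eq_of_isBot (fun x => unitInterval.nonneg x), hf.zero]

lemma eventually_left (hf : IsCountingPath f) (s : Time) :
    ∀ᶠ u in 𝓝[<] s, f u = Function.leftLim f s := by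
  have := hf.mono.tendsto_leftLim s
  rwa [nhds_discrete, tendsto_pure] at this

lemma eventually_right (hf : IsCountingPath f) (s : Time) : ∀ᶠ u in 𝓝[≥] s, f u = f s := by
  have := hf.rightCts s
  rwa [ContinuousWithinAt, nhds_discrete, tendsto_pure] at this

lemma le_leftLim_iff (hf : IsCountingPath f) {k : ℕ} (hk : 1 ≤ k) (s : Time) :
    k ≤ Function.leftLim f s ↔ ∃ u < s, k ≤ f u := by
  constructor
  · intro h
    rcases eq_or_ne s 0 with rfl | hs
    · rw [hf.leftLim_zero] at h; omega
    · have hne : (𝓝[<] s).NeBot := nhdsLT_neBot_of_exists_lt ⟨0, unitInterval.pos_iff_ne_zero.2 hs⟩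
      obtain ⟨u, hu, hus⟩ := ((hf.eventually_left s).and self_mem_nhdsWithin).exists
      exact ⟨u, hus, hu ▸ h⟩
  · rintro ⟨u, hu, hk⟩
    exact hk.trans (hf.mono.le_leftLim hu)

lemma hit_le_iff (hf : IsCountingPath f) {k : ℕ} (hk : k ≤ f 1) (s : Time) :
    hit f k ≤ s ↔ k ≤ f s := by
  constructor
  · intro h
    refine le_trans ?_ (hf.mono h)
    by_contra! hlt
    have h1 : hit f k < 1 := lt_of_le_of_ne unitInterval.le_one' fun h1 => by
      rw [h1] at hlt; omega
    have h2 := hf.eventually_right (hit f k)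
    obtain ⟨w, hw, hw'⟩ := (mem_nhdsGE_iff_exists_Ico_subset' h1).1 h2
    have h3 : w ≤ hit f k := le_sInf fun u hu => by
      by_contra! huw
      have h4 : f u = f (hit f k) := hw' ⟨sInf_le hu, huw⟩
      have h5 : k ≤ f u := hu
      omega
    exact absurd hw (not_lt.2 h3)
  · intro h; exact sInf_le h

lemma apply_hit (hf : IsCountingPath f) {k : ℕ} (hk : 1 ≤ k) (hk1 : k ≤ f 1) :
    f (hit f k) = k ∧ Function.leftLim f (hit f k) < k := by
  have h1 : k ≤ f (hit f k) := (hf.hit_le_iff hk1 _).1 le_rfl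
  have h2 : Function.leftLim f (hit f k) < k := by
    by_contra! h
    obtain ⟨u, hu, hku⟩ := (hf.le_leftLim_iff hk _).1 h
    exact absurd ((hf.hit_le_iff hk1 u).2 hku) (not_le.2 hu)
  have h3 := hf.jump_le (hit f k)
  exact ⟨by omega, h2⟩

lemma jump_iff (hf : IsCountingPath f) (s : Time) :
    Function.leftLim f s ≠ f s ↔ f s = Function.leftLim f s + 1 := by
  have h1 := hf.jump_le s
  have h2 := hf.mono.leftLim_le (le_refl s)
  omega

lemma jumps_eq (hf : IsCountingPath f) :
    {s | Function.leftLim f s ≠ f s} = hit f '' (Finset.Icc 1 (f 1) : Finset ℕ) := by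
  ext s
  simp only [Set.mem_ofPred_eq, Set.mem_image, SetLike.mem_coe, Finset.mem_Icc]
  constructor
  · intro h
    have h1 := (hf.jump_iff s).1 h
    have hs1 : f s ≤ f 1 := hf.mono unitInterval.le_one'
    refine ⟨f s, ⟨by omega, hs1⟩, le_antisymm ((hf.hit_le_iff hs1 s).2 le_rfl) ?_⟩
    by_contra! hlt
    have h2 := (hf.hit_le_iff hs1 _).1 (le_refl (hit f (f s)))
    have h3 := hf.mono.le_leftLim hlt
    omega
  · rintro ⟨k, ⟨hk, hk1⟩, rfl⟩
    have := hf.apply_hit hk hk1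
    omega

lemma hit_injOn (hf : IsCountingPath f) : Set.InjOn (hit f) (Finset.Icc 1 (f 1) : Finset ℕ) := by
  intro k hk l hl hkl
  rw [Finset.mem_coe, Finset.mem_Icc] at hk hl
  rw [← (hf.apply_hit hk.1 hk.2).1, hkl, (hf.apply_hit hl.1 hl.2).1]

lemma finite_jumps (hf : IsCountingPath f) : {s | Function.leftLim f s ≠ f s}.Finite := by
  rw [hf.jumps_eq]; exact (Finset.finite_toSet _).image _

/-- The jumps are the hitting times of `1, …, f 1`, without repetition. -/
lemma tsum_jumps (hf : IsCountingPath f) (C : Time → ℝ≥0∞) :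
    ∑' s : {s | Function.leftLim f s ≠ f s}, C s =
      ∑' k : ℕ, if 1 ≤ k ∧ k ≤ f 1 then C (hit f k) else 0 := by
  rw [hf.jumps_eq, tsum_image C hf.hit_injOn]
  rw [Finset.tsum_subtype' (Finset.Icc 1 (f 1)) fun k => C (hit f k)]
  rw [tsum_eq_sum (s := Finset.Icc 1 (f 1))]
  · refine Finset.sum_congr rfl fun k hk => ?_
    rw [Finset.mem_Icc] at hk; rw [if_pos hk]
  · intro k hk
    rw [Finset.mem_Icc] at hk; rw [if_neg hk]

lemma tsum_jumps_one (hf : IsCountingPath f) :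
    ∑' _ : {s | Function.leftLim f s ≠ f s}, (1 : ℝ≥0∞) = f 1 := by
  rw [hf.jumps_eq, tsum_image (fun _ => 1) hf.hit_injOn,
    Finset.tsum_subtype' (Finset.Icc 1 (f 1)) fun k => 1]
  simp

/-- The number of jumps in `(s, 1]` is the increment of the path. -/
lemma tsum_jumps_Ioi (hf : IsCountingPath f) (s : Time) :
    ∑' u : {u | Function.leftLim f u ≠ f u}, (Set.Ioi s).indicator 1 (u : Time)
      = ((f 1 - f s : ℕ) : ℝ≥0∞) := by
  rw [hf.jumps_eq, tsum_image (fun u => (Set.Ioi s).indicator (1 : Time → ℝ≥0∞) u) hf.hit_injOn,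
    Finset.tsum_subtype' (Finset.Icc 1 (f 1)) fun k => (Set.Ioi s).indicator 1 (hit f k)]
  have h1 : ∀ k ∈ Finset.Icc 1 (f 1), (Set.Ioi s).indicator (1 : Time → ℝ≥0∞) (hit f k)
      = if f s < k then 1 else 0 := by
    intro k hk
    rw [Finset.mem_Icc] at hk
    have := hf.hit_le_iff hk.2 s
    by_cases h : f s < k
    · rw [if_pos h, Set.indicator_of_mem, Pi.one_apply]
      rw [Set.mem_Ioi, ← not_le, this]; omega
    · rw [if_neg h, Set.indicator_of_notMem]
      rw [Set.mem_Ioi, ← not_le, this]; omega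
  rw [Finset.sum_congr rfl h1, Finset.sum_boole]
  congr 1
  have : (Finset.Icc 1 (f 1)).filter (fun k => f s < k) = Finset.Icc (f s + 1) (f 1) := by
    ext k; simp only [Finset.mem_filter, Finset.mem_Icc]; omega
  rw [this, Nat.card_Icc]; omega

end IsCountingPath

end Paths

/-! ### Measurability of jump sums -/

section Measurability

variable {Ω : Type*} {mΩ : MeasurableSpace Ω} {X : Time → Ω → ℕ}

lemma measurable_hit (hX : ∀ t, Measurable (X t)) (hp : ∀ ω, IsCountingPath fun t => X t ω)
    (k : ℕ) : Measurable fun ω => hit (fun t => X t ω) k := by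
  refine measurable_of_Iic fun s => ?_
  rcases eq_or_ne s 1 with rfl | hs
  · have : (fun ω => hit (fun t => X t ω) k) ⁻¹' Set.Iic 1 = Set.univ := by
      ext ω; simp [unitInterval.le_one']
    rw [this]; exact MeasurableSet.univ
  · have : (fun ω => hit (fun t => X t ω) k) ⁻¹' Set.Iic s = {ω | k ≤ X s ω} := by
      ext ω
      by_cases hk : k ≤ X 1 ω
      · simpa using (hp ω).hit_le_iff hk s
      · have h1 : {u : Time | k ≤ X u ω} = ∅ := by
          ext u
          have : X u ω ≤ X 1 ω := (hp ω).mono (unitInterval.le_one' : u ≤ 1)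
          simp only [Set.mem_ofPred_eq, Set.mem_empty_iff_false, iff_false]
          omega
        have h2 : X s ω ≤ X 1 ω := (hp ω).mono (unitInterval.le_one' : s ≤ 1)
        simp only [Set.mem_preimage, Set.mem_Iic, hit, h1, sInf_empty, Set.mem_ofPred_eq]
        constructor
        · intro h
          exact absurd (le_antisymm unitInterval.le_one' h) hs
        · intro h; omega
    rw [this]; exact measurableSet_le measurable_const (hX s)

lemma measurable_uncurry_of_path (hX : ∀ t, Measurable (X t))
    (hp : ∀ ω, IsCountingPath fun t => X t ω) : Measurable fun p : Time × Ω => X p.1 p.2 := by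
  refine measurable_of_Ici fun k => ?_
  have : (fun p : Time × Ω => X p.1 p.2) ⁻¹' Set.Ici k =
      {p | hit (fun t => X t p.2) k ≤ p.1} ∩ {p | k ≤ X 1 p.2} := by
    ext ⟨s, ω⟩
    simp only [Set.mem_preimage, Set.mem_Ici, Set.mem_inter_iff, Set.mem_ofPred_eq]
    constructor
    · intro h
      have h1 := h.trans ((hp ω).mono (unitInterval.le_one' : s ≤ 1))
      exact ⟨((hp ω).hit_le_iff h1 s).2 h, h1⟩
    · rintro ⟨h1, h2⟩
      exact ((hp ω).hit_le_iff h2 s).1 h1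
  rw [this]
  exact (measurableSet_le ((measurable_hit hX hp k).comp measurable_snd) measurable_fst).inter
    (measurableSet_le measurable_const ((hX 1).comp measurable_snd))

/-- The left limits of an adapted counting process form a predictable process. -/
lemma measurable_leftLim_predictable {F : Filtration Time mΩ} (hX : ∀ t, Measurable[F t] (X t))
    (hp : ∀ ω, IsCountingPath fun t => X t ω) :
    Measurable[F.predictable] fun p : Time × Ω => Function.leftLim (fun t => X t p.2) p.1 := by
  let : MeasurableSpace (Time × Ω) := F.predictable
  refine measurable_of_Ici fun k => ?_
  rcases Nat.eq_zero_or_pos k with rfl | hk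
  · simp
  · have : (fun p : Time × Ω => Function.leftLim (fun t => X t p.2) p.1) ⁻¹' Set.Ici k =
        ⋃ u ∈ TopologicalSpace.denseSeq Time '' Set.univ, Set.Ioi u ×ˢ {ω | k ≤ X u ω} := by
      ext ⟨s, ω⟩
      simp only [Set.mem_preimage, Set.mem_Ici, Set.mem_iUnion, Set.mem_prod, Set.mem_Ioi,
        Set.mem_ofPred_eq, exists_prop]
      rw [(hp ω).le_leftLim_iff hk]
      constructor
      · rintro ⟨u, hu, hku⟩
        obtain ⟨w, ⟨i, rfl⟩, h1, h2⟩ :=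
          (TopologicalSpace.denseRange_denseSeq Time).exists_between hu
        exact ⟨_, ⟨i, trivial, rfl⟩, h2, hku.trans ((hp ω).mono h1.le)⟩
      · rintro ⟨u, -, h1, h2⟩
        exact ⟨u, h1, h2⟩
    rw [this]
    refine MeasurableSet.biUnion (Set.countable_univ.image _) fun u _ => ?_
    exact measurableSet_predictable_Ioi_prod (hX u measurableSet_Ici)

lemma predictable_le_prod (F : Filtration Time mΩ) :
    F.predictable ≤ (inferInstance : MeasurableSpace (Time × Ω)) :=
  measurableSpace_le_predictable_of_measurableSet
    (fun _ hA => (measurableSet_singleton _).prod (F.le _ _ hA))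
    (fun _ _ hA => measurableSet_Ioi.prod (F.le _ _ hA))

lemma measurable_leftLim (hX : ∀ t, Measurable (X t)) (hp : ∀ ω, IsCountingPath fun t => X t ω) :
    Measurable fun p : Time × Ω => Function.leftLim (fun t => X t p.2) p.1 :=
  (measurable_leftLim_predictable (F := Filtration.const Time mΩ le_rfl) hX hp).mono
    (predictable_le_prod _) le_rfl

/-- The graph of the jump times of a counting process is measurable. -/
lemma measurableSet_jumpTimes (hX : ∀ t, Measurable (X t))
    (hp : ∀ ω, IsCountingPath fun t => X t ω) :
    MeasurableSet {p : Time × Ω | p.1 ∈ jumpTimes X p.2} :=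
  (measurableSet_eq_fun (measurable_leftLim hX hp) (measurable_uncurry_of_path hX hp)).compl

lemma measurable_tsum_jumpTimes (hX : ∀ t, Measurable (X t))
    (hp : ∀ ω, IsCountingPath fun t => X t ω) {C : Time × Ω → ℝ≥0∞} (hC : Measurable C) :
    Measurable fun ω => ∑' s : jumpTimes X ω, C (s, ω) := by
  have : (fun ω => ∑' s : jumpTimes X ω, C (s, ω)) = fun ω => ∑' k : ℕ,
      if 1 ≤ k ∧ k ≤ X 1 ω then C (hit (fun t => X t ω) k, ω) else 0 := by
    ext ω
    exact (hp ω).tsum_jumps fun s => C (s, ω)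
  rw [this]
  refine Measurable.tsum fun k => Measurable.ite ?_ ?_ measurable_const
  · exact (MeasurableSet.const _).inter (measurableSet_le measurable_const (hX 1))
  · exact hC.comp ((measurable_hit hX hp k).prodMk measurable_id)

/-- Sums over a measurably selected part of the jump times are measurable. -/
lemma measurable_tsum_of_subset (hX : ∀ t, Measurable (X t))
    (hp : ∀ ω, IsCountingPath fun t => X t ω) {T : Ω → Set Time}
    (hT : MeasurableSet {p : Time × Ω | p.1 ∈ T p.2}) (hTX : ∀ ω, T ω ⊆ jumpTimes X ω)
    {C : Time × Ω → ℝ≥0∞} (hC : Measurable C) :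
    Measurable fun ω => ∑' s : T ω, C (s, ω) := by
  have h1 := measurable_tsum_jumpTimes hX hp (hC.indicator hT)
  convert h1 using 2 with ω
  rw [tsum_subtype (T ω) fun s => C (s, ω), tsum_subtype (jumpTimes X ω) fun s =>
    Set.indicator {p : Time × Ω | p.1 ∈ T p.2} C (s, ω)]
  congr 1; ext s
  by_cases h : s ∈ T ω
  · simp [Set.indicator, h, hTX ω h]
  · simp [Set.indicator, h]

end Measurability

/-! ### Independence of the increments of the noise -/

section Independence

lemma indep_mono {Ω : Type*} {mΩ : MeasurableSpace Ω} {P : Measure Ω}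
    {m₁ m₂ m₁' m₂' : MeasurableSpace Ω} (h : Indep m₁ m₂ P) (h₁ : m₁' ≤ m₁) (h₂ : m₂' ≤ m₂) :
    Indep m₁' m₂' P :=
  indep_of_indep_of_le_right (indep_of_indep_of_le_left h h₁) h₂

variable {Ω : Type*} {mΩ : MeasurableSpace Ω} {P : Measure Ω}

/-- If `m₁` is independent of `m₂`, and `m₃` of both together, then `m₁` is independent of `m₂` and
`m₃` together. -/
lemma indep_sup_of_indep [IsProbabilityMeasure P] {m₁ m₂ m₃ : MeasurableSpace Ω}
    (h₁ : m₁ ≤ mΩ) (h₂ : m₂ ≤ mΩ) (h₃ : m₃ ≤ mΩ) (h₁₂ : Indep m₁ m₂ P)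
    (h₁₂₃ : Indep (m₁ ⊔ m₂) m₃ P) :
    Indep m₁ (m₂ ⊔ m₃) P := by
  let p : Set (Set Ω) := {s | ∃ B C, MeasurableSet[m₂] B ∧ MeasurableSet[m₃] C ∧ s = B ∩ C}
  have hp : IsPiSystem p := by
    rintro _ ⟨B, C, hB, hC, rfl⟩ _ ⟨B', C', hB', hC', rfl⟩ -
    exact ⟨B ∩ B', C ∩ C', hB.inter hB', hC.inter hC', by rw [Set.inter_inter_inter_comm]⟩
  have hgen : m₂ ⊔ m₃ = MeasurableSpace.generateFrom p := by
    refine le_antisymm (sup_le ?_ ?_) (MeasurableSpace.generateFrom_le ?_)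
    · intro B hB
      exact MeasurableSpace.measurableSet_generateFrom
        ⟨B, Set.univ, hB, MeasurableSet.univ, by simp⟩
    · intro C hC
      exact MeasurableSpace.measurableSet_generateFrom
        ⟨Set.univ, C, MeasurableSet.univ, hC, by simp⟩
    · rintro _ ⟨B, C, hB, hC, rfl⟩
      exact MeasurableSet.inter (le_sup_left (a := m₂) _ hB) (le_sup_right (a := m₂) _ hC)
  refine IndepSets.indep h₁ (sup_le h₂ h₃) (@MeasurableSpace.isPiSystem_measurableSet _ m₁) hp
    (@MeasurableSpace.generateFrom_measurableSet _ m₁).symm hgen ?_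
  rw [IndepSets_iff]
  rintro A _ hA ⟨B, C, hB, hC, rfl⟩
  have hA' : MeasurableSet[m₁ ⊔ m₂] A := le_sup_left (a := m₁) _ hA
  have hB' : MeasurableSet[m₁ ⊔ m₂] B := le_sup_right (a := m₁) _ hB
  rw [Indep_iff] at h₁₂ h₁₂₃
  rw [← Set.inter_assoc, h₁₂₃ _ _ (hA'.inter hB') hC, h₁₂ _ _ hA hB, h₁₂₃ _ _ hB' hC, mul_assoc]

/-- The increment after time `u` of a process with independent increments started from `0` is
independent of its values at finitely many earlier times. -/
lemma indep_increment_finset {Z : Time → Ω → ℕ} (hZ : ∀ t, Measurable (Z t))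
    (hp : ∀ ω, IsCountingPath fun t => Z t ω) (hi : HasIndepIncrements Z P) (u : Time)
    (S : Finset Time) (hS : ∀ s ∈ S, s ≤ u) :
    Indep (⨆ s ∈ S, MeasurableSpace.comap (Z s) ⊤)
      (MeasurableSpace.comap (fun ω => Z 1 ω - Z u ω) ⊤) P := by
  -- the times of `S` in increasing order, followed by `u` and `1`
  obtain ⟨l, hlS, hlsort⟩ : ∃ l : List Time, (∀ s, s ∈ l ↔ s ∈ S) ∧ l.Pairwise (· ≤ ·) :=
    ⟨S.sort (· ≤ ·), fun _ => Finset.mem_sort _, S.pairwise_sort _⟩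
  let τ : ℕ → Time := fun i =>
    if i = 0 then 0 else if h : i - 1 < l.length then l[i - 1]
    else if i = l.length + 1 then u else 1
  have hl : ∀ i (h : i < l.length), l[i] ≤ u := fun i h =>
    hS _ ((hlS _).1 (List.getElem_mem h))
  have hsort : ∀ i j (hi : i < l.length) (hj : j < l.length), i ≤ j → l[i] ≤ l[j] := by
    intro i j hi hj hij
    rcases hij.lt_or_eq with h | rfl
    · exact List.pairwise_iff_getElem.1 hlsort i j hi hj h
    · exact le_rfl
  have hτ : Monotone τ := by
    intro i j hij
    simp only [τ]
    by_cases hi0 : i = 0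
    · rw [if_pos hi0]; exact unitInterval.nonneg'
    rw [if_neg hi0, if_neg (by omega : ¬ j = 0)]
    by_cases hj1 : j - 1 < l.length
    · rw [dif_pos hj1, dif_pos (by omega : i - 1 < l.length)]
      exact hsort _ _ _ _ (by omega)
    rw [dif_neg hj1]
    by_cases hj2 : j = l.length + 1
    · rw [if_pos hj2]
      by_cases hi1 : i - 1 < l.length
      · rw [dif_pos hi1]; exact hl _ hi1
      · rw [dif_neg hi1, if_pos (by omega)]
    · rw [if_neg hj2]; exact unitInterval.le_one'
  have hτ0 : τ 0 = 0 := by simp [τ]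
  have hτu : τ (l.length + 1) = u := by simp [τ]
  have hτ1 : τ (l.length + 2) = 1 := by simp [τ]
  have hτS : ∀ s ∈ S, ∃ i < l.length + 1, τ i = s := by
    intro s hs
    obtain ⟨i, hi, rfl⟩ := List.mem_iff_getElem.1 ((hlS s).2 hs)
    exact ⟨i + 1, by omega, by simp [τ, hi]⟩
  have hind := hi.nat hτ
  rw [iIndepFun_iff_iIndep] at hind
  have hdisj := indep_iSup_of_disjoint (fun i => ((hZ (τ (i + 1))).sub (hZ (τ i))).comap_le) hind
    (S := {i | i < l.length + 1}) (T := {l.length + 1}) (by simp)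
  refine indep_mono hdisj (iSup₂_le fun s hs => ?_) ?_
  · obtain ⟨i, hi, rfl⟩ := hτS s hs
    have hsum : Z (τ i) = fun ω => ∑ j ∈ Finset.range i, (Z (τ (j + 1)) ω - Z (τ j) ω) := by
      ext ω
      rw [Finset.sum_range_tsub (f := fun j => Z (τ j) ω) ((hp ω).mono.comp hτ) i, hτ0]
      have : Z 0 ω = 0 := (hp ω).zero
      rw [this, Nat.sub_zero]
    rw [hsum]
    refine Measurable.comap_le (Finset.measurable_fun_sum _ fun j hj => ?_)
    rw [Finset.mem_range] at hj
    exact Measurable.of_comap_le (le_iSup₂_of_le (f := fun j (_ : j ∈ {i | i < l.length + 1}) =>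
      MeasurableSpace.comap (fun ω => Z (τ (j + 1)) ω - Z (τ j) ω) ⊤) j
      (show j < l.length + 1 by omega) le_rfl)
  · refine le_iSup₂_of_le (l.length + 1) rfl ?_
    rw [hτu, hτ1]
    exact le_rfl

lemma indep_increment_past [IsProbabilityMeasure P] {Z : Time → Ω → ℕ} (hZ : ∀ t, Measurable (Z t))
    (hp : ∀ ω, IsCountingPath fun t => Z t ω) (hi : HasIndepIncrements Z P) (u : Time) :
    Indep (MeasurableSpace.comap (fun ω => Z 1 ω - Z u ω) ⊤)
      (⨆ s : Set.Iic u, MeasurableSpace.comap (Z s) ⊤) P := by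
  classical
  have hle : ∀ s, MeasurableSpace.comap (Z s) ⊤ ≤ mΩ := fun s => (hZ s).comap_le
  refine Indep.symm ?_
  rw [iSup_eq_iSup_finset]
  refine indep_iSup_of_directed_le (fun S => ?_) (fun S => iSup₂_le fun s _ => hle s)
    ((hZ 1).sub (hZ u)).comap_le ?_
  · refine indep_mono (indep_increment_finset hZ hp hi u
      (S.map ⟨Subtype.val, Subtype.val_injective⟩) ?_) (iSup₂_le fun s hs => ?_) le_rfl
    · intro s hs
      obtain ⟨s', -, rfl⟩ := Finset.mem_map.1 hs
      exact s'.2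
    · exact le_iSup₂_of_le (f := fun s _ => MeasurableSpace.comap (Z s) ⊤) (s : Time)
        (Finset.mem_map.2 ⟨s, hs, rfl⟩) le_rfl
  · exact directed_of_isDirected_le fun S T hST =>
      biSup_mono fun _ hs => Finset.mem_of_subset hST hs

end Independence

/-! ### Increments of the noise and the insider's information -/

lemma lintegral_poissonMeasure_id (r : ℝ≥0) : ∫⁻ n, (n : ℝ≥0∞) ∂(poissonMeasure r) = r := by
  have hsum := (hasSum_one_poissonMeasure r)
  rw [poissonMeasure, lintegral_sum_measure]
  simp only [lintegral_smul_measure, lintegral_dirac, smul_eq_mul]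
  rw [tsum_eq_zero_add' ENNReal.summable]
  have h1 : ∀ n : ℕ, ENNReal.ofReal (Real.exp (-r) * r ^ (n + 1) / (n + 1).factorial) *
      ((n + 1 : ℕ) : ℝ≥0∞) = r * ENNReal.ofReal (Real.exp (-r) * r ^ n / n.factorial) := by
    intro n
    rw [← ENNReal.ofReal_natCast, ← ENNReal.ofReal_mul (by positivity),
      ← ENNReal.ofReal_coe_nnreal, ← ENNReal.ofReal_mul (by positivity)]
    congr 1
    rw [Nat.factorial_succ]; push_cast; field_simp; ring
  simp only [h1, ENNReal.tsum_mul_left]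
  rw [← ENNReal.ofReal_tsum_of_nonneg (fun n => by positivity) hsum.summable, hsum.tsum_eq]
  simp

section Noise

variable {Ω : Type*} {mΩ : MeasurableSpace Ω} {P : Measure Ω}

lemma comap_eval_le_comap_path (Z : Time → Ω → ℕ) (s : Time) :
    MeasurableSpace.comap (Z s) ⊤ ≤
      MeasurableSpace.comap (fun ω t => Z t ω) MeasurableSpace.pi := by
  have h1 : Measurable[MeasurableSpace.comap (fun ω t => Z t ω) MeasurableSpace.pi] (Z s) :=
    (measurable_pi_apply s).comp (comap_measurable (fun ω t => Z t ω))
  exact h1.comap_le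

/-- An increment of one of the noise processes is independent of the fundamental value, the past
of both noise processes and an independent source of information. -/
lemma indep_increment_info [IsProbabilityMeasure P] {Z W : Time → Ω → ℕ} {β : ℝ≥0} {vt : Ω → ℝ}
    (hvt : Measurable vt) (hZ : IsPoissonProcess P β Z) (hW : ∀ t, Measurable (W t))
    (hZW : IndepFun (fun ω t => Z t ω) (fun ω t => W t ω) P)
    (hv : IndepFun vt (fun ω => ((fun t => Z t ω), (fun t => W t ω))) P)
    (H : Filtration Time mΩ)
    (hH : Indep (⨆ t, H t) (MeasurableSpace.comap vt inferInstance ⊔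
      ⨆ s : Time, (MeasurableSpace.comap (Z s) ⊤ ⊔ MeasurableSpace.comap (W s) ⊤)) P) (u : Time) :
    Indep (MeasurableSpace.comap (fun ω => Z 1 ω - Z u ω) ⊤)
      (MeasurableSpace.comap vt inferInstance ⊔
        (⨆ s : Set.Iic u, (MeasurableSpace.comap (Z s) ⊤ ⊔ MeasurableSpace.comap (W s) ⊤)) ⊔ H u)
      P := by
  have hz : ∀ s, MeasurableSpace.comap (Z s) ⊤ ≤ mΩ := fun s => (hZ.measurable s).comap_le
  have hw : ∀ s, MeasurableSpace.comap (W s) ⊤ ≤ mΩ := fun s => (hW s).comap_le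
  have hinc : MeasurableSpace.comap (fun ω => Z 1 ω - Z u ω) ⊤ ≤ mΩ :=
    ((hZ.measurable 1).sub (hZ.measurable u)).comap_le
  have hincZ : ∀ m : MeasurableSpace Ω, (∀ s, MeasurableSpace.comap (Z s) ⊤ ≤ m) →
      MeasurableSpace.comap (fun ω => Z 1 ω - Z u ω) ⊤ ≤ m := by
    intro m hm
    have h1 : Measurable[m] (Z 1) := Measurable.of_comap_le (hm 1)
    have h2 : Measurable[m] (Z u) := Measurable.of_comap_le (hm u)
    exact (h1.sub h2).comap_le
  have h2 : Indep (MeasurableSpace.comap (fun ω => Z 1 ω - Z u ω) ⊤)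
      ((⨆ s : Set.Iic u, MeasurableSpace.comap (Z s) ⊤) ⊔
        (⨆ s : Set.Iic u, MeasurableSpace.comap (W s) ⊤)) P := by
    refine indep_sup_of_indep hinc (iSup_le fun s => hz s) (iSup_le fun s => hw s)
      (indep_increment_past hZ.measurable hZ.path hZ.indep u) ?_
    refine indep_mono hZW (sup_le ?_ (iSup_le fun s => comap_eval_le_comap_path Z s))
      (iSup_le fun s => comap_eval_le_comap_path W s)
    exact hincZ _ fun s => comap_eval_le_comap_path Z s
  have h3 : Indep (MeasurableSpace.comap (fun ω => Z 1 ω - Z u ω) ⊤)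
      (((⨆ s : Set.Iic u, MeasurableSpace.comap (Z s) ⊤) ⊔
        (⨆ s : Set.Iic u, MeasurableSpace.comap (W s) ⊤)) ⊔
        MeasurableSpace.comap vt inferInstance) P := by
    refine indep_sup_of_indep hinc (sup_le (iSup_le fun s => hz s) (iSup_le fun s => hw s))
      hvt.comap_le h2 ?_
    have h4 : ∀ s, MeasurableSpace.comap (Z s) ⊤ ≤ MeasurableSpace.comap
        (fun ω => ((fun t => Z t ω), (fun t => W t ω))) inferInstance := by
      intro s
      refine Measurable.comap_le ?_
      exact (measurable_pi_apply s).comp (measurable_fst.comp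
        (comap_measurable (fun ω => ((fun t => Z t ω), (fun t => W t ω)))))
    have h5 : ∀ s, MeasurableSpace.comap (W s) ⊤ ≤ MeasurableSpace.comap
        (fun ω => ((fun t => Z t ω), (fun t => W t ω))) inferInstance := by
      intro s
      refine Measurable.comap_le ?_
      exact (measurable_pi_apply s).comp (measurable_snd.comp
        (comap_measurable (fun ω => ((fun t => Z t ω), (fun t => W t ω)))))
    exact indep_mono hv.symm (sup_le (hincZ _ h4) (sup_le (iSup_le fun s => h4 s)
      (iSup_le fun s => h5 s))) le_rfl
  have h4 : Indep (MeasurableSpace.comap (fun ω => Z 1 ω - Z u ω) ⊤)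
      ((((⨆ s : Set.Iic u, MeasurableSpace.comap (Z s) ⊤) ⊔
        (⨆ s : Set.Iic u, MeasurableSpace.comap (W s) ⊤)) ⊔
        MeasurableSpace.comap vt inferInstance) ⊔ H u) P := by
    refine indep_sup_of_indep hinc (sup_le (sup_le (iSup_le fun s => hz s) (iSup_le fun s => hw s))
      hvt.comap_le) (H.le u) h3 ?_
    have h5 : ∀ s, MeasurableSpace.comap (Z s) ⊤ ≤ (MeasurableSpace.comap vt inferInstance ⊔
      ⨆ s : Time, (MeasurableSpace.comap (Z s) ⊤ ⊔ MeasurableSpace.comap (W s) ⊤)) := fun s =>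
      le_sup_of_le_right (le_iSup_of_le s le_sup_left)
    have h6 : ∀ s, MeasurableSpace.comap (W s) ⊤ ≤ (MeasurableSpace.comap vt inferInstance ⊔
      ⨆ s : Time, (MeasurableSpace.comap (Z s) ⊤ ⊔ MeasurableSpace.comap (W s) ⊤)) := fun s =>
      le_sup_of_le_right (le_iSup_of_le s le_sup_right)
    exact indep_mono hH.symm (sup_le (hincZ _ h5) (sup_le (sup_le (iSup_le fun s => h5 s)
      (iSup_le fun s => h6 s)) le_sup_left)) (le_iSup (fun t => H t) u)
  refine indep_mono h4 le_rfl (sup_le (sup_le ?_ (iSup_le fun s => sup_le ?_ ?_)) ?_)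
  · exact le_sup_of_le_left le_sup_right
  · exact le_sup_of_le_left (le_sup_of_le_left (le_sup_of_le_left
      (le_iSup (fun s : Set.Iic u => MeasurableSpace.comap (Z s) ⊤) s)))
  · exact le_sup_of_le_left (le_sup_of_le_left (le_sup_of_le_right
      (le_iSup (fun s : Set.Iic u => MeasurableSpace.comap (W s) ⊤) s)))
  · exact le_sup_right

/-! ### The usual augmentation -/

lemma measurableSet_of_ae_eq (hP : ∀ s, P s = 0 → MeasurableSet s) {s t : Set Ω}
    (ht : MeasurableSet t) (hst : s =ᵐ[P] t) : MeasurableSet s := by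
  have : P.IsComplete := ⟨hP⟩
  exact (ht.nullMeasurableSet.congr hst.symm).measurable_of_complete

/-- The filtration `G`, augmented by the null sets. -/
def augment (P : Measure Ω) (hP : ∀ s, P s = 0 → MeasurableSet s) (G : Filtration Time mΩ) :
    Filtration Time mΩ where
  seq t := eventuallyMeasurableSpace (G t) (ae P)
  mono' := by
    rintro s t hst A ⟨B, hB, hAB⟩
    exact ⟨B, G.mono hst _ hB, hAB⟩
  le' := by
    rintro t A ⟨B, hB, hAB⟩
    exact measurableSet_of_ae_eq hP (G.le t _ hB) hAB

/-- Before time `1`, the events of the least usual filtration containing `G` belong, up to null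
sets, to each later `σ`-algebra of `G`. -/
lemma exists_ae_eq_of_isLeast_usual {G F : Filtration Time mΩ}
    (hF : IsLeast {G' : Filtration Time mΩ | IsUsual P G' ∧ ∀ t, G t ≤ G' t} F) {s u : Time}
    (hsu : s < u) {A : Set Ω} (hA : MeasurableSet[F s] A) :
    ∃ B, MeasurableSet[G u] B ∧ A =ᵐ[P] B := by
  have hP : ∀ s, P s = 0 → MeasurableSet s := fun s hs => F.le 0 _ (hF.1.1.complete s hs)
  have hmem : (augment P hP G).rightCont ∈
      {G' : Filtration Time mΩ | IsUsual P G' ∧ ∀ t, G t ≤ G' t} := by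
    refine ⟨⟨inferInstance, fun s hs => ?_⟩, fun t => ?_⟩
    · have h0 : MeasurableSet[augment P hP G 0] s :=
        ⟨∅, @MeasurableSet.empty _ (G 0), ae_eq_empty.2 hs⟩
      exact (augment P hP G).le_rightCont 0 _ h0
    · have h0 : G t ≤ augment P hP G t := le_eventuallyMeasurableSpace
      exact h0.trans ((augment P hP G).le_rightCont t)
  have h1 : MeasurableSet[(augment P hP G).rightCont s] A := hF.2 hmem s _ hA
  rw [Filtration.rightCont_eq_of_not_isMax _ (not_isMax_of_lt hsu)] at h1
  exact (iInf₂_le (f := fun j (_ : j > s) => augment P hP G j) u hsu : _ ≤ _) _ h1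

end Noise

/-! ### The intensity of the noise orders -/

section NoiseIntensity

variable {Ω : Type*} {mΩ : MeasurableSpace Ω} {P : Measure Ω}

lemma IsPoissonProcess.lintegral_increment {β : ℝ≥0} {Z : Time → Ω → ℕ}
    (hZ : IsPoissonProcess P β Z) (u : Time) :
    ∫⁻ ω, ((Z 1 ω - Z u ω : ℕ) : ℝ≥0∞) ∂P = β * ENNReal.ofReal (1 - u) := by
  have h1 := hZ.law u 1 unitInterval.le_one'
  have h2 := lintegral_map (f := fun n : ℕ => (n : ℝ≥0∞)) (μ := P) Measurable.of_discrete
    ((hZ.measurable 1).sub (hZ.measurable u))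
  have h3 : P.map (Z 1 - Z u) = _ := h1.map_eq
  rw [h3, lintegral_poissonMeasure_id] at h2
  refine h2.symm.trans ?_
  simp [ENNReal.ofReal]

/-- If the increments after time `u` are independent of `G u` for every `u`, then the increments
after time `s` still have the conditional mean `β (1 - s)` given the usual augmentation of `G` at
time `s`. -/
lemma lintegral_increment_of_isLeast_usual [IsProbabilityMeasure P] {G F : Filtration Time mΩ}
    (hF : IsLeast {G' : Filtration Time mΩ | IsUsual P G' ∧ ∀ t, G t ≤ G' t} F)
    {β : ℝ≥0} {Z : Time → Ω → ℕ} (hZ : IsPoissonProcess P β Z)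
    (hind : ∀ u, Indep (MeasurableSpace.comap (fun ω => Z 1 ω - Z u ω) ⊤) (G u) P)
    (s : Time) {A : Set Ω} (hA : MeasurableSet[F s] A) :
    ∫⁻ ω in A, ((Z 1 ω - Z s ω : ℕ) : ℝ≥0∞) ∂P = β * ENNReal.ofReal (1 - s) * P A := by
  rcases eq_or_lt_of_le (unitInterval.le_one' : s ≤ 1) with rfl | hs
  · simp
  have key : ∀ u > s, ∫⁻ ω in A, ((Z 1 ω - Z u ω : ℕ) : ℝ≥0∞) ∂P
      = β * ENNReal.ofReal (1 - u) * P A := by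
    intro u hu
    obtain ⟨B, hB, hAB⟩ := exists_ae_eq_of_isLeast_usual hF hu hA
    have hB' : MeasurableSet B := (G.le u) _ hB
    rw [setLIntegral_congr hAB, measure_congr hAB, ← lintegral_indicator hB',
      ← hZ.lintegral_increment u]
    have h1 := lintegral_mul_eq_lintegral_mul_lintegral_of_independent_measurableSpace
      ((hZ.measurable 1).sub (hZ.measurable u)).comap_le (G.le u) (hind u)
      (f := fun ω => ((Z 1 ω - Z u ω : ℕ) : ℝ≥0∞)) (g := B.indicator 1)
      ((Measurable.of_discrete (f := fun n : ℕ => (n : ℝ≥0∞))).comp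
        (comap_measurable (fun ω => Z 1 ω - Z u ω)))
      (Measurable.indicator (@measurable_const _ _ _ (G u) 1) hB)
    rw [lintegral_indicator_one hB'] at h1
    rw [← h1]
    congr 1; ext ω
    by_cases hω : ω ∈ B <;> simp [hω]
  -- approximate `s` from the right, where the augmentation does not matter
  obtain ⟨u, hu, hus, hlim⟩ := exists_seq_strictAnti_tendsto' hs
  have hL : Tendsto (fun n => ∫⁻ ω in A, ((Z 1 ω - Z (u n) ω : ℕ) : ℝ≥0∞) ∂P) atTop
      (𝓝 (∫⁻ ω in A, ((Z 1 ω - Z s ω : ℕ) : ℝ≥0∞) ∂P)) := by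
    refine lintegral_tendsto_of_tendsto_of_monotone (fun n => ?_) ?_ ?_
    · exact ((Measurable.of_discrete (f := fun n : ℕ => (n : ℝ≥0∞))).comp
        ((hZ.measurable 1).sub (hZ.measurable _))).aemeasurable
    · refine Eventually.of_forall fun ω m n hmn => ?_
      have h1 : Z (u n) ω ≤ Z (u m) ω := (hZ.path ω).mono (hu.antitone hmn)
      exact Nat.cast_le.2 (by omega)
    · refine Eventually.of_forall fun ω => ?_
      refine tendsto_const_nhds.congr' ?_
      have h2 : Tendsto u atTop (𝓝[≥] s) :=
        tendsto_nhdsWithin_iff.2 ⟨hlim, Eventually.of_forall fun n => (hus n).1.le⟩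
      filter_upwards [h2.eventually ((hZ.path ω).eventually_right s)] with n hn
      rw [hn]
  have hR : Tendsto (fun n => β * ENNReal.ofReal (1 - u n) * P A) atTop
      (𝓝 (β * ENNReal.ofReal (1 - s) * P A)) := by
    refine ENNReal.Tendsto.mul_const (ENNReal.Tendsto.const_mul ?_ (Or.inr ENNReal.coe_ne_top))
      (Or.inr (measure_ne_top _ _))
    exact (ENNReal.continuous_ofReal.tendsto _).comp
      (tendsto_const_nhds.sub ((continuous_subtype_val.tendsto _).comp hlim))
  refine tendsto_nhds_unique hL (hR.congr fun n => (key _ (hus n).1).symm)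

/-- The Doléans measure on `Time × Ω` of the point process `X`: its `k`-th jump, if there is one,
contributes the law of `(hit X k, ω)`. -/
noncomputable def jumpMeasure (P : Measure Ω) (X : Time → Ω → ℕ) : Measure (Time × Ω) :=
  Measure.sum fun k : ℕ =>
    (P.restrict {ω | 1 ≤ k ∧ k ≤ X 1 ω}).map fun ω => (hit (fun t => X t ω) k, ω)

lemma lintegral_jumpMeasure {X : Time → Ω → ℕ} (hX : ∀ t, Measurable (X t))
    (hp : ∀ ω, IsCountingPath fun t => X t ω) {C : Time × Ω → ℝ≥0∞} (hC : Measurable C) :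
    ∫⁻ p, C p ∂(jumpMeasure P X) = ∫⁻ ω, (∑' s : jumpTimes X ω, C (s, ω)) ∂P := by
  have hset : ∀ k : ℕ, MeasurableSet {ω | 1 ≤ k ∧ k ≤ X 1 ω} := fun k =>
    (MeasurableSet.const _).inter (measurableSet_le measurable_const (hX 1))
  have hh : ∀ k : ℕ, Measurable fun ω => (hit (fun t => X t ω) k, ω) := fun k =>
    (measurable_hit hX hp k).prodMk measurable_id
  have h1 : ∀ ω, ∑' s : jumpTimes X ω, C (s, ω) = ∑' k : ℕ,
      {ω | 1 ≤ k ∧ k ≤ X 1 ω}.indicator (fun ω => C (hit (fun t => X t ω) k, ω)) ω := by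
    intro ω
    refine ((hp ω).tsum_jumps fun s => C (s, ω)).trans ?_
    simp only [Set.indicator, Set.mem_ofPred_eq]
  simp only [h1]
  have h2 : ∀ k : ℕ, Measurable ({ω | 1 ≤ k ∧ k ≤ X 1 ω}.indicator
      (fun ω => C (hit (fun t => X t ω) k, ω))) := fun k => (hC.comp (hh k)).indicator (hset k)
  rw [lintegral_tsum fun k => (h2 k).aemeasurable, jumpMeasure, lintegral_sum_measure]
  refine tsum_congr fun k => ?_
  rw [lintegral_map hC (hh k), ← lintegral_indicator (hset k)]

/-- The generators of the predictable `σ`-algebra form a `π`-system. -/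
lemma isPiSystem_predictable (F : Filtration Time mΩ) : IsPiSystem
    ({s | ∃ A, MeasurableSet[F ⊥] A ∧ s = {⊥} ×ˢ A} ∪
    {s : Set (Time × Ω) | ∃ i A, MeasurableSet[F i] A ∧ s = Set.Ioi i ×ˢ A}) := by
  rintro _ (⟨A, hA, rfl⟩ | ⟨i, A, hA, rfl⟩) _ (⟨B, hB, rfl⟩ | ⟨j, B, hB, rfl⟩) hne
  · exact Or.inl ⟨A ∩ B, hA.inter hB, by rw [Set.prod_inter_prod, Set.inter_self]⟩
  · obtain ⟨p, ⟨hp1, -⟩, hp2, -⟩ := hne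
    rw [hp1] at hp2; exact absurd (Set.mem_Ioi.1 hp2) not_lt_bot
  · obtain ⟨p, ⟨hp2, -⟩, hp1, -⟩ := hne
    rw [hp1] at hp2; exact absurd (Set.mem_Ioi.1 hp2) not_lt_bot
  · refine Or.inr ⟨i ⊔ j, A ∩ B, (F.mono le_sup_left _ hA).inter (F.mono le_sup_right _ hB), ?_⟩
    rw [Set.prod_inter_prod, Set.Ioi_inter_Ioi]

/-- A counting process whose increments have the conditional expectation `β (1 - s)` given `F s`
has the constant `F`-intensity `β`. -/
lemma hasIntensity_const [IsProbabilityMeasure P] {F : Filtration Time mΩ} {β : ℝ≥0}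
    {Z : Time → Ω → ℕ} (hZ : ∀ t, Measurable (Z t)) (hp : ∀ ω, IsCountingPath fun t => Z t ω)
    (hinc : ∀ s A, MeasurableSet[F s] A →
      ∫⁻ ω in A, ((Z 1 ω - Z s ω : ℕ) : ℝ≥0∞) ∂P = β * ENNReal.ofReal (1 - s) * P A) :
    HasIntensity P F (jumpTimes Z) fun _ _ => β := by
  refine ⟨fun _ _ => β.2, isStronglyProgressive_const F _, fun C hC => ?_⟩
  have hle := predictable_le_prod F
  have hIoi : ∀ s A, MeasurableSet[F s] A →
      jumpMeasure P Z (Set.Ioi s ×ˢ A) = β * ENNReal.ofReal (1 - s) * P A := by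
    intro s A hA
    have hA' := F.le s _ hA
    rw [← lintegral_indicator_one (measurableSet_Ioi.prod hA'), lintegral_jumpMeasure hZ hp
      (measurable_one.indicator (measurableSet_Ioi.prod hA')), ← hinc s A hA,
      ← lintegral_indicator hA']
    congr 1; ext ω
    by_cases hω : ω ∈ A
    · rw [Set.indicator_of_mem hω, ← (hp ω).tsum_jumps_Ioi s]
      refine tsum_congr fun u => ?_
      simp [Set.indicator, hω]
    · rw [Set.indicator_of_notMem hω]
      simp [Set.indicator, hω]
  have hbot : ∀ A, MeasurableSet A → jumpMeasure P Z ({⊥} ×ˢ A) = 0 := by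
    intro A hA'
    rw [← lintegral_indicator_one ((measurableSet_singleton _).prod hA'),
      lintegral_jumpMeasure hZ hp
      (measurable_one.indicator ((measurableSet_singleton _).prod hA'))]
    refine (lintegral_congr fun ω => ?_).trans lintegral_zero
    refine ENNReal.tsum_eq_zero.2 fun u => Set.indicator_of_notMem ?_ _
    rintro ⟨h1, -⟩
    have h2 : (u : Time) = 0 := h1
    have h3 := u.2
    rw [h2] at h3
    exact h3 ((hp ω).leftLim_zero.trans (hp ω).zero.symm)
  have huniv : (Set.univ : Set (Time × Ω)) = {⊥} ×ˢ Set.univ ∪ Set.Ioi ⊥ ×ˢ Set.univ := by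
    rw [← Set.union_prod, ← Set.univ_prod_univ]
    congr 1; ext s
    simp
  have hdisj : Disjoint ({⊥} ×ˢ Set.univ : Set (Time × Ω)) (Set.Ioi ⊥ ×ˢ Set.univ) := by
    rw [Set.disjoint_prod]; left; simp
  -- both measures agree on the generators of the predictable `σ`-algebra
  have hmeas : (jumpMeasure P Z).trim hle = ((β : ℝ≥0∞) • volume.prod P).trim hle := by
    have hu : (jumpMeasure P Z) Set.univ =
        ((β : ℝ≥0∞) • (volume : Measure Time).prod P) Set.univ := by
      rw [huniv, measure_union hdisj (measurableSet_Ioi.prod MeasurableSet.univ),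
        hbot _ MeasurableSet.univ, hIoi _ _ MeasurableSet.univ, ← huniv]
      simp
    have hfin : IsFiniteMeasure ((jumpMeasure P Z).trim hle) := by
      refine ⟨?_⟩
      rw [trim_measurableSet_eq hle MeasurableSet.univ, hu]
      simp
    refine ext_of_generate_finite _ rfl (isPiSystem_predictable F) ?_ ?_
    · rintro _ (⟨A, hA, rfl⟩ | ⟨i, A, hA, rfl⟩)
      · have hm := measurableSet_predictable_singleton_bot_prod hA
        rw [trim_measurableSet_eq hle hm, trim_measurableSet_eq hle hm, hbot _ (F.le _ _ hA)]
        simp [Measure.prod_prod]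
      · have hm := measurableSet_predictable_Ioi_prod hA
        rw [trim_measurableSet_eq hle hm, trim_measurableSet_eq hle hm, hIoi _ _ hA]
        rw [Measure.smul_apply, Measure.prod_prod, unitInterval.volume_Ioi, smul_eq_mul, mul_assoc]
    · rw [trim_measurableSet_eq hle MeasurableSet.univ,
        trim_measurableSet_eq hle MeasurableSet.univ, hu]
  have hC' := hC.mono hle le_rfl
  rw [← lintegral_jumpMeasure hZ hp hC', ← lintegral_trim hle hC, hmeas, lintegral_trim hle hC,
    lintegral_smul_measure, lintegral_prod_symm' _ hC', smul_eq_mul]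
  rw [← lintegral_const_mul _ hC'.lintegral_prod_left']
  refine lintegral_congr fun ω => ?_
  have h1 : Measurable fun s => C (s, ω) := hC'.comp measurable_prodMk_right
  rw [lintegral_mul_const _ h1, mul_comm]
  simp

end NoiseIntensity

/-! ### Absence of common jumps -/

section CommonJumps

variable {Ω : Type*} {mΩ : MeasurableSpace Ω} {P : Measure Ω}

/-- Markov's inequality for the number of jumps. -/
lemma IsPoissonProcess.measure_increment_ne_zero_le {β : ℝ≥0} {Z : Time → Ω → ℕ}
    (hZ : IsPoissonProcess P β Z) {s u : Time} (hsu : s ≤ u) :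
    P {ω | Z u ω - Z s ω ≠ 0} ≤ β * ENNReal.ofReal (u - s) := by
  have hm : Measurable (fun ω => Z u ω - Z s ω) := (hZ.measurable u).sub (hZ.measurable s)
  have h2 := lintegral_map (f := fun n : ℕ => (n : ℝ≥0∞)) (μ := P) Measurable.of_discrete hm
  rw [(hZ.law s u hsu).map_eq, lintegral_poissonMeasure_id] at h2
  have h3 := meas_ge_le_lintegral_div (μ := P) (f := fun ω => ((Z u ω - Z s ω : ℕ) : ℝ≥0∞))
    ((Measurable.of_discrete (f := fun n : ℕ => (n : ℝ≥0∞))).comp hm).aemeasurable one_ne_zero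
    ENNReal.one_ne_top
  rw [← h2, div_one] at h3
  refine le_trans (measure_mono fun ω hω => ?_) (h3.trans (le_of_eq ?_))
  · have : 1 ≤ Z u ω - Z s ω := Nat.one_le_iff_ne_zero.2 hω
    exact_mod_cast this
  · simp [ENNReal.ofReal]

/-- Two independent Poisson processes almost surely have no common jump: on a grid of mesh `1 / n`,
both jump in the same cell with probability at most `n (β / n)²`. -/
lemma ae_disjoint_jumpTimes [IsProbabilityMeasure P] {β : ℝ≥0} {Z W : Time → Ω → ℕ}
    (hZ : IsPoissonProcess P β Z) (hW : IsPoissonProcess P β W)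
    (hZW : IndepFun (fun ω t => Z t ω) (fun ω t => W t ω) P) :
    ∀ᵐ ω ∂P, Disjoint (jumpTimes Z ω) (jumpTimes W ω) := by
  have key : ∀ n : ℕ, P {ω | ¬ Disjoint (jumpTimes Z ω) (jumpTimes W ω)} ≤
      β ^ 2 * ENNReal.ofReal (1 / ((n : ℝ) + 1)) := by
    intro n
    -- the grid of mesh `1 / (n + 1)`
    let τ : ℕ → Time := fun k => Set.projIcc 0 1 zero_le_one ((k : ℝ) / (n + 1))
    have hn : (0 : ℝ) < n + 1 := by positivity
    have hτ : ∀ k ≤ n + 1, (τ k : ℝ) = (k : ℝ) / (n + 1) := by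
      intro k hk
      have h1 : (k : ℝ) / (n + 1) ∈ Set.Icc (0 : ℝ) 1 :=
        ⟨by positivity, by rw [div_le_one hn]; exact_mod_cast hk⟩
      simp only [τ, Set.projIcc_of_mem zero_le_one h1]
    have hsub : {ω | ¬ Disjoint (jumpTimes Z ω) (jumpTimes W ω)} ⊆ ⋃ k ∈ Finset.range (n + 1),
        ({ω | Z (τ (k + 1)) ω - Z (τ k) ω ≠ 0} ∩ {ω | W (τ (k + 1)) ω - W (τ k) ω ≠ 0}) := by
      intro ω hω
      obtain ⟨s, hsZ, hsW⟩ := Set.not_disjoint_iff.1 hω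
      have hs0 : (0 : ℝ) < s := by
        refine lt_of_le_of_ne s.2.1 fun h => ?_
        have : s = 0 := Subtype.ext h.symm
        subst this
        exact hsZ ((hZ.path ω).leftLim_zero.trans (hZ.path ω).zero.symm)
      obtain ⟨k, hk⟩ : ∃ k, ⌈(s : ℝ) * (n + 1)⌉₊ = k + 1 :=
        Nat.exists_eq_succ_of_ne_zero (Nat.ceil_pos.2 (by positivity)).ne'
      rw [Nat.ceil_eq_iff (by omega)] at hk
      push_cast at hk
      have hkn : k < n + 1 := by
        have h1 : (k : ℝ) < n + 1 := by nlinarith [s.2.2]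
        exact_mod_cast h1
      have h1 : τ k < s := by
        rw [← Subtype.coe_lt_coe, hτ k hkn.le, div_lt_iff₀ hn]; exact hk.1
      have h2 : s ≤ τ (k + 1) := by
        rw [← Subtype.coe_le_coe, hτ (k + 1) (by omega), le_div_iff₀ hn]; push_cast; exact hk.2
      have hjump : ∀ f : Time → ℕ, IsCountingPath f → Function.leftLim f s ≠ f s →
          f (τ (k + 1)) - f (τ k) ≠ 0 := by
        intro f hf hfs
        have h3 := (hf.jump_iff s).1 hfs
        have h4 := hf.mono.le_leftLim h1
        have h5 := hf.mono h2
        omega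
      refine Set.mem_biUnion (Finset.mem_coe.2 (Finset.mem_range.2 hkn)) ⟨?_, ?_⟩
      · exact hjump _ (hZ.path ω) hsZ
      · exact hjump _ (hW.path ω) hsW
    refine (measure_mono hsub).trans ((measure_biUnion_finset_le _ _).trans ?_)
    have hterm : ∀ k ∈ Finset.range (n + 1), P ({ω | Z (τ (k + 1)) ω - Z (τ k) ω ≠ 0} ∩
        {ω | W (τ (k + 1)) ω - W (τ k) ω ≠ 0}) ≤ (β * ENNReal.ofReal (1 / ((n : ℝ) + 1))) ^ 2 := by
      intro k hk
      rw [Finset.mem_range] at hk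
      have hm : ∀ i j : Time, Measurable fun f : Time → ℕ => f i - f j := fun i j =>
        (measurable_pi_apply i).sub (measurable_pi_apply j)
      have hind := hZW.comp (hm (τ (k + 1)) (τ k)) (hm (τ (k + 1)) (τ k))
      have h1 := hind.measure_inter_preimage_eq_mul {0}ᶜ {0}ᶜ (by measurability) (by measurability)
      have hle : τ k ≤ τ (k + 1) := by
        rw [← Subtype.coe_le_coe, hτ k (by omega), hτ (k + 1) (by omega)]
        gcongr; simp
      have hdiff : (τ (k + 1) : ℝ) - τ k = 1 / (n + 1) := by
        rw [hτ k (by omega), hτ (k + 1) (by omega)]; push_cast; field_simp; ring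
      refine (le_of_eq h1).trans ?_
      rw [sq, ← hdiff]
      exact mul_le_mul' (hZ.measure_increment_ne_zero_le hle) (hW.measure_increment_ne_zero_le hle)
    refine (Finset.sum_le_sum hterm).trans (le_of_eq ?_)
    rw [Finset.sum_const, Finset.card_range, nsmul_eq_mul, mul_pow, sq (ENNReal.ofReal _)]
    have h1 : ((n + 1 : ℕ) : ℝ≥0∞) * ENNReal.ofReal (1 / ((n : ℝ) + 1)) = 1 := by
      rw [← ENNReal.ofReal_natCast, ← ENNReal.ofReal_mul (by positivity)]
      push_cast
      rw [mul_one_div_cancel hn.ne', ENNReal.ofReal_one]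
    calc ((n + 1 : ℕ) : ℝ≥0∞) * (β ^ 2 * (ENNReal.ofReal (1 / ((n : ℝ) + 1)) *
          ENNReal.ofReal (1 / ((n : ℝ) + 1))))
        = (((n + 1 : ℕ) : ℝ≥0∞) * ENNReal.ofReal (1 / ((n : ℝ) + 1))) *
          (β ^ 2 * ENNReal.ofReal (1 / ((n : ℝ) + 1))) := by ring
      _ = _ := by rw [h1, one_mul]
  have hlim : Tendsto (fun n : ℕ => (β : ℝ≥0∞) ^ 2 * ENNReal.ofReal (1 / ((n : ℝ) + 1))) atTop
      (𝓝 (β ^ 2 * ENNReal.ofReal 0)) :=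
    ENNReal.Tendsto.const_mul ((ENNReal.continuous_ofReal.tendsto _).comp
      tendsto_one_div_add_atTop_nhds_zero_nat) (Or.inr (by finiteness))
  rw [ENNReal.ofReal_zero, mul_zero] at hlim
  rw [ae_iff]
  exact le_antisymm (ge_of_tendsto' hlim key) (zero_le)

end CommonJumps

/-! ### The noise in the insider's filtration -/

section MarketNoise

variable {Ω : Type*} {mΩ : MeasurableSpace Ω} {P : Measure Ω}
  {o : OrderFlow Ω} {β : ℝ≥0} {vt : Ω → ℝ} {F : Filtration Time mΩ}

/-- The information given by the value, the noise orders up to `t` and `H t`. -/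
def infoFiltration (hvt : Measurable vt) (hnoise : o.IsNoise P β vt) (H : Filtration Time mΩ) :
    Filtration Time mΩ where
  seq t := MeasurableSpace.comap vt inferInstance ⊔ o.noiseInfo t ⊔ H t
  mono' := by
    intro s t hst
    refine sup_le_sup (sup_le_sup le_rfl (iSup_le fun u => ?_)) (H.mono hst)
    exact le_iSup (fun u : Set.Iic t => MeasurableSpace.comap (o.ZB u) ⊤ ⊔
      MeasurableSpace.comap (o.ZS u) ⊤) ⟨u, le_trans u.2 hst⟩
  le' := by
    intro t
    exact sup_le (sup_le hvt.comap_le (iSup_le fun u => sup_le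
      (hnoise.buy.measurable u).comap_le (hnoise.sell.measurable u).comap_le)) (H.le t)

/-- The value and the source `H` are independent of the noise, so the insider's additional
information does not change the intensity of the noise orders. -/
lemma hasIntensity_noise [IsProbabilityMeasure P] (hvt : Measurable vt) (hnoise : o.IsNoise P β vt)
    (hF : o.IsInsiderFiltration P vt F) :
    HasIntensity P F (jumpTimes o.ZB) (fun _ _ => β) ∧
      HasIntensity P F (jumpTimes o.ZS) (fun _ _ => β) := by
  obtain ⟨H, hH, hleast⟩ := hF
  have hleast' : IsLeast {G' : Filtration Time mΩ | IsUsual P G' ∧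
      ∀ t, infoFiltration hvt hnoise H t ≤ G' t} F := hleast
  have hle : ∀ s : Time, (MeasurableSpace.comap (o.ZB s) ⊤ ⊔ MeasurableSpace.comap (o.ZS s) ⊤) ≤
      o.noiseInfo 1 := fun s =>
    le_iSup (fun u : Set.Iic (1 : Time) => MeasurableSpace.comap (o.ZB u) ⊤ ⊔
      MeasurableSpace.comap (o.ZS u) ⊤) ⟨s, unitInterval.le_one'⟩
  constructor
  · refine hasIntensity_const hnoise.buy.measurable hnoise.buy.path
      (lintegral_increment_of_isLeast_usual hleast' hnoise.buy fun u => ?_)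
    exact indep_increment_info hvt hnoise.buy hnoise.sell.measurable hnoise.indep
      hnoise.indep_value H
      (indep_mono hH le_rfl (sup_le_sup le_rfl (iSup_le hle))) u
  · refine hasIntensity_const hnoise.sell.measurable hnoise.sell.path
      (lintegral_increment_of_isLeast_usual hleast' hnoise.sell fun u => ?_)
    have h1 := indep_increment_info hvt hnoise.sell hnoise.buy.measurable hnoise.indep.symm
      (hnoise.indep_value.comp measurable_id measurable_swap) H
      (indep_mono hH le_rfl (sup_le_sup le_rfl
        (iSup_le fun s => (sup_comm _ _).le.trans (hle s)))) u
    refine indep_mono h1 le_rfl (sup_le_sup (sup_le_sup le_rfl ?_) le_rfl)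
    exact iSup_mono fun s => (sup_comm _ _).le

lemma noise_adapted (hF : o.IsInsiderFiltration P vt F) (t : Time) :
    Measurable[F t] (o.ZB t) ∧ Measurable[F t] (o.ZS t) := by
  obtain ⟨H, -, hleast⟩ := hF
  have h1 := hleast.1.2 t
  have h2 : MeasurableSpace.comap (o.ZB t) ⊤ ⊔ MeasurableSpace.comap (o.ZS t) ⊤ ≤ F t :=
    le_trans (le_trans (le_iSup (fun u : Set.Iic t => MeasurableSpace.comap (o.ZB u) ⊤ ⊔
      MeasurableSpace.comap (o.ZS u) ⊤) ⟨t, Set.mem_Iic.2 le_rfl⟩)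
      (le_sup_of_le_left le_sup_right)) h1
  exact ⟨Measurable.of_comap_le (le_sup_left.trans h2),
    Measurable.of_comap_le (le_sup_right.trans h2)⟩

lemma value_measurable (hF : o.IsInsiderFiltration P vt F) (t : Time) : Measurable[F t] vt := by
  obtain ⟨H, -, hleast⟩ := hF
  exact Measurable.of_comap_le ((le_sup_of_le_left le_sup_left).trans (hleast.1.2 t))

end MarketNoise

/-! ### The compensation formula -/

section Compensation

variable {Ω : Type*} {mΩ : MeasurableSpace Ω} {P : Measure Ω}

lemma jumpSum_eq_sum {T : Set Time} {D : Finset Time} (hTD : T ⊆ D) (t : Time) (f : Time → ℝ) :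
    OrderFlow.jumpSum T t f = ∑ s ∈ D with t < s, T.indicator f s := by
  classical
  rw [OrderFlow.jumpSum, finsum_mem_eq_sum_of_subset (t := D.filter fun s => s ∈ T ∧ t < s) _]
  · rw [← Finset.sum_filter_add_sum_filter_not (D.filter fun s => t < s) (fun s => s ∈ T)]
    rw [Finset.sum_eq_zero (s := (D.filter fun s => t < s).filter fun s => ¬ s ∈ T), add_zero]
    · rw [Finset.filter_filter]
      refine Finset.sum_congr (Finset.filter_congr fun s _ => by tauto) fun s hs => ?_
      rw [Set.indicator_of_mem (Finset.mem_filter.1 hs).2.2]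
    · intro s hs
      exact Set.indicator_of_notMem (Finset.mem_filter.1 hs).2 _
  · rintro s ⟨⟨h1, h2⟩, -⟩
    exact Finset.mem_coe.2 (Finset.mem_filter.2 ⟨hTD h1, h1, h2.1⟩)
  · intro s hs
    have := (Finset.mem_filter.1 (Finset.mem_coe.1 hs)).2
    exact ⟨this.1, this.2, unitInterval.le_one'⟩

/-- The extended nonnegative sum over the jump times after `t` agrees with `jumpSum`. -/
lemma tsum_eq_ofReal_jumpSum {T : Set Time} (hT : T.Finite) (t : Time) {f : Time → ℝ}
    (hf : ∀ s, 0 ≤ f s) :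
    ∑' s : T, (Set.Ioi t).indicator (fun s => ENNReal.ofReal (f s)) (s : Time) =
      ENNReal.ofReal (OrderFlow.jumpSum T t f) := by
  classical
  rw [jumpSum_eq_sum (D := hT.toFinset) (by simp) t f, ENNReal.ofReal_sum_of_nonneg
    (fun s _ => Set.indicator_nonneg (fun s _ => hf s) s), Finset.sum_filter]
  rw [tsum_subtype T ((Set.Ioi t).indicator fun s => ENNReal.ofReal (f s)),
    tsum_eq_sum (s := hT.toFinset)]
  · refine Finset.sum_congr rfl fun s hs => ?_
    have hsT : s ∈ T := by simpa using hs
    by_cases h : t < s <;> simp [h, hsT]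
  · intro s hs
    exact Set.indicator_of_notMem (by simpa using hs) _

lemma HasIntensity.measurable {F : Filtration Time mΩ} {T : Ω → Set Time} {θ : Time → Ω → ℝ}
    (hI : HasIntensity P F T θ) : Measurable fun p : Time × Ω => θ p.1 p.2 := by
  have h1 := (hI.progressive 1).measurable
  have h2 : Measurable[_, Subtype.instMeasurableSpace.prod (F 1)] fun p : Time × Ω =>
      ((⟨p.1, unitInterval.le_one'⟩ : Set.Iic (1 : Time)), p.2) :=
    Measurable.prodMk (measurable_fst.subtype_mk) (measurable_snd.mono le_rfl (F.le 1))
  exact h1.comp h2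

/-- The data of a marked part `T` of the jumps of an integrable counting process `X`. -/
structure IsJumpPart (P : Measure Ω) (F : Filtration Time mΩ) (X : Time → Ω → ℕ)
    (T : Ω → Set Time) (θ : Time → Ω → ℝ) : Prop where
  measurable : ∀ t, Measurable (X t)
  path : ∀ ω, IsCountingPath fun t => X t ω
  lintegral_lt_top : ∫⁻ ω, (X 1 ω : ℝ≥0∞) ∂P < ⊤
  subset : ∀ ω, T ω ⊆ jumpTimes X ω
  graph : MeasurableSet {p : Time × Ω | p.1 ∈ T p.2}
  intensity : HasIntensity P F T θ

variable {F : Filtration Time mΩ} {X : Time → Ω → ℕ} {T : Ω → Set Time} {θ : Time → Ω → ℝ}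

lemma IsJumpPart.finite (h : IsJumpPart P F X T θ) (ω : Ω) : (T ω).Finite :=
  (h.path ω).finite_jumps.subset (h.subset ω)

lemma Ioc_one (t : Time) : Set.Ioc t 1 = Set.Ioi t := by
  ext s; simp [unitInterval.le_one']

/-- The compensation formula on `A ∈ F t` for bounded nonnegative predictable integrands. -/
lemma IsJumpPart.compensation_nonneg (h : IsJumpPart P F X T θ) {t : Time} {A : Set Ω}
    (hA : MeasurableSet[F t] A) (hPA : P A ≠ 0) {g : Time × Ω → ℝ}
    (hg : Measurable[F.predictable] g)
    (hg0 : ∀ p, 0 ≤ g p) {C : ℝ} (hgC : ∀ p, g p ≤ C) :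
    Integrable (fun ω => OrderFlow.jumpSum (T ω) t fun s => g (s, ω)) (cond P A) ∧
    Integrable (fun ω => ∫ r in Set.Ioc t 1, g (r, ω) * θ r ω) (cond P A) ∧
    (∀ᵐ ω ∂(cond P A), IntegrableOn (fun r => g (r, ω) * θ r ω) (Set.Ioc t 1)) ∧
    ∫ ω, (OrderFlow.jumpSum (T ω) t fun s => g (s, ω)) ∂(cond P A) =
      ∫ ω, (∫ r in Set.Ioc t 1, g (r, ω) * θ r ω) ∂(cond P A) := by
  have hA' : MeasurableSet A := F.le t _ hA
  have hle := predictable_le_prod F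
  have hgm : Measurable g := hg.mono hle le_rfl
  have hθm := h.intensity.measurable
  let c : Time × Ω → ℝ≥0∞ := (Set.Ioi t ×ˢ Set.univ).indicator fun p => ENNReal.ofReal (g p)
  have hcm : Measurable c :=
    (hgm.ennreal_ofReal).indicator (measurableSet_Ioi.prod MeasurableSet.univ)
  let S : Ω → ℝ≥0∞ := fun ω => ∑' s : T ω, c (s, ω)
  let I : Ω → ℝ≥0∞ := fun ω => ∫⁻ s, c (s, ω) * ENNReal.ofReal (θ s ω)
  have hSm : Measurable S := measurable_tsum_of_subset h.measurable h.path h.graph h.subset hcm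
  have hIm : Measurable I := (hcm.mul hθm.ennreal_ofReal).lintegral_prod_left'
  -- the projection property for the integrand restricted to the predictable set `(t, 1] × A`
  have hSI : ∫⁻ ω in A, S ω ∂P = ∫⁻ ω in A, I ω ∂P := by
    have hp := h.intensity.projection ((Set.Ioi t ×ˢ A).indicator fun p => ENNReal.ofReal (g p))
      (Measurable.indicator (hg.ennreal_ofReal) (measurableSet_predictable_Ioi_prod hA))
    rw [← lintegral_indicator hA', ← lintegral_indicator hA']
    refine Eq.trans (lintegral_congr fun ω => ?_) (hp.trans (lintegral_congr fun ω => ?_))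
    · by_cases hω : ω ∈ A
      · simp only [S, c, Set.indicator_of_mem hω]
        refine tsum_congr fun s => ?_
        simp [Set.indicator, hω]
      · simp [Set.indicator, hω]
    · by_cases hω : ω ∈ A
      · simp only [I, c, Set.indicator_of_mem hω]
        refine lintegral_congr fun s => ?_
        simp [Set.indicator, hω]
      · simp [Set.indicator, hω]
  have hcond : ∀ f : Ω → ℝ≥0∞, ∫⁻ ω, f ω ∂(cond P A) = (P A)⁻¹ * ∫⁻ ω in A, f ω ∂P := by
    intro f; rw [ProbabilityTheory.cond, lintegral_smul_measure, smul_eq_mul]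
  have hSle : ∀ ω, S ω ≤ ENNReal.ofReal C * X 1 ω := by
    intro ω
    rw [← (h.path ω).tsum_jumps_one, ← ENNReal.tsum_mul_left]
    simp only [mul_one]
    refine le_trans (ENNReal.tsum_le_tsum (g := fun _ => ENNReal.ofReal C) fun s => ?_)
      (ENNReal.tsum_mono_subtype (fun _ => ENNReal.ofReal C) (h.subset ω))
    exact (Set.indicator_le_self' (fun _ _ => zero_le) _).trans
      (ENNReal.ofReal_le_ofReal (hgC _))
  have hSfin : ∫⁻ ω, S ω ∂(cond P A) ≠ ⊤ := by
    rw [hcond]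
    refine ENNReal.mul_ne_top (ENNReal.inv_ne_top.2 hPA) (ne_top_of_le_ne_top ?_
      ((setLIntegral_le_lintegral A _).trans (lintegral_mono hSle)))
    have hX1 : Measurable fun ω => (X 1 ω : ℝ≥0∞) :=
      (Measurable.of_discrete (f := fun n : ℕ => (n : ℝ≥0∞))).comp (h.measurable 1)
    rw [lintegral_const_mul _ hX1]
    exact ENNReal.mul_ne_top ENNReal.ofReal_ne_top h.lintegral_lt_top.ne
  have hSI' : ∫⁻ ω, S ω ∂(cond P A) = ∫⁻ ω, I ω ∂(cond P A) := by rw [hcond, hcond, hSI]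
  have hIfin : ∫⁻ ω, I ω ∂(cond P A) ≠ ⊤ := hSI' ▸ hSfin
  have hSeq : ∀ ω, OrderFlow.jumpSum (T ω) t (fun s => g (s, ω)) = (S ω).toReal := by
    intro ω
    have h1 := tsum_eq_ofReal_jumpSum (h.finite ω) t (f := fun s => g (s, ω)) fun s => hg0 _
    have h2 : S ω = ENNReal.ofReal (OrderFlow.jumpSum (T ω) t fun s => g (s, ω)) := by
      rw [← h1]
      refine tsum_congr fun s => ?_
      simp [c, Set.indicator]
    rw [h2, ENNReal.toReal_ofReal]
    rw [jumpSum_eq_sum (D := (h.finite ω).toFinset) (by simp)]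
    exact Finset.sum_nonneg fun s _ => Set.indicator_nonneg (fun s _ => hg0 _) s
  have hIeq0 : ∀ ω, I ω = ∫⁻ r in Set.Ioc t 1, ENNReal.ofReal (g (r, ω) * θ r ω) := by
    intro ω
    rw [Ioc_one, ← lintegral_indicator measurableSet_Ioi]
    refine lintegral_congr fun r => ?_
    by_cases hr : t < r
    · simp [c, Set.indicator, hr, ENNReal.ofReal_mul (hg0 _)]
    · simp [c, Set.indicator, hr]
  have hsm : ∀ ω, Measurable fun r => g (r, ω) * θ r ω := fun ω =>
    (hgm.mul hθm).comp measurable_prodMk_right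
  have hIeq : ∀ ω, ∫ r in Set.Ioc t 1, g (r, ω) * θ r ω = (I ω).toReal := by
    intro ω
    rw [integral_eq_lintegral_of_nonneg_ae (Eventually.of_forall fun r =>
      mul_nonneg (hg0 _) (h.intensity.nonneg r ω)) (hsm ω).aestronglyMeasurable, hIeq0]
  have hIae := ae_lt_top' hIm.aemeasurable hIfin
  have hSae := ae_lt_top' hSm.aemeasurable hSfin
  refine ⟨?_, ?_, ?_, ?_⟩
  · simp only [hSeq]; exact integrable_toReal_of_lintegral_ne_top hSm.aemeasurable hSfin
  · simp only [hIeq]; exact integrable_toReal_of_lintegral_ne_top hIm.aemeasurable hIfin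
  · filter_upwards [hIae] with ω hω
    refine ⟨(hsm ω).aestronglyMeasurable, ?_⟩
    rw [hasFiniteIntegral_iff_ofReal (Eventually.of_forall fun r =>
      mul_nonneg (hg0 _) (h.intensity.nonneg r ω)), ← hIeq0]
    exact hω
  · simp only [hSeq, hIeq]
    rw [integral_toReal hSm.aemeasurable hSae, integral_toReal hIm.aemeasurable hIae, hSI']

/-- The compensation formula on `A ∈ F t` for bounded predictable integrands. -/
lemma IsJumpPart.compensation (h : IsJumpPart P F X T θ) {t : Time} {A : Set Ω}
    (hA : MeasurableSet[F t] A) (hPA : P A ≠ 0) {g : Time × Ω → ℝ}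
    (hg : Measurable[F.predictable] g)
    {C : ℝ} (hgC : ∀ p, |g p| ≤ C) :
    Integrable (fun ω => OrderFlow.jumpSum (T ω) t fun s => g (s, ω)) (cond P A) ∧
    Integrable (fun ω => ∫ r in Set.Ioc t 1, g (r, ω) * θ r ω) (cond P A) ∧
    (∀ᵐ ω ∂(cond P A), IntegrableOn (fun r => g (r, ω) * θ r ω) (Set.Ioc t 1)) ∧
    ∫ ω, (OrderFlow.jumpSum (T ω) t fun s => g (s, ω)) ∂(cond P A) =
      ∫ ω, (∫ r in Set.Ioc t 1, g (r, ω) * θ r ω) ∂(cond P A) := by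
  -- both sides are linear, so it is enough to treat `g + C` and `C`
  have hC0 : ∀ p : Time × Ω, 0 ≤ C := fun p => (abs_nonneg _).trans (hgC p)
  obtain ⟨a1, a2, a3, a4⟩ := h.compensation_nonneg hA hPA (g := fun p => g p + C)
    (Measurable.add_const hg C) (fun p => by linarith [neg_abs_le (g p), hgC p]) (C := C + C)
    (fun p => by linarith [le_abs_self (g p), hgC p])
  obtain ⟨b1, b2, b3, b4⟩ := h.compensation_nonneg hA hPA (g := fun _ => C)
    measurable_const hC0 (C := C) (fun p => le_rfl)
  have hS : ∀ ω, OrderFlow.jumpSum (T ω) t (fun s => g (s, ω)) =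
      OrderFlow.jumpSum (T ω) t (fun s => g (s, ω) + C) - OrderFlow.jumpSum (T ω) t fun _ => C := by
    intro ω
    have hsub : T ω ⊆ (h.finite ω).toFinset := by simp
    rw [jumpSum_eq_sum hsub, jumpSum_eq_sum hsub, jumpSum_eq_sum hsub, ← Finset.sum_sub_distrib]
    refine Finset.sum_congr rfl fun s _ => ?_
    by_cases hs : s ∈ T ω <;> simp [hs]
  have hI : (fun ω => ∫ r in Set.Ioc t 1, g (r, ω) * θ r ω) =ᵐ[cond P A] fun ω =>
      (∫ r in Set.Ioc t 1, (g (r, ω) + C) * θ r ω) - ∫ r in Set.Ioc t 1, C * θ r ω := by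
    filter_upwards [a3, b3] with ω ha hb
    rw [← integral_sub ha hb]
    congr 1; ext r; ring
  refine ⟨?_, ?_, ?_, ?_⟩
  · simp only [hS]; exact a1.sub b1
  · exact (a2.sub b2).congr hI.symm
  · filter_upwards [a3, b3] with ω ha hb
    refine (ha.sub hb).congr (Eventually.of_forall fun r => ?_)
    simp only [Pi.sub_apply]; ring
  · rw [integral_congr_ae hI, integral_sub a2 b2, ← a4, ← b4, ← integral_sub a1 b1]
    simp only [hS]

end Compensation

/-! ### The change of variables formula -/

section ChangeOfVariables

/-- Integrals over `Time` with its own volume are interval integrals. -/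
lemma setIntegral_time (φ : ℝ → ℝ) {x s : Time} (hxs : x ≤ s) :
    ∫ r : Time in Set.Ioc x s, φ r = ∫ r in (x : ℝ)..s, φ r := by
  have h1 := unitInterval.measurePreserving_coe.setIntegral_preimage_emb
    (MeasurableEmbedding.subtype_coe measurableSet_Icc) φ (Set.Ioc (x : ℝ) s)
  have h2 : ((↑) : Time → ℝ) ⁻¹' Set.Ioc (x : ℝ) s = Set.Ioc x s := by
    ext r; simp [← Subtype.coe_lt_coe, ← Subtype.coe_le_coe]
  rw [h2] at h1
  rw [h1, intervalIntegral.integral_of_le (Subtype.coe_le_coe.2 hxs), Measure.restrict_restrict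
    measurableSet_Ioc, Set.inter_eq_self_of_subset_left]
  intro r hr
  exact ⟨x.2.1.trans hr.1.le, hr.2.trans s.2.2⟩

/-- The change of variables formula for a step path `y` with left limits `yl` and jumps in the
finite set `D`, and a function `u` with time derivative `w`. -/
lemma change_of_variables {y yl : Time → ℤ} {D : Finset Time}
    (hleft : ∀ s, ∀ᶠ r in 𝓝[<] s, y r = yl s) (hright : ∀ s, ∀ᶠ r in 𝓝[≥] s, y r = y s)
    (hD : ∀ s ∉ D, yl s = y s) {u w : ℤ → Time → ℝ}
    (huw : ∀ k r s, r ≤ s → u k s - u k r = ∫ x in Set.Ioc r s, w k x)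
    (hint : Integrable fun r => w (y r) r) (t : Time) :
    u (y 1) 1 - u (y t) t =
      (∑ s ∈ D with t < s, (u (y s) s - u (yl s) s)) + ∫ r in Set.Ioc t 1, w (y r) r := by
  have hsplit : ∀ r s : Time, r ≤ s → ∫ x in Set.Ioc 0 s, w (y x) x =
      (∫ x in Set.Ioc 0 r, w (y x) x) + ∫ x in Set.Ioc r s, w (y x) x := by
    intro r s hrs
    rw [← setIntegral_union (Set.Ioc_disjoint_Ioc_of_le le_rfl) measurableSet_Ioc
      hint.integrableOn hint.integrableOn, Set.Ioc_union_Ioc_eq_Ioc unitInterval.nonneg' hrs]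
  -- the defect of the formula on `[0, s]` is locally constant in `s`, hence constant
  let Φ : Time → ℝ := fun s => u (y s) s - (∑ r ∈ D with r ≤ s, (u (y r) r - u (yl r) r)) -
    ∫ r in Set.Ioc 0 s, w (y r) r
  have hΦ : IsLocallyConstant Φ := by
    rw [IsLocallyConstant.iff_eventually_eq]
    intro s
    have hDs : ∀ᶠ r in 𝓝 s, r ∉ D.erase s :=
      (D.erase s).finite_toSet.isClosed.isOpen_compl.mem_nhds (by simp)
    rw [← nhdsLT_sup_nhdsGE s, eventually_sup]
    constructor
    · rcases eq_or_ne s 0 with rfl | hs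
      · have : 𝓝[<] (0 : Time) = ⊥ := by
          have h0 : Set.Iio (0 : Time) = ∅ := by
            ext r; simp
          rw [h0, nhdsWithin_empty]
        rw [this]; exact eventually_bot
      · have hs' : 0 < s := unitInterval.pos_iff_ne_zero.2 hs
        obtain ⟨l, hl, hls⟩ := (mem_nhdsLT_iff_exists_Ioo_subset' hs').1
          ((hleft s).and (hDs.filter_mono nhdsWithin_le_nhds))
        filter_upwards [Ioo_mem_nhdsLT hl] with x hx
        have hyx : y x = yl s := (hls hx).1
        have hsum : ∑ r ∈ D with r ≤ s, (u (y r) r - u (yl r) r) =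
            (∑ r ∈ D with r ≤ x, (u (y r) r - u (yl r) r)) + (u (y s) s - u (yl s) s) := by
          by_cases hsD : s ∈ D
          · have h1 : D.filter (fun r => r ≤ s) = insert s (D.filter fun r => r ≤ x) := by
              ext r
              simp only [Finset.mem_filter, Finset.mem_insert]
              constructor
              · rintro ⟨h1, h2⟩
                rcases eq_or_ne r s with rfl | hrs
                · exact Or.inl rfl
                · refine Or.inr ⟨h1, ?_⟩
                  by_contra! hxr
                  exact (hls ⟨hx.1.trans hxr, lt_of_le_of_ne h2 hrs⟩).2
                    (Finset.mem_erase.2 ⟨hrs, h1⟩)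
              · rintro (rfl | ⟨h1, h2⟩)
                · exact ⟨hsD, le_rfl⟩
                · exact ⟨h1, h2.trans hx.2.le⟩
            rw [h1, Finset.sum_insert, add_comm]
            simp [hx.2]
          · rw [hD s hsD, sub_self, add_zero]
            congr 1; ext r
            simp only [Finset.mem_filter]
            refine and_congr_right fun h1 => ⟨fun h2 => ?_, fun h2 => h2.trans hx.2.le⟩
            have hrs : r ≠ s := fun h => hsD (h ▸ h1)
            by_contra! hxr
            exact (hls ⟨hx.1.trans hxr, lt_of_le_of_ne h2 hrs⟩).2 (Finset.mem_erase.2 ⟨hrs, h1⟩)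
        have hinteg : ∫ r in Set.Ioc x s, w (y r) r = u (yl s) s - u (yl s) x := by
          rw [huw _ _ _ hx.2.le]
          refine setIntegral_congr_ae measurableSet_Ioc ?_
          filter_upwards [(Set.countable_singleton s).ae_notMem volume] with r hr hrx
          rw [(hls ⟨hx.1.trans hrx.1, lt_of_le_of_ne hrx.2 hr⟩ : _ ∧ _).1]
        simp only [Φ]
        rw [hsplit x s hx.2.le, hsum, hinteg, hyx]
        ring
    · rcases eq_or_ne s 1 with rfl | hs
      · filter_upwards [self_mem_nhdsWithin] with x hx
        rw [le_antisymm unitInterval.le_one' hx]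
      · have hs' : s < 1 := unitInterval.lt_one_iff_ne_one.2 hs
        obtain ⟨l, hl, hls⟩ := (mem_nhdsGE_iff_exists_Ico_subset' hs').1
          ((hright s).and (hDs.filter_mono nhdsWithin_le_nhds))
        filter_upwards [Ico_mem_nhdsGE hl] with x hx
        have hsum : ∑ r ∈ D with r ≤ x, (u (y r) r - u (yl r) r) =
            (∑ r ∈ D with r ≤ s, (u (y r) r - u (yl r) r)) := by
          congr 1; ext r
          simp only [Finset.mem_filter]
          refine and_congr_right fun h1 => ⟨fun h2 => ?_, fun h2 => h2.trans hx.1⟩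
          by_contra! hsr
          exact (hls ⟨hsr.le, h2.trans_lt hx.2⟩).2 (Finset.mem_erase.2 ⟨hsr.ne', h1⟩)
        have hinteg : ∫ r in Set.Ioc s x, w (y r) r = u (y s) x - u (y s) s := by
          rw [huw _ _ _ hx.1]
          refine setIntegral_congr_ae measurableSet_Ioc (Eventually.of_forall fun r hr => ?_)
          rw [(hls ⟨hr.1.le, hr.2.trans_lt hx.2⟩ : _ ∧ _).1]
        simp only [Φ]
        rw [hsplit s x hx.1, hsum, hinteg, (hls hx : _ ∧ _).1]
        ring
  have h1 := hΦ.apply_eq_of_isPreconnected isPreconnected_univ (Set.mem_univ 1) (Set.mem_univ t)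
  have hsum : ∑ r ∈ D with r ≤ 1, (u (y r) r - u (yl r) r) =
      (∑ r ∈ D with r ≤ t, (u (y r) r - u (yl r) r)) +
        ∑ r ∈ D with t < r, (u (y r) r - u (yl r) r) := by
    have h2 : D.filter (fun r => r ≤ 1) = D :=
      Finset.filter_true_of_mem fun r _ => unitInterval.le_one'
    rw [h2, ← Finset.sum_filter_add_sum_filter_not D fun r => r ≤ t]
    simp only [not_le]
  simp only [Φ] at h1
  rw [hsum, hsplit t 1 unitInterval.le_one'] at h1
  linarith

end ChangeOfVariables

/-! ### Gains from single orders -/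

section Gains

variable {N : ℕ} (v : Fin N → ℝ) (a : Fin (N + 1) → EReal) (β : ℝ≥0) (n : Fin N)

/-- The time derivative of `U(v_n, y, ·)`. -/
noncomputable def drift (y : ℤ) (r : Time) : ℝ :=
  open Classical in
  -(β : ℝ) * if upMid a n ≤ lvl y then price v a β y r - price v a β (y - 1) r
    else price v a β (y + 1) r - price v a β y r

/-- The increment of `U(v_n, ·, r)` from `y` to `y + d`. -/
noncomputable def incU (d : ℤ) (y : ℤ) (r : Time) : ℝ := U v a β n (y + d) r - U v a β n y r

/-- The integrand of the loss rate at the level just above the middle. -/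
noncomputable def lossAtUp (y : ℤ) (r : Time) : ℝ :=
  open Classical in
  (v n - price v a β (lowMidInt a n) r) * if lvl y = upMid a n then 1 else 0

/-- The integrand of the loss rate at the level just below the middle. -/
noncomputable def lossAtLow (y : ℤ) (r : Time) : ℝ :=
  open Classical in
  (v n - price v a β (upMidInt a n) r) * if lvl y = lowMid a n then 1 else 0

/-- The (nonpositive) excess gain from moving the demand from `y` to `y + 1` above the middle level
by a purchase. -/
noncomputable def buyGap (y : ℤ) (r : Time) : ℝ :=
  open Classical in
  if upMid a n ≤ lvl y then price v a β y r - price v a β (y + 1) r else 0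

/-- The (nonpositive) excess gain from moving the demand from `y` to `y - 1` below the middle level
by a sale. -/
noncomputable def sellGap (y : ℤ) (r : Time) : ℝ :=
  open Classical in
  if lvl y ≤ lowMid a n then price v a β (y - 1) r - price v a β y r else 0

/-- The (nonpositive) excess gain from cancelling a noise sell order above the middle level. -/
noncomputable def cancelSellGap (y : ℤ) (r : Time) : ℝ :=
  open Classical in
  if upMid a n ≤ lvl y then price v a β (y - 1) r - price v a β y r else 0

/-- The (nonpositive) excess gain from cancelling a noise buy order below the middle level. -/
noncomputable def cancelBuyGap (y : ℤ) (r : Time) : ℝ :=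
  open Classical in
  if lvl y ≤ lowMid a n then price v a β y r - price v a β (y + 1) r else 0

variable {v a β n}
variable {Ω : Type*} [MeasurableSpace Ω] {P : Measure Ω} {vt : Ω → ℝ}

/-- The gain from a purchase which moves the demand from `y` to `y + 1`. -/
lemma gain_buy (ha : MiddleLevelAssumption P v a β vt) (hN : 2 ≤ N) (y : ℤ) (r : Time) :
    v n - price v a β (y + 1) r + incU v a β n 1 y r =
      buyGap v a β n y r + lossAtLow v a β n y r := by
  have hiff := ha.eq_lowMid_iff hN n y
  by_cases hu : upMid a n ≤ lvl y
  · have hl := (ha.not_low_iff hN n y).2 hu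
    have h1 := ha.U_add_one_of_up hN r.2.2 hu
    have h2 : ¬ lvl y = lowMid a n := fun h => hl h.le
    simp only [incU, buyGap, lossAtLow, if_pos hu, if_neg h2]; linarith
  · have hl : lvl y ≤ lowMid a n := by rwa [← ha.not_low_iff hN, not_not] at hu
    by_cases hl' : lvl (y + 1) ≤ lowMid a n
    · have h1 := ha.U_add_one_of_low hN r.2.2 hl'
      have h2 : ¬ lvl y = lowMid a n := by
        rw [hiff, ← ha.not_low_iff hN]; tauto
      simp only [incU, buyGap, lossAtLow, if_neg hu, if_neg h2]; linarith
    · have hu' := (ha.not_low_iff hN n (y + 1)).1 hl'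
      have h1 := ha.U_mid (β := β) hN r hl hu'
      have h2 : lvl y = lowMid a n := hiff.2 ⟨hl, hu'⟩
      simp only [incU, buyGap, lossAtLow, if_neg hu, if_pos h2, (ha.midInt_of_eq_lowMid hN h2).2]
      linarith

/-- The gain from a sale which moves the demand from `y` to `y - 1`. -/
lemma gain_sell (ha : MiddleLevelAssumption P v a β vt) (hN : 2 ≤ N) (y : ℤ) (r : Time) :
    -(v n - price v a β (y - 1) r) + incU v a β n (-1) y r =
      sellGap v a β n y r - lossAtUp v a β n y r := by
  have hiff := ha.eq_upMid_iff hN n y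
  obtain ⟨z, rfl⟩ : ∃ z, y = z + 1 := ⟨y - 1, by ring⟩
  have hz : z + 1 + -1 = z := by ring
  rw [add_sub_cancel_right] at hiff
  simp only [incU, sellGap, lossAtUp, add_sub_cancel_right, hz]
  by_cases hl : lvl (z + 1) ≤ lowMid a n
  · have h1 := ha.U_add_one_of_low hN r.2.2 hl
    have h2 : ¬ lvl (z + 1) = upMid a n := by
      rw [hiff, ← ha.not_low_iff hN]; tauto
    simp only [if_pos hl, if_neg h2]; linarith
  · have hu := (ha.not_low_iff hN n (z + 1)).1 hl
    by_cases hl' : lvl z ≤ lowMid a n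
    · have h1 := ha.U_mid (β := β) hN r hl' hu
      have h2 : lvl (z + 1) = upMid a n := hiff.2 ⟨hu, hl'⟩
      simp only [if_neg hl, if_pos h2, (ha.midInt_of_eq_upMid hN h2).1, add_sub_cancel_right]
      linarith
    · have h1 := ha.U_add_one_of_up hN r.2.2 ((ha.not_low_iff hN n z).1 hl')
      have h2 : ¬ lvl (z + 1) = upMid a n := by tauto
      simp only [if_neg hl, if_neg h2]; linarith

/-- The gain from a purchase which cancels a noise sell order, compared with the effect of the
noise order alone. -/
lemma gain_cancelSell (ha : MiddleLevelAssumption P v a β vt) (hN : 2 ≤ N) (y : ℤ) (r : Time) :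
    v n - price v a β y r - incU v a β n (-1) y r =
      cancelSellGap v a β n y r + lossAtUp v a β n y r := by
  have h1 := gain_sell (n := n) ha hN y r
  have h2 := ha.not_low_iff hN n y
  by_cases hu : upMid a n ≤ lvl y
  · have hl := h2.2 hu
    simp only [sellGap, cancelSellGap, if_pos hu, if_neg hl] at h1 ⊢; linarith
  · have hl : lvl y ≤ lowMid a n := by tauto
    simp only [sellGap, cancelSellGap, if_neg hu, if_pos hl] at h1 ⊢; linarith

/-- The gain from a sale which cancels a noise buy order, compared with the effect of the noise
order alone. -/
lemma gain_cancelBuy (ha : MiddleLevelAssumption P v a β vt) (hN : 2 ≤ N) (y : ℤ) (r : Time) :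
    -(v n - price v a β y r) - incU v a β n 1 y r =
      cancelBuyGap v a β n y r - lossAtLow v a β n y r := by
  have h1 := gain_buy (n := n) ha hN y r
  have h2 := ha.not_low_iff hN n y
  by_cases hu : upMid a n ≤ lvl y
  · have hl := h2.2 hu
    simp only [buyGap, cancelBuyGap, if_pos hu, if_neg hl] at h1 ⊢; linarith
  · have hl : lvl y ≤ lowMid a n := by tauto
    simp only [buyGap, cancelBuyGap, if_neg hu, if_pos hl] at h1 ⊢; linarith

/-- The noise alone changes `U` on average only at the two levels next to the middle level. -/
lemma generator_U (ha : MiddleLevelAssumption P v a β vt) (hN : 2 ≤ N) (y : ℤ) (r : Time) :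
    incU v a β n 1 y r * β + incU v a β n (-1) y r * β + drift v a β n y r =
      lossAtLow v a β n y r * β - lossAtUp v a β n y r * β := by
  have h1 := gain_buy (n := n) ha hN y r
  have h3 := gain_sell (n := n) ha hN y r
  have h2 := ha.not_low_iff hN n y
  rw [show incU v a β n 1 y r = buyGap v a β n y r + lossAtLow v a β n y r -
    (v n - price v a β (y + 1) r) by linarith, show incU v a β n (-1) y r =
    sellGap v a β n y r - lossAtUp v a β n y r + (v n - price v a β (y - 1) r) by linarith]
  by_cases hu : upMid a n ≤ lvl y
  · have hl := h2.2 hu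
    simp only [sellGap, buyGap, drift, if_pos hu, if_neg hl]; ring
  · have hl : lvl y ≤ lowMid a n := by tauto
    simp only [sellGap, buyGap, drift, if_neg hu, if_pos hl]; ring

/-! ### Signs, bounds and measurability of the gains -/

lemma abs_value_le (n : Fin N) : |v n| ≤ ∑ m, |v m| :=
  Finset.single_le_sum (f := fun m => |v m|) (fun _ _ => abs_nonneg _) (Finset.mem_univ n)

lemma price_sub_nonpos (ha : MiddleLevelAssumption P v a β vt) (hv : StrictMono v) {y z : ℤ}
    (hyz : y ≤ z) (r : ℝ) : price v a β y r - price v a β z r ≤ 0 :=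
  sub_nonpos.2 (price_mono ha.strictMono ha.first ha.last hv r hyz)

lemma buyGap_nonpos (ha : MiddleLevelAssumption P v a β vt) (hv : StrictMono v) (y : ℤ)
    (r : Time) : buyGap v a β n y r ≤ 0 := by
  unfold buyGap; split_ifs
  · exact price_sub_nonpos ha hv (by omega) r
  · exact le_rfl

lemma sellGap_nonpos (ha : MiddleLevelAssumption P v a β vt) (hv : StrictMono v) (y : ℤ)
    (r : Time) : sellGap v a β n y r ≤ 0 := by
  unfold sellGap; split_ifs
  · exact price_sub_nonpos ha hv (by omega) r
  · exact le_rfl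

lemma cancelSellGap_nonpos (ha : MiddleLevelAssumption P v a β vt) (hv : StrictMono v) (y : ℤ)
    (r : Time) : cancelSellGap v a β n y r ≤ 0 := by
  unfold cancelSellGap; split_ifs
  · exact price_sub_nonpos ha hv (by omega) r
  · exact le_rfl

lemma cancelBuyGap_nonpos (ha : MiddleLevelAssumption P v a β vt) (hv : StrictMono v) (y : ℤ)
    (r : Time) : cancelBuyGap v a β n y r ≤ 0 := by
  unfold cancelBuyGap; split_ifs
  · exact price_sub_nonpos ha hv (by omega) r
  · exact le_rfl

lemma abs_value_sub_price_le (y : ℤ) (r : ℝ) : |v n - price v a β y r| ≤ 2 * ∑ m, |v m| :=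
  (abs_sub _ _).trans
    (by linarith [abs_price_le (v := v) (a := a) (β := β) y r, abs_value_le (v := v) n])

end Gains

/-- A bounded family of measurable functions of time, indexed by the demand level. -/
structure IsBddFamily (g : ℤ → Time → ℝ) : Prop where
  measurable : ∀ k, Measurable (g k)
  bounded : ∃ C, ∀ k r, |g k r| ≤ C

namespace IsBddFamily

variable {g g' : ℤ → Time → ℝ}

lemma add (hg : IsBddFamily g) (hg' : IsBddFamily g') :
    IsBddFamily fun k r => g k r + g' k r := by
  obtain ⟨C, hC⟩ := hg.bounded
  obtain ⟨C', hC'⟩ := hg'.bounded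
  exact ⟨fun k => (hg.measurable k).add (hg'.measurable k), C + C', fun k r =>
    (abs_add_le _ _).trans (add_le_add (hC k r) (hC' k r))⟩

lemma neg (hg : IsBddFamily g) : IsBddFamily fun k r => -g k r := by
  obtain ⟨C, hC⟩ := hg.bounded
  exact ⟨fun k => (hg.measurable k).neg, C, fun k r => by rw [abs_neg]; exact hC k r⟩

lemma sub (hg : IsBddFamily g) (hg' : IsBddFamily g') :
    IsBddFamily fun k r => g k r - g' k r := by
  simpa only [sub_eq_add_neg] using hg.add hg'.neg

lemma comp_add (hg : IsBddFamily g) (d : ℤ) : IsBddFamily fun k r => g (k + d) r := by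
  obtain ⟨C, hC⟩ := hg.bounded
  exact ⟨fun k => hg.measurable _, C, fun k r => hC _ r⟩

lemma ite (hg : IsBddFamily g) (hg' : IsBddFamily g') (p : ℤ → Prop) [DecidablePred p] :
    IsBddFamily fun k r => if p k then g k r else g' k r := by
  obtain ⟨C, hC⟩ := hg.bounded
  obtain ⟨C', hC'⟩ := hg'.bounded
  refine ⟨fun k => ?_, max C C', fun k r => ?_⟩
  · by_cases h : p k
    · simp only [if_pos h]; exact hg.measurable k
    · simp only [if_neg h]; exact hg'.measurable k
  · split_ifs
    · exact (hC k r).trans (le_max_left _ _)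
    · exact (hC' k r).trans (le_max_right _ _)

lemma zero : IsBddFamily fun _ _ => 0 :=
  ⟨fun _ => measurable_const, 0, fun _ _ => by simp⟩

lemma const (c : ℝ) : IsBddFamily fun _ _ => c :=
  ⟨fun _ => measurable_const, |c|, fun _ _ => le_rfl⟩

lemma const_mul (hg : IsBddFamily g) (c : ℝ) : IsBddFamily fun k r => c * g k r := by
  obtain ⟨C, hC⟩ := hg.bounded
  exact ⟨fun k => (hg.measurable k).const_mul c, |c| * C, fun k r => by
    rw [abs_mul]; exact mul_le_mul_of_nonneg_left (hC k r) (abs_nonneg _)⟩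

end IsBddFamily

section Families

variable {N : ℕ} {v : Fin N → ℝ} {a : Fin (N + 1) → EReal} {β : ℝ≥0} {n : Fin N}
variable {Ω : Type*} [MeasurableSpace Ω] {P : Measure Ω} {vt : Ω → ℝ}

lemma measurable_price (y : ℤ) : Measurable fun r : Time => price v a β y r :=
  (continuous_price y).measurable.comp measurable_subtype_coe

lemma isBddFamily_price (d : ℤ) : IsBddFamily fun y r => price v a β (y + d) r :=
  ⟨fun _ => measurable_price _, ∑ m, |v m|, fun _ _ => abs_price_le _ _⟩

lemma isBddFamily_lossAtUp : IsBddFamily (lossAtUp v a β n) := by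
  classical
  have h : IsBddFamily fun (_ : ℤ) (r : Time) => v n - price v a β (lowMidInt a n) r :=
    ⟨fun _ => measurable_const.sub (measurable_price _), _, fun _ _ => abs_value_sub_price_le _ _⟩
  convert h.ite .zero
    (fun y => lvl y = upMid a n) using 3 with y r
  rw [lossAtUp, mul_ite, mul_one, mul_zero]

lemma isBddFamily_lossAtLow : IsBddFamily (lossAtLow v a β n) := by
  classical
  have h : IsBddFamily fun (_ : ℤ) (r : Time) => v n - price v a β (upMidInt a n) r :=
    ⟨fun _ => measurable_const.sub (measurable_price _), _, fun _ _ => abs_value_sub_price_le _ _⟩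
  convert h.ite .zero
    (fun y => lvl y = lowMid a n) using 3 with y r
  rw [lossAtLow, mul_ite, mul_one, mul_zero]

lemma isBddFamily_price_sub (d e : ℤ) :
    IsBddFamily fun y r => price v a β (y + d) r - price v a β (y + e) r :=
  (isBddFamily_price d).sub (isBddFamily_price e)

lemma isBddFamily_buyGap : IsBddFamily (buyGap v a β n) := by
  classical
  have h := (isBddFamily_price_sub (v := v) (a := a) (β := β) 0 1).ite .zero
    (fun y => upMid a n ≤ lvl y)
  convert h using 3 with y r
  simp [buyGap, sub_eq_add_neg]

lemma isBddFamily_sellGap : IsBddFamily (sellGap v a β n) := by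
  classical
  have h := (isBddFamily_price_sub (v := v) (a := a) (β := β) (-1) 0).ite .zero
    (fun y => lvl y ≤ lowMid a n)
  convert h using 3 with y r
  simp [sellGap, sub_eq_add_neg]

lemma isBddFamily_cancelSellGap : IsBddFamily (cancelSellGap v a β n) := by
  classical
  have h := (isBddFamily_price_sub (v := v) (a := a) (β := β) (-1) 0).ite .zero
    (fun y => upMid a n ≤ lvl y)
  convert h using 3 with y r
  simp [cancelSellGap, sub_eq_add_neg]

lemma isBddFamily_cancelBuyGap : IsBddFamily (cancelBuyGap v a β n) := by
  classical
  have h := (isBddFamily_price_sub (v := v) (a := a) (β := β) 0 1).ite .zero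
    (fun y => lvl y ≤ lowMid a n)
  convert h using 3 with y r
  simp [cancelBuyGap, sub_eq_add_neg]

lemma isBddFamily_drift : IsBddFamily (drift v a β n) := by
  classical
  have h := ((isBddFamily_price_sub (v := v) (a := a) (β := β) 0 (-1)).ite
    (isBddFamily_price_sub (v := v) (a := a) (β := β) 1 0)
      (fun y => upMid a n ≤ lvl y)).const_mul (-(β : ℝ))
  convert h using 3 with y r
  simp [drift, sub_eq_add_neg]

lemma isBddFamily_incU_one (ha : MiddleLevelAssumption P v a β vt) (hN : 2 ≤ N) :
    IsBddFamily (incU v a β n 1) := by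
  have h := ((isBddFamily_buyGap (v := v) (a := a) (β := β) (n := n)).add
    (isBddFamily_lossAtLow (v := v) (a := a) (β := β) (n := n))).sub
      ((IsBddFamily.const (v n)).sub (isBddFamily_price (v := v) (a := a) (β := β) 1))
  convert h using 3 with y r
  linarith [gain_buy (n := n) ha hN y r]

lemma isBddFamily_incU_neg_one (ha : MiddleLevelAssumption P v a β vt) (hN : 2 ≤ N) :
    IsBddFamily (incU v a β n (-1)) := by
  have h := ((isBddFamily_sellGap (v := v) (a := a) (β := β) (n := n)).sub
    (isBddFamily_lossAtUp (v := v) (a := a) (β := β) (n := n))).add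
      ((IsBddFamily.const (v n)).sub (isBddFamily_price (v := v) (a := a) (β := β) (-1)))
  convert h using 3 with y r
  have := gain_sell (n := n) ha hN y r
  rw [← sub_eq_add_neg]
  linarith

lemma U_sub_U (y : ℤ) {r s : Time} (hrs : r ≤ s) :
    U v a β n y s - U v a β n y r = ∫ x in Set.Ioc r s, drift v a β n y x := by
  classical
  have hi : ∀ b c : ℝ, IntervalIntegrable (fun r => if upMid a n ≤ lvl y then
      price v a β y r - price v a β (y - 1) r else price v a β (y + 1) r - price v a β y r)
      volume b c := by
    intro b c
    split_ifs
    · exact (intervalIntegrable_price _ _ _).sub (intervalIntegrable_price _ _ _)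
    · exact (intervalIntegrable_price _ _ _).sub (intervalIntegrable_price _ _ _)
  simp only [drift]
  rw [setIntegral_time (fun x => -(β : ℝ) * if upMid a n ≤ lvl y then
    price v a β y x - price v a β (y - 1) x else price v a β (y + 1) x - price v a β y x) hrs,
    intervalIntegral.integral_const_mul]
  have h := intervalIntegral.integral_add_adjacent_intervals (hi r s) (hi s 1)
  simp only [U]
  rw [← h]
  ring

lemma U_one (y : ℤ) : U v a β n y ((1 : Time) : ℝ) = terminalU v a n y := by
  simp [U]

end Families

/-! ### The paths of the total demand -/

namespace OrderFlow

variable {Ω : Type*}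

/-- All four cumulative order processes have counting paths. -/
structure HasPaths (o : OrderFlow Ω) : Prop where
  zb : ∀ ω, IsCountingPath fun t => o.ZB t ω
  zs : ∀ ω, IsCountingPath fun t => o.ZS t ω
  xb : ∀ ω, IsCountingPath fun t => o.XB t ω
  xs : ∀ ω, IsCountingPath fun t => o.XS t ω

variable {o : OrderFlow Ω}

lemma HasPaths.Yleft_eq (hp : o.HasPaths) (s : Time) (ω : Ω) :
    o.Yleft s ω = o.start +
      (((Function.leftLim (fun u => o.ZB u ω) s : ℕ) : ℤ) -
        (Function.leftLim (fun u => o.ZS u ω) s : ℕ)) +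
      (((Function.leftLim (fun u => o.XB u ω) s : ℕ) : ℤ) -
        (Function.leftLim (fun u => o.XS u ω) s : ℕ)) := by
  rcases eq_or_ne s 0 with rfl | hs
  · have hb : IsBot (0 : Time) := fun x => unitInterval.nonneg x
    simp only [Yleft, leftLim_eq_of_isBot hb, Y]
  · have hne : (𝓝[<] s).NeBot := nhdsLT_neBot_of_exists_lt ⟨0, unitInterval.pos_iff_ne_zero.2 hs⟩
    refine leftLim_eq_of_tendsto (tendsto_const_nhds.congr' ?_)
    filter_upwards [(hp.zb ω).eventually_left s, (hp.zs ω).eventually_left s,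
      (hp.xb ω).eventually_left s, (hp.xs ω).eventually_left s] with u h1 h2 h3 h4
    simp only [Y, h1, h2, h3, h4]

lemma HasPaths.eventually_left (hp : o.HasPaths) (s : Time) (ω : Ω) :
    ∀ᶠ u in 𝓝[<] s, o.Y u ω = o.Yleft s ω := by
  filter_upwards [(hp.zb ω).eventually_left s, (hp.zs ω).eventually_left s,
    (hp.xb ω).eventually_left s, (hp.xs ω).eventually_left s] with u h1 h2 h3 h4
  rw [hp.Yleft_eq]
  simp only [Y, h1, h2, h3, h4]

lemma HasPaths.eventually_right (hp : o.HasPaths) (s : Time) (ω : Ω) :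
    ∀ᶠ u in 𝓝[≥] s, o.Y u ω = o.Y s ω := by
  filter_upwards [(hp.zb ω).eventually_right s, (hp.zs ω).eventually_right s,
    (hp.xb ω).eventually_right s, (hp.xs ω).eventually_right s] with u h1 h2 h3 h4
  simp only [Y, h1, h2, h3, h4]

/-- The finite set of all jump times of the four processes. -/
noncomputable def HasPaths.jumps (hp : o.HasPaths) (ω : Ω) : Finset Time :=
  (((hp.zb ω).finite_jumps.union (hp.zs ω).finite_jumps).union
    ((hp.xb ω).finite_jumps.union (hp.xs ω).finite_jumps)).toFinset

lemma HasPaths.mem_jumps (hp : o.HasPaths) (ω : Ω) (s : Time) : s ∈ hp.jumps ω ↔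
    (s ∈ jumpTimes o.ZB ω ∨ s ∈ jumpTimes o.ZS ω) ∨
      (s ∈ jumpTimes o.XB ω ∨ s ∈ jumpTimes o.XS ω) := by
  rw [jumps, Set.Finite.mem_toFinset]; rfl

lemma apply_eq_leftLim_add {X : Time → Ω → ℕ} {ω : Ω} (hX : IsCountingPath fun t => X t ω)
    (s : Time) : (X s ω : ℤ) = (Function.leftLim (fun u => X u ω) s : ℕ) +
      (jumpTimes X ω).indicator (fun _ => 1) s := by
  by_cases h : s ∈ jumpTimes X ω
  · rw [Set.indicator_of_mem h]; exact_mod_cast (hX.jump_iff s).1 h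
  · rw [Set.indicator_of_notMem h, add_zero]
    have : Function.leftLim (fun u => X u ω) s = X s ω := by
      by_contra h'; exact h h'
    rw [this]

lemma HasPaths.Y_eq (hp : o.HasPaths) (s : Time) (ω : Ω) :
    o.Y s ω = o.Yleft s ω +
      ((jumpTimes o.ZB ω).indicator (fun _ => 1) s - (jumpTimes o.ZS ω).indicator (fun _ => 1) s) +
      ((jumpTimes o.XB ω).indicator (fun _ => 1) s -
        (jumpTimes o.XS ω).indicator (fun _ => 1) s) := by
  rw [hp.Yleft_eq, Y, apply_eq_leftLim_add (hp.zb ω), apply_eq_leftLim_add (hp.zs ω),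
    apply_eq_leftLim_add (hp.xb ω), apply_eq_leftLim_add (hp.xs ω)]
  ring

lemma HasPaths.measurable_Y_path (hp : o.HasPaths) (ω : Ω) : Measurable fun r => o.Y r ω := by
  have h : ∀ f : Time → ℕ, IsCountingPath f → Measurable fun r => (f r : ℤ) := fun f hf =>
    Measurable.of_discrete.comp (g := fun k : ℕ => (k : ℤ)) hf.mono.measurable
  exact (measurable_const.add ((h _ (hp.zb ω)).sub (h _ (hp.zs ω)))).add
    ((h _ (hp.xb ω)).sub (h _ (hp.xs ω)))

/-- The sum of `g (Y_{s-}, s)` over the times `s ∈ T` after `t`. -/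
noncomputable def gainSum (o : OrderFlow Ω) (T : Ω → Set Time) (t : Time)
    (g : ℤ → Time → ℝ) (ω : Ω) : ℝ :=
  jumpSum (T ω) t fun s => g (o.Yleft s ω) s

/-- The integral of `g (Y_{r-}, r) θ_r` over `(t, 1]`. -/
noncomputable def gainIntegral (o : OrderFlow Ω) (θ : Time → Ω → ℝ) (t : Time)
    (g : ℤ → Time → ℝ) (ω : Ω) : ℝ :=
  ∫ r in Set.Ioc t 1, g (o.Yleft r ω) r * θ r ω

lemma gainSum_eq {T : Ω → Set Time} {D : Finset Time} {ω : Ω} (hD : T ω ⊆ D) (t : Time)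
    (g : ℤ → Time → ℝ) : o.gainSum T t g ω =
      ∑ s ∈ D with t < s, (T ω).indicator (fun s => g (o.Yleft s ω) s) s :=
  jumpSum_eq_sum hD t _

lemma gainSum_add {T : Ω → Set Time} {ω : Ω} (hT : (T ω).Finite) (t : Time)
    (g g' : ℤ → Time → ℝ) : o.gainSum T t (fun y r => g y r + g' y r) ω =
      o.gainSum T t g ω + o.gainSum T t g' ω := by
  have hD : T ω ⊆ hT.toFinset := by simp
  rw [gainSum_eq hD, gainSum_eq hD, gainSum_eq hD, ← Finset.sum_add_distrib]
  refine Finset.sum_congr rfl fun s _ => ?_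
  by_cases hs : s ∈ T ω <;> simp [hs]

lemma gainSum_neg {T : Ω → Set Time} {ω : Ω} (hT : (T ω).Finite) (t : Time)
    (g : ℤ → Time → ℝ) : o.gainSum T t (fun y r => -g y r) ω = -o.gainSum T t g ω := by
  have hD : T ω ⊆ hT.toFinset := by simp
  rw [gainSum_eq hD, gainSum_eq hD, ← Finset.sum_neg_distrib]
  refine Finset.sum_congr rfl fun s _ => ?_
  by_cases hs : s ∈ T ω <;> simp [hs]

lemma gainSum_nonpos {T : Ω → Set Time} {ω : Ω} (hT : (T ω).Finite) (t : Time)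
    {g : ℤ → Time → ℝ} (hg : ∀ y r, g y r ≤ 0) : o.gainSum T t g ω ≤ 0 := by
  have hD : T ω ⊆ hT.toFinset := by simp
  rw [gainSum_eq hD]
  exact Finset.sum_nonpos fun s _ => Set.indicator_nonpos (fun s _ => hg _ _) s

end OrderFlow

/-! ### The pathwise identity for the profit -/

section PathIdentity

open OrderFlow

variable {Ω : Type*} {mΩ : MeasurableSpace Ω} {P : Measure Ω} {N : ℕ} {v : Fin N → ℝ}
  {a : Fin (N + 1) → EReal} {β : ℝ≥0} {vt : Ω → ℝ} {o : OrderFlow Ω}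

/-- On every path, the profit is determined by the change of `U`, the drift of `U`, the changes
of `U` caused by the noise orders, and the gains from the insider's single orders. -/
lemma profit_add_terminalU (ha : MiddleLevelAssumption P v a β vt) (hN : 2 ≤ N)
    (hp : o.HasPaths) (n : Fin N) (t : Time) {ω : Ω} (hvt : vt ω = v n)
    (hZ : Disjoint (jumpTimes o.ZB ω) (jumpTimes o.ZS ω))
    (hX : Disjoint (jumpTimes o.XB ω) (jumpTimes o.XS ω)) :
    o.profit v a β vt t ω + terminalU v a n (o.Y 1 ω) = U v a β n (o.Y t ω) t +
      (∫ r in Set.Ioc t 1, drift v a β n (o.Yleft r ω) r) +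
      o.gainSum (jumpTimes o.ZB) t (incU v a β n 1) ω +
      o.gainSum (jumpTimes o.ZS) t (incU v a β n (-1)) ω +
      o.gainSum o.timesBB t (fun y r => buyGap v a β n y r + lossAtLow v a β n y r) ω +
      o.gainSum o.timesBT t (fun y r => buyGap v a β n (y + 1) r + lossAtLow v a β n (y + 1) r) ω +
      o.gainSum o.timesBS t (fun y r => cancelSellGap v a β n y r + lossAtUp v a β n y r) ω +
      o.gainSum o.timesSS t (fun y r => sellGap v a β n y r + -lossAtUp v a β n y r) ω +
      o.gainSum o.timesST t (fun y r => sellGap v a β n (y - 1) r + -lossAtUp v a β n (y - 1) r) ω +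
      o.gainSum o.timesSB t (fun y r => cancelBuyGap v a β n y r + -lossAtLow v a β n y r) ω := by
  set D := hp.jumps ω with hD
  have hDm := hp.mem_jumps ω
  have hnot : ∀ s ∉ D, o.Yleft s ω = o.Y s ω := by
    intro s hs
    rw [hDm] at hs
    push Not at hs
    rw [hp.Y_eq, Set.indicator_of_notMem hs.1.1, Set.indicator_of_notMem hs.1.2,
      Set.indicator_of_notMem hs.2.1, Set.indicator_of_notMem hs.2.2]
    ring
  obtain ⟨C, hC⟩ := (isBddFamily_drift (v := v) (a := a) (β := β) (n := n)).bounded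
  have hint : Integrable fun r => drift v a β n (o.Y r ω) r := by
    refine Integrable.of_bound (C := C) ?_ (Eventually.of_forall fun r => hC _ _)
    have hm : Measurable fun p : ℤ × Time => drift v a β n p.1 p.2 :=
      measurable_from_prod_countable_right fun k => isBddFamily_drift.measurable k
    exact (hm.comp ((hp.measurable_Y_path ω).prodMk measurable_id)).aestronglyMeasurable
  have hito := change_of_variables (hp.eventually_left · ω) (hp.eventually_right · ω) hnot
    (u := fun y s => U v a β n y s) (w := drift v a β n) (fun k r s hrs => U_sub_U k hrs) hint t
  have hdrift : ∫ r in Set.Ioc t 1, drift v a β n (o.Y r ω) r =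
      ∫ r in Set.Ioc t 1, drift v a β n (o.Yleft r ω) r := by
    refine integral_congr_ae (ae_restrict_of_ae ?_)
    filter_upwards [D.countable_toSet.ae_notMem volume] with r hr
    rw [hnot r hr]
  rw [hdrift, U_one] at hito
  have sub1 : jumpTimes o.ZB ω ⊆ D := fun s hs => (hDm s).2 (Or.inl (Or.inl hs))
  have sub2 : jumpTimes o.ZS ω ⊆ D := fun s hs => (hDm s).2 (Or.inl (Or.inr hs))
  have sub3 : o.timesBB ω ⊆ D := fun s hs => (hDm s).2 (Or.inr (Or.inl hs.1))
  have sub4 : o.timesBT ω ⊆ D := fun s hs => (hDm s).2 (Or.inr (Or.inl hs.1))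
  have sub5 : o.timesBS ω ⊆ D := fun s hs => (hDm s).2 (Or.inr (Or.inl hs.1))
  have sub6 : o.timesSS ω ⊆ D := fun s hs => (hDm s).2 (Or.inr (Or.inr hs.1))
  have sub7 : o.timesST ω ⊆ D := fun s hs => (hDm s).2 (Or.inr (Or.inr hs.1))
  have sub8 : o.timesSB ω ⊆ D := fun s hs => (hDm s).2 (Or.inr (Or.inr hs.1))
  rw [gainSum_eq sub1, gainSum_eq sub2, gainSum_eq sub3, gainSum_eq sub4, gainSum_eq sub5,
    gainSum_eq sub6, gainSum_eq sub7, gainSum_eq sub8, profit, jumpSum_eq_sum sub3,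
    jumpSum_eq_sum sub4, jumpSum_eq_sum sub5, jumpSum_eq_sum sub6, jumpSum_eq_sum sub7,
    jumpSum_eq_sum sub8, hvt]
  rw [show terminalU v a n (o.Y 1 ω) = U v a β n (o.Y t ω) t +
    ((∑ s ∈ D with t < s, (U v a β n (o.Y s ω) s - U v a β n (o.Yleft s ω) s)) +
      ∫ r in Set.Ioc t 1, drift v a β n (o.Yleft r ω) r) by linarith]
  -- the identity holds jump by jump
  have key : ∀ s, (U v a β n (o.Y s ω) s - U v a β n (o.Yleft s ω) s) +
      (o.timesBB ω).indicator (fun s => v n - price v a β (o.Yleft s ω + 1) s) s +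
      (o.timesBT ω).indicator (fun s => v n - price v a β (o.Yleft s ω + 2) s) s +
      (o.timesBS ω).indicator (fun s => v n - price v a β (o.Yleft s ω) s) s -
      (o.timesSS ω).indicator (fun s => v n - price v a β (o.Yleft s ω - 1) s) s -
      (o.timesST ω).indicator (fun s => v n - price v a β (o.Yleft s ω - 2) s) s -
      (o.timesSB ω).indicator (fun s => v n - price v a β (o.Yleft s ω) s) s =
      (jumpTimes o.ZB ω).indicator (fun s => incU v a β n 1 (o.Yleft s ω) s) s +
      (jumpTimes o.ZS ω).indicator (fun s => incU v a β n (-1) (o.Yleft s ω) s) s +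
      (o.timesBB ω).indicator (fun s => buyGap v a β n (o.Yleft s ω) s +
        lossAtLow v a β n (o.Yleft s ω) s) s +
      (o.timesBT ω).indicator (fun s => buyGap v a β n (o.Yleft s ω + 1) s +
        lossAtLow v a β n (o.Yleft s ω + 1) s) s +
      (o.timesBS ω).indicator (fun s => cancelSellGap v a β n (o.Yleft s ω) s +
        lossAtUp v a β n (o.Yleft s ω) s) s +
      (o.timesSS ω).indicator (fun s => sellGap v a β n (o.Yleft s ω) s +
        -lossAtUp v a β n (o.Yleft s ω) s) s +
      (o.timesST ω).indicator (fun s => sellGap v a β n (o.Yleft s ω - 1) s +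
        -lossAtUp v a β n (o.Yleft s ω - 1) s) s +
      (o.timesSB ω).indicator (fun s => cancelBuyGap v a β n (o.Yleft s ω) s +
        -lossAtLow v a β n (o.Yleft s ω) s) s := by
    intro s
    have hY := hp.Y_eq s ω
    set k := o.Yleft s ω with hk
    have g1 := gain_buy (n := n) ha hN k s
    have g2 := gain_buy (n := n) ha hN (k + 1) s
    have g3 := gain_sell (n := n) ha hN k s
    have g4 := gain_sell (n := n) ha hN (k - 1) s
    have g5 := gain_cancelSell (n := n) ha hN k s
    have g6 := gain_cancelBuy (n := n) ha hN k s
    have e1 : k + 1 + 1 = k + 2 := by ring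
    have e2 : k - 1 - 1 = k - 2 := by ring
    have e3 : k - 1 + -1 = k - 2 := by ring
    have e4 : k + -1 = k - 1 := by ring
    have e5 : k + 1 + -1 = k := by ring
    have e7 : k - 1 + 1 = k := by ring
    have hZs : s ∈ jumpTimes o.ZB ω → s ∉ jumpTimes o.ZS ω := fun h => Set.disjoint_left.1 hZ h
    have hXs : s ∈ jumpTimes o.XB ω → s ∉ jumpTimes o.XS ω := fun h => Set.disjoint_left.1 hX h
    simp only [incU, e1, e2, e3, e4] at g1 g2 g3 g4 g5 g6 ⊢
    have hBB : s ∈ o.timesBB ω ↔ s ∈ jumpTimes o.XB ω ∧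
      ¬(s ∈ jumpTimes o.ZB ω ∨ s ∈ jumpTimes o.ZS ω) := Iff.rfl
    have hBT : s ∈ o.timesBT ω ↔ s ∈ jumpTimes o.XB ω ∧ s ∈ jumpTimes o.ZB ω := Iff.rfl
    have hBS : s ∈ o.timesBS ω ↔ s ∈ jumpTimes o.XB ω ∧ s ∈ jumpTimes o.ZS ω := Iff.rfl
    have hSS : s ∈ o.timesSS ω ↔ s ∈ jumpTimes o.XS ω ∧
      ¬(s ∈ jumpTimes o.ZB ω ∨ s ∈ jumpTimes o.ZS ω) := Iff.rfl
    have hST : s ∈ o.timesST ω ↔ s ∈ jumpTimes o.XS ω ∧ s ∈ jumpTimes o.ZS ω := Iff.rfl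
    have hSB : s ∈ o.timesSB ω ↔ s ∈ jumpTimes o.XS ω ∧ s ∈ jumpTimes o.ZB ω := Iff.rfl
    classical
    simp only [Set.indicator_apply, ← hk, hBB, hBT, hBS, hSS, hST, hSB] at hY ⊢
    -- the nine combinations of a noise order (buy, sell, none) and an insider's order
    by_cases zb : s ∈ jumpTimes o.ZB ω <;> by_cases zs : s ∈ jumpTimes o.ZS ω <;>
      by_cases xb : s ∈ jumpTimes o.XB ω <;> by_cases xs : s ∈ jumpTimes o.XS ω <;>
      first
      | exact absurd zs (hZs zb)
      | exact absurd xs (hXs xb)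
      | simp only [zb, zs, xb, xs, if_true, if_false, and_true, and_false, or_true, or_false,
          not_true, not_false_eq_true, sub_zero, zero_sub, sub_self, add_zero,
          e1, e3, e4, e5, e7] at hY ⊢
        rw [hY] <;> linarith
  have hsum := Finset.sum_congr (rfl : D.filter (fun s => t < s) = D.filter fun s => t < s)
    fun s _ => key s
  simp only [Finset.sum_add_distrib, Finset.sum_sub_distrib] at hsum ⊢
  linarith

end PathIdentity

/-! ### Compensated sums along the total demand -/

section Compensators

variable {Ω : Type*} {mΩ : MeasurableSpace Ω} {P : Measure Ω} {F : Filtration Time mΩ}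
  {o : OrderFlow Ω}

lemma measurable_fst_predictable (F : Filtration Time mΩ) :
    Measurable[F.predictable] (Prod.fst : Time × Ω → Time) := by
  let : MeasurableSpace (Time × Ω) := F.predictable
  refine measurable_of_Ioi fun s => ?_
  have h := measurableSet_predictable_Ioi_prod (𝓕 := F) (i := s) (s := Set.univ) MeasurableSet.univ
  convert h using 1
  ext p; simp

/-- The left limit of the total demand is predictable. -/
lemma OrderFlow.HasPaths.measurable_Yleft (hp : o.HasPaths)
    (hZB : ∀ t, Measurable[F t] (o.ZB t)) (hZS : ∀ t, Measurable[F t] (o.ZS t))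
    (hXB : ∀ t, Measurable[F t] (o.XB t)) (hXS : ∀ t, Measurable[F t] (o.XS t)) :
    Measurable[F.predictable] fun p : Time × Ω => o.Yleft p.1 p.2 := by
  have h1 := measurable_leftLim_predictable hZB hp.zb
  have h2 := measurable_leftLim_predictable hZS hp.zs
  have h3 := measurable_leftLim_predictable hXB hp.xb
  have h4 := measurable_leftLim_predictable hXS hp.xs
  let : MeasurableSpace (Time × Ω) := F.predictable
  have hc : Measurable fun k : ℕ => (k : ℤ) := Measurable.of_discrete
  simp only [hp.Yleft_eq]
  exact (measurable_const.add ((hc.comp h1).sub (hc.comp h2))).add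
    ((hc.comp h3).sub (hc.comp h4))

/-- For every bounded family `g`, the sum of `g (Y_{s-}, s)` over the times `s ∈ T` after `t` has
under `μ` the same finite expectation as the integral of `g (Y_{r-}, r) θ_r` over `(t, 1]`. -/
structure IsCompensator (o : OrderFlow Ω) (μ : Measure Ω) (t : Time) (T : Ω → Set Time)
    (θ : Time → Ω → ℝ) : Prop where
  finite : ∀ ω, (T ω).Finite
  integrable_sum : ∀ {g}, IsBddFamily g → Integrable (o.gainSum T t g) μ
  integrable_integral : ∀ {g}, IsBddFamily g → Integrable (o.gainIntegral θ t g) μ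
  integrableOn : ∀ {g}, IsBddFamily g →
    ∀ᵐ ω ∂μ, IntegrableOn (fun r => g (o.Yleft r ω) r * θ r ω) (Set.Ioc t 1)
  integral_eq : ∀ {g}, IsBddFamily g →
    ∫ ω, o.gainSum T t g ω ∂μ = ∫ ω, o.gainIntegral θ t g ω ∂μ

lemma IsJumpPart.isCompensator {X : Time → Ω → ℕ} {T : Ω → Set Time} {θ : Time → Ω → ℝ}
    (h : IsJumpPart P F X T θ)
    (hY : Measurable[F.predictable] fun p : Time × Ω => o.Yleft p.1 p.2) {t : Time} {A : Set Ω}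
    (hA : MeasurableSet[F t] A) (hPA : P A ≠ 0) :
    IsCompensator o (ProbabilityTheory.cond P A) t T θ := by
  have key : ∀ {g : ℤ → Time → ℝ}, IsBddFamily g → _ := fun {g} hg =>
    h.compensation hA hPA (g := fun p => g (o.Yleft p.1 p.2) p.1)
      (by
        have h1 := measurable_fst_predictable F
        have hm : Measurable fun p : ℤ × Time => g p.1 p.2 :=
          measurable_from_prod_countable_right fun k => hg.measurable k
        exact hm.comp (Measurable.prodMk hY h1))
      (fun p => hg.bounded.choose_spec _ _)
  exact ⟨h.finite, fun hg => (key hg).1, fun hg => (key hg).2.1, fun hg => (key hg).2.2.1,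
    fun hg => (key hg).2.2.2⟩

lemma integrable_fun_sub {α : Type*} {m : MeasurableSpace α} {μ : Measure α} {f f' : α → ℝ}
    (h : Integrable f μ) (h' : Integrable f' μ) : Integrable (fun x => f x - f' x) μ :=
  h.sub h'

/-- `f` is integrable with mean zero. -/
def IsCentered (μ : Measure Ω) (f : Ω → ℝ) : Prop := Integrable f μ ∧ ∫ ω, f ω ∂μ = 0

lemma IsCentered.add {μ : Measure Ω} {f f' : Ω → ℝ} (h : IsCentered μ f) (h' : IsCentered μ f') :
    IsCentered μ fun ω => f ω + f' ω :=
  ⟨h.1.add h'.1, by rw [integral_add h.1 h'.1, h.2, h'.2, add_zero]⟩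

lemma IsCentered.sub {μ : Measure Ω} {f f' : Ω → ℝ} (h : IsCentered μ f) (h' : IsCentered μ f') :
    IsCentered μ fun ω => f ω - f' ω :=
  ⟨h.1.sub h'.1, by rw [integral_sub h.1 h'.1, h.2, h'.2, sub_zero]⟩

lemma IsCompensator.isCentered {μ : Measure Ω} {t : Time} {T : Ω → Set Time} {θ : Time → Ω → ℝ}
    (h : IsCompensator o μ t T θ) {g : ℤ → Time → ℝ} (hg : IsBddFamily g) :
    IsCentered μ fun ω => o.gainSum T t g ω - o.gainIntegral θ t g ω :=
  ⟨(h.integrable_sum hg).sub (h.integrable_integral hg), by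
    rw [integral_sub (h.integrable_sum hg) (h.integrable_integral hg), h.integral_eq hg, sub_self]⟩

end Compensators

/-! ### The expected profit -/

section ExpectedProfit

variable {Ω : Type*} {mΩ : MeasurableSpace Ω} {N : ℕ} {v : Fin N → ℝ} {a : Fin (N + 1) → EReal}
  {β : ℝ≥0} {vt : Ω → ℝ} {o : OrderFlow Ω} {θ : Rates Ω} {P μ : Measure Ω} {t : Time} {n : Fin N}

/-- Under `μ`, the eight kinds of orders are compensated by their intensities. -/
structure AreCompensators (o : OrderFlow Ω) (β : ℝ≥0) (θ : Rates Ω) (μ : Measure Ω) (t : Time) :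
    Prop where
  ZB : IsCompensator o μ t (jumpTimes o.ZB) fun _ _ => β
  ZS : IsCompensator o μ t (jumpTimes o.ZS) fun _ _ => β
  BB : IsCompensator o μ t o.timesBB θ.BB
  BT : IsCompensator o μ t o.timesBT θ.BT
  BS : IsCompensator o μ t o.timesBS θ.BS
  SS : IsCompensator o μ t o.timesSS θ.SS
  ST : IsCompensator o μ t o.timesST θ.ST
  SB : IsCompensator o μ t o.timesSB θ.SB

namespace AreCompensators

lemma integrable_profit (h : AreCompensators o β θ μ t) (hvt : ∀ᵐ ω ∂μ, vt ω = v n) :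
    Integrable (o.profit v a β vt t) μ := by
  have hb : ∀ d : ℤ, IsBddFamily fun k r => v n - price v a β (k + d) r := fun d =>
    (IsBddFamily.const (v n)).sub (isBddFamily_price d)
  have hi := ((((((h.BB.integrable_sum (hb 1)).add (h.BT.integrable_sum (hb 2))).add
    (h.BS.integrable_sum (hb 0))).sub (h.SS.integrable_sum (hb (-1)))).sub
    (h.ST.integrable_sum (hb (-2)))).sub (h.SB.integrable_sum (hb 0)))
  refine hi.congr ?_
  filter_upwards [hvt] with ω hω
  simp only [Pi.add_apply, Pi.sub_apply, OrderFlow.gainSum, OrderFlow.profit, hω, add_zero,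
    ← sub_eq_add_neg (_ : ℤ)]

lemma lossUp_ae_eq (ha : MiddleLevelAssumption P v a β vt) (hN : 2 ≤ N)
    (h : AreCompensators o β θ μ t) : o.lossUp v a β θ n t =ᵐ[μ] fun ω =>
      o.gainIntegral (fun _ _ => (β : ℝ)) t (lossAtUp v a β n) ω -
      o.gainIntegral θ.BS t (lossAtUp v a β n) ω +
      o.gainIntegral θ.SS t (lossAtUp v a β n) ω +
      o.gainIntegral θ.ST t (fun y r => lossAtUp v a β n (y - 1) r) ω := by
  have hb := isBddFamily_lossAtUp (v := v) (a := a) (β := β) (n := n)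
  filter_upwards [h.ZB.integrableOn hb, h.BS.integrableOn hb, h.SS.integrableOn hb,
    h.ST.integrableOn (hb.comp_add (-1))] with ω h1 h2 h3 h4
  simp only [OrderFlow.gainIntegral, sub_eq_add_neg _ (1 : ℤ)]
  have h12 := integrable_fun_sub h1 h2
  have h123 := Integrable.fun_add h12 h3
  rw [← integral_sub h1 h2, ← integral_add h12 h3, ← integral_add h123 h4, OrderFlow.lossUp]
  refine integral_congr_ae (Eventually.of_forall fun r => ?_)
  simp only [lossAtUp, ← sub_eq_add_neg _ (1 : ℤ), ha.eq_upMid_add_one_iff hN]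
  ring

lemma lossDown_ae_eq (ha : MiddleLevelAssumption P v a β vt) (hN : 2 ≤ N)
    (h : AreCompensators o β θ μ t) : o.lossDown v a β θ n t =ᵐ[μ] fun ω =>
      o.gainIntegral (fun _ _ => (β : ℝ)) t (lossAtLow v a β n) ω -
      o.gainIntegral θ.SB t (lossAtLow v a β n) ω +
      o.gainIntegral θ.BB t (lossAtLow v a β n) ω +
      o.gainIntegral θ.BT t (fun y r => lossAtLow v a β n (y + 1) r) ω := by
  have hb := isBddFamily_lossAtLow (v := v) (a := a) (β := β) (n := n)
  filter_upwards [h.ZB.integrableOn hb, h.SB.integrableOn hb, h.BB.integrableOn hb,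
    h.BT.integrableOn (hb.comp_add 1)] with ω h1 h2 h3 h4
  simp only [OrderFlow.gainIntegral]
  have h12 := integrable_fun_sub h1 h2
  have h123 := Integrable.fun_add h12 h3
  rw [← integral_sub h1 h2, ← integral_add h12 h3, ← integral_add h123 h4, OrderFlow.lossDown]
  refine integral_congr_ae (Eventually.of_forall fun r => ?_)
  simp only [lossAtLow, ha.eq_lowMid_sub_one_iff hN]
  ring

lemma integrable_lossUp (ha : MiddleLevelAssumption P v a β vt) (hN : 2 ≤ N)
    (h : AreCompensators o β θ μ t) : Integrable (o.lossUp v a β θ n t) μ := by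
  have hb := isBddFamily_lossAtUp (v := v) (a := a) (β := β) (n := n)
  exact ((((h.ZB.integrable_integral hb).sub (h.BS.integrable_integral hb)).add
    (h.SS.integrable_integral hb)).add (h.ST.integrable_integral (hb.comp_add (-1)))).congr
    (h.lossUp_ae_eq ha hN).symm

lemma integrable_lossDown (ha : MiddleLevelAssumption P v a β vt) (hN : 2 ≤ N)
    (h : AreCompensators o β θ μ t) : Integrable (o.lossDown v a β θ n t) μ := by
  have hb := isBddFamily_lossAtLow (v := v) (a := a) (β := β) (n := n)
  exact ((((h.ZB.integrable_integral hb).sub (h.SB.integrable_integral hb)).add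
    (h.BB.integrable_integral hb)).add (h.BT.integrable_integral (hb.comp_add 1))).congr
    (h.lossDown_ae_eq ha hN).symm

/-- The drift of `U` is cancelled by the noise orders, up to the losses of the noise at the two
levels next to the middle level. -/
lemma integral_drift_ae_eq (ha : MiddleLevelAssumption P v a β vt) (hN : 2 ≤ N)
    (h : AreCompensators o β θ μ t) :
    (fun ω => ∫ r in Set.Ioc t 1, drift v a β n (o.Yleft r ω) r) =ᵐ[μ] fun ω =>
      o.gainIntegral (fun _ _ => (β : ℝ)) t (lossAtLow v a β n) ω -
      o.gainIntegral (fun _ _ => (β : ℝ)) t (lossAtUp v a β n) ω -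
      o.gainIntegral (fun _ _ => (β : ℝ)) t (incU v a β n 1) ω -
      o.gainIntegral (fun _ _ => (β : ℝ)) t (incU v a β n (-1)) ω := by
  filter_upwards [h.ZB.integrableOn (isBddFamily_lossAtLow (v := v) (a := a) (β := β) (n := n)),
    h.ZB.integrableOn (isBddFamily_lossAtUp (v := v) (a := a) (β := β) (n := n)),
    h.ZB.integrableOn (isBddFamily_incU_one (n := n) ha hN),
    h.ZB.integrableOn (isBddFamily_incU_neg_one (n := n) ha hN)] with ω h1 h2 h3 h4
  simp only [OrderFlow.gainIntegral]
  have h12 := integrable_fun_sub h1 h2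
  have h123 := integrable_fun_sub h12 h3
  rw [← integral_sub h1 h2, ← integral_sub h12 h3, ← integral_sub h123 h4]
  refine integral_congr_ae (Eventually.of_forall fun r => ?_)
  have := generator_U (n := n) ha hN (o.Yleft r ω) r
  dsimp only
  linarith

/-- The sum of the excess gains of the insider's orders. -/
noncomputable def totalGap (o : OrderFlow Ω) (v : Fin N → ℝ) (a : Fin (N + 1) → EReal) (β : ℝ≥0)
    (n : Fin N) (t : Time) (ω : Ω) : ℝ :=
  o.gainSum o.timesBB t (buyGap v a β n) ω +
  o.gainSum o.timesBT t (fun y r => buyGap v a β n (y + 1) r) ω +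
  o.gainSum o.timesBS t (cancelSellGap v a β n) ω +
  o.gainSum o.timesSS t (sellGap v a β n) ω +
  o.gainSum o.timesST t (fun y r => sellGap v a β n (y - 1) r) ω +
  o.gainSum o.timesSB t (cancelBuyGap v a β n) ω

lemma integrable_totalGap (h : AreCompensators o β θ μ t) :
    Integrable (totalGap o v a β n t) μ :=
  (((((h.BB.integrable_sum isBddFamily_buyGap).add
    (h.BT.integrable_sum (isBddFamily_buyGap.comp_add 1))).add
    (h.BS.integrable_sum isBddFamily_cancelSellGap)).add
    (h.SS.integrable_sum isBddFamily_sellGap)).add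
    (h.ST.integrable_sum (isBddFamily_sellGap.comp_add (-1)))).add
    (h.SB.integrable_sum isBddFamily_cancelBuyGap)

lemma totalGap_nonpos (ha : MiddleLevelAssumption P v a β vt) (hv : StrictMono v)
    (h : AreCompensators o β θ μ t) (ω : Ω) : totalGap o v a β n t ω ≤ 0 := by
  have h1 := OrderFlow.gainSum_nonpos (o := o) (h.BB.finite ω) t
    (buyGap_nonpos (β := β) (n := n) ha hv)
  have h2 := OrderFlow.gainSum_nonpos (o := o) (h.BT.finite ω) t
    fun y r => buyGap_nonpos (β := β) (n := n) ha hv (y + 1) r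
  have h3 := OrderFlow.gainSum_nonpos (o := o) (h.BS.finite ω) t
    (cancelSellGap_nonpos (β := β) (n := n) ha hv)
  have h4 := OrderFlow.gainSum_nonpos (o := o) (h.SS.finite ω) t
    (sellGap_nonpos (β := β) (n := n) ha hv)
  have h5 := OrderFlow.gainSum_nonpos (o := o) (h.ST.finite ω) t
    fun y r => sellGap_nonpos (β := β) (n := n) ha hv (y - 1) r
  have h6 := OrderFlow.gainSum_nonpos (o := o) (h.SB.finite ω) t
    (cancelBuyGap_nonpos (β := β) (n := n) ha hv)
  unfold totalGap
  linarith

/-- The expected profit is `U - L`, plus the expected excess gains, minus the expected value of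
the terminal `U`. -/
lemma expectation_identity [IsProbabilityMeasure μ] (ha : MiddleLevelAssumption P v a β vt)
    (hN : 2 ≤ N) (hp : o.HasPaths) {y : ℤ} (h : AreCompensators o β θ μ t)
    (hvt : ∀ᵐ ω ∂μ, vt ω = v n) (hY : ∀ᵐ ω ∂μ, o.Y t ω = y)
    (hZ : ∀ᵐ ω ∂μ, Disjoint (jumpTimes o.ZB ω) (jumpTimes o.ZS ω))
    (hX : ∀ᵐ ω ∂μ, Disjoint (jumpTimes o.XB ω) (jumpTimes o.XS ω)) :
    ∫ ω, o.profit v a β vt t ω ∂μ = U v a β n y t -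
      (∫ ω, o.lossUp v a β θ n t ω ∂μ - ∫ ω, o.lossDown v a β θ n t ω ∂μ) +
      ∫ ω, totalGap o v a β n t ω ∂μ - ∫ ω, terminalU v a n (o.Y 1 ω) ∂μ := by
  have bU := isBddFamily_lossAtUp (v := v) (a := a) (β := β) (n := n)
  have bL := isBddFamily_lossAtLow (v := v) (a := a) (β := β) (n := n)
  -- the compensated sums, whose total has mean zero
  have hM := (((((((h.ZB.isCentered (isBddFamily_incU_one (n := n) ha hN)).add
    (h.ZS.isCentered (isBddFamily_incU_neg_one (n := n) ha hN))).add
    (h.BB.isCentered bL)).add (h.BT.isCentered (bL.comp_add 1))).add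
    (h.BS.isCentered bU)).sub (h.SS.isCentered bU)).sub
    (h.ST.isCentered (bU.comp_add (-1)))).sub (h.SB.isCentered bL)
  set M := _
  change IsCentered μ M at hM
  have hpr := h.integrable_profit (a := a) hvt
  have hup := h.integrable_lossUp (n := n) ha hN
  have hdn := h.integrable_lossDown (n := n) ha hN
  have hG := h.integrable_totalGap (v := v) (a := a) (n := n)
  have hid : (fun ω => terminalU v a n (o.Y 1 ω)) =ᵐ[μ] fun ω => U v a β n y t + M ω +
      totalGap o v a β n t ω + o.lossDown v a β θ n t ω - o.lossUp v a β θ n t ω -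
      o.profit v a β vt t ω := by
    filter_upwards [hvt, hY, hZ, hX, h.lossUp_ae_eq ha hN, h.lossDown_ae_eq ha hN,
      h.integral_drift_ae_eq (n := n) ha hN] with ω h1 h2 h3 h4 h5 h6 h7
    have hi := profit_add_terminalU ha hN hp n t h1 h3 h4
    rw [OrderFlow.gainSum_add (h.BB.finite ω), OrderFlow.gainSum_add (h.BT.finite ω),
      OrderFlow.gainSum_add (h.BS.finite ω), OrderFlow.gainSum_add (h.SS.finite ω),
      OrderFlow.gainSum_add (h.ST.finite ω), OrderFlow.gainSum_add (h.SB.finite ω),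
      OrderFlow.gainSum_neg (h.SS.finite ω), OrderFlow.gainSum_neg (h.ST.finite ω),
      OrderFlow.gainSum_neg (h.SB.finite ω), h2, h7] at hi
    simp only [M, totalGap, ← sub_eq_add_neg _ (1 : ℤ)]
    linarith
  have hc : Integrable (fun _ : Ω => U v a β n y t) μ := integrable_const _
  have h1 := hc.fun_add hM.1
  have h2 := h1.fun_add hG
  have h3 := h2.fun_add hdn
  have h4 := integrable_fun_sub h3 hup
  rw [integral_congr_ae hid, integral_sub h4 hpr, integral_sub h3 hup, integral_add h2 hdn,
    integral_add h1 hG, integral_add hc hM.1, hM.2, integral_const, probReal_univ,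
    one_smul]
  ring

end AreCompensators

end ExpectedProfit

/-! ### The case of equality -/

section Equality

variable {Ω : Type*} {mΩ : MeasurableSpace Ω} {N : ℕ} {v : Fin N → ℝ} {a : Fin (N + 1) → EReal}
  {β : ℝ≥0} {vt : Ω → ℝ} {o : OrderFlow Ω} {θ : Rates Ω} {P μ : Measure Ω} {t : Time} {n : Fin N}

lemma OrderFlow.gainSum_eq_zero {T : Ω → Set Time} {g : ℤ → Time → ℝ} {ω : Ω}
    (h : ∀ s ∈ Set.Ioc t 1, s ∈ T ω → g (o.Yleft s ω) s = 0) : o.gainSum T t g ω = 0 :=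
  finsum_mem_eq_zero_of_forall_eq_zero fun s hs => h s hs.2 hs.1

/-- If the rate `ρ` vanishes wherever `g` is nonzero, the sum of `g` has mean zero. -/
lemma IsCompensator.integral_gainSum_eq_zero {T : Ω → Set Time} {ρ : Time → Ω → ℝ}
    (h : IsCompensator o μ t T ρ) {g : ℤ → Time → ℝ} (hg : IsBddFamily g)
    (h0 : ∀ᵐ ω ∂μ, ∀ᵐ r : Time, r ∈ Set.Ioc t 1 → g (o.Yleft r ω) r ≠ 0 → ρ r ω = 0) :
    ∫ ω, o.gainSum T t g ω ∂μ = 0 := by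
  rw [h.integral_eq hg]
  refine integral_eq_zero_of_ae ?_
  filter_upwards [h0] with ω hω
  refine integral_eq_zero_of_ae ((ae_restrict_iff' measurableSet_Ioc).2 ?_)
  filter_upwards [hω] with r hr hrt
  by_cases hgr : g (o.Yleft r ω) r = 0
  · simp [hgr]
  · simp [hr hrt hgr]

lemma MiddleLevelAssumption.lowMid_le_of_upMid_le_add_one (ha : MiddleLevelAssumption P v a β vt)
    (hN : 2 ≤ N) {y : ℤ} (hy : upMid a n ≤ lvl (y + 1)) : lowMid a n ≤ lvl y := by
  rcases ha.cases hN n with ⟨c, -, -, hl, hu⟩ | ⟨b, -, -, hl, hu⟩ | ⟨b, c, m, -, -, -, -, hl, hu, -⟩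
  · simp [hl]
  · rw [hu] at hy; exact absurd hy (not_le.2 (lvl_lt_top _))
  · rw [hu, lvl_le_lvl] at hy
    rw [hl, lvl_le_lvl]; omega

lemma MiddleLevelAssumption.le_upMid_of_sub_one_le_lowMid (ha : MiddleLevelAssumption P v a β vt)
    (hN : 2 ≤ N) {y : ℤ} (hy : lvl (y - 1) ≤ lowMid a n) : lvl y ≤ upMid a n := by
  rcases ha.cases hN n with ⟨c, -, -, hl, hu⟩ | ⟨b, -, -, hl, hu⟩ | ⟨b, c, m, -, -, -, -, hl, hu, -⟩
  · rw [hl] at hy; exact absurd hy (not_le.2 (bot_lt_lvl _))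
  · simp [hu]
  · rw [hl, lvl_le_lvl] at hy
    rw [hu, lvl_le_lvl]; omega

/-- Trades towards the middle level have no excess gains on average. -/
lemma AreCompensators.integral_totalGap_eq_zero (ha : MiddleLevelAssumption P v a β vt)
    (hN : 2 ≤ N) (h : AreCompensators o β θ μ t)
    (htrade : ∀ᵐ ω ∂μ, (∀ r ∈ Set.Ioc t 1,
      (lvl (o.Yleft r ω) ≤ lowMid a n → r ∉ o.timesSS ω ∧ r ∉ o.timesSB ω) ∧
      (upMid a n ≤ lvl (o.Yleft r ω) → r ∉ o.timesBB ω ∧ r ∉ o.timesBS ω)) ∧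
      (∀ᵐ r : Time, r ∈ Set.Ioc t 1 →
        (lowMid a n ≤ lvl (o.Yleft r ω) → θ.BT r ω = 0) ∧
        (lvl (o.Yleft r ω) ≤ upMid a n → θ.ST r ω = 0))) :
    ∫ ω, totalGap o v a β n t ω ∂μ = 0 := by
  have b1 := (isBddFamily_buyGap (v := v) (a := a) (β := β) (n := n)).comp_add 1
  have b2 := (isBddFamily_sellGap (v := v) (a := a) (β := β) (n := n)).comp_add (-1)
  have e1 : ∫ ω, o.gainSum o.timesBT t (fun y r => buyGap v a β n (y + 1) r) ω ∂μ = 0 := by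
    refine h.BT.integral_gainSum_eq_zero b1 ?_
    filter_upwards [htrade] with ω hω
    filter_upwards [hω.2] with r hr hrt hne
    refine (hr hrt).1 (ha.lowMid_le_of_upMid_le_add_one hN ?_)
    by_contra hn
    exact hne (if_neg hn)
  have e2 : ∫ ω, o.gainSum o.timesST t (fun y r => sellGap v a β n (y + -1) r) ω ∂μ = 0 := by
    refine h.ST.integral_gainSum_eq_zero b2 ?_
    filter_upwards [htrade] with ω hω
    filter_upwards [hω.2] with r hr hrt hne
    refine (hr hrt).2 (ha.le_upMid_of_sub_one_le_lowMid hN ?_)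
    by_contra hn
    exact hne (if_neg hn)
  have hae : totalGap o v a β n t =ᵐ[μ] fun ω =>
      o.gainSum o.timesBT t (fun y r => buyGap v a β n (y + 1) r) ω +
      o.gainSum o.timesST t (fun y r => sellGap v a β n (y + -1) r) ω := by
    filter_upwards [htrade] with ω hω
    have z1 : o.gainSum o.timesBB t (buyGap v a β n) ω = 0 :=
      OrderFlow.gainSum_eq_zero fun s hs hT => if_neg fun hu => ((hω.1 s hs).2 hu).1 hT
    have z2 : o.gainSum o.timesBS t (cancelSellGap v a β n) ω = 0 :=
      OrderFlow.gainSum_eq_zero fun s hs hT => if_neg fun hu => ((hω.1 s hs).2 hu).2 hT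
    have z3 : o.gainSum o.timesSS t (sellGap v a β n) ω = 0 :=
      OrderFlow.gainSum_eq_zero fun s hs hT => if_neg fun hl => ((hω.1 s hs).1 hl).1 hT
    have z4 : o.gainSum o.timesSB t (cancelBuyGap v a β n) ω = 0 :=
      OrderFlow.gainSum_eq_zero fun s hs hT => if_neg fun hl => ((hω.1 s hs).1 hl).2 hT
    simp only [totalGap, z1, z2, z3, z4, zero_add, add_zero, sub_eq_add_neg]
  rw [integral_congr_ae hae, integral_add (h.BT.integrable_sum b1) (h.ST.integrable_sum b2), e1,
    e2, add_zero]

end Equality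

/-! ### Admissible strategies -/

section Admissible

variable {Ω : Type*} {mΩ : MeasurableSpace Ω} {N : ℕ} {v : Fin N → ℝ} {a : Fin (N + 1) → EReal}
  {β : ℝ≥0} {vt : Ω → ℝ} {o : OrderFlow Ω} {θ : Rates Ω} {P : Measure Ω} {F : Filtration Time mΩ}

lemma IsPoissonProcess.lintegral_one_lt_top [IsProbabilityMeasure P] {Z : Time → Ω → ℕ}
    (hZ : IsPoissonProcess P β Z) : ∫⁻ ω, (Z 1 ω : ℝ≥0∞) ∂P < ⊤ := by
  have h := hZ.lintegral_increment 0
  simp only [(hZ.path _).zero] at h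
  simp only [tsub_zero] at h
  rw [h]
  exact ENNReal.mul_lt_top ENNReal.coe_lt_top ENNReal.ofReal_lt_top

lemma OrderFlow.IsAdmissibleSide.lintegral_one_lt_top {X : Time → Ω → ℕ}
    (h : o.IsAdmissibleSide P v a β F X) : ∫⁻ ω, (X 1 ω : ℝ≥0∞) ∂P < ⊤ := by
  have h1 := h.integrable.hasFiniteIntegral
  rw [hasFiniteIntegral_iff_ofReal (Eventually.of_forall fun ω => Nat.cast_nonneg _)] at h1
  simpa only [ENNReal.ofReal_natCast] using h1

lemma OrderFlow.IsAdmissible.hasPaths (hadm : o.IsAdmissible P v a β vt F)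
    (hnoise : o.IsNoise P β vt) : o.HasPaths :=
  ⟨hnoise.buy.path, hnoise.sell.path, hadm.buy.path, hadm.sell.path⟩

/-- Conditionally on an event known at time `t`, all orders are compensated by their intensities. -/
lemma OrderFlow.IsAdmissible.areCompensators [IsProbabilityMeasure P]
    (hadm : o.IsAdmissible P v a β vt F) (hvt : Measurable vt) (hnoise : o.IsNoise P β vt)
    (hθ : o.HasRates P F θ) {t : Time} {A : Set Ω} (hA : MeasurableSet[F t] A) (hPA : P A ≠ 0) :
    AreCompensators o β θ (ProbabilityTheory.cond P A) t := by
  have hp := hadm.hasPaths hnoise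
  have hY : Measurable[F.predictable] fun p : Time × Ω => o.Yleft p.1 p.2 :=
    hp.measurable_Yleft (fun t => (noise_adapted hadm.filtration t).1)
      (fun t => (noise_adapted hadm.filtration t).2) hadm.buy.adapted hadm.sell.adapted
  have mXB : ∀ t, Measurable (o.XB t) := fun t => (hadm.buy.adapted t).mono (F.le t) le_rfl
  have mXS : ∀ t, Measurable (o.XS t) := fun t => (hadm.sell.adapted t).mono (F.le t) le_rfl
  have gZB := measurableSet_jumpTimes hnoise.buy.measurable hp.zb
  have gZS := measurableSet_jumpTimes hnoise.sell.measurable hp.zs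
  have gXB := measurableSet_jumpTimes mXB hp.xb
  have gXS := measurableSet_jumpTimes mXS hp.xs
  have iZ := hasIntensity_noise hvt hnoise hadm.filtration
  have fXB := hadm.buy.lintegral_one_lt_top
  have fXS := hadm.sell.lintegral_one_lt_top
  have buy : ∀ {T : Ω → Set Time} {ρ : Time → Ω → ℝ}, (∀ ω, T ω ⊆ jumpTimes o.XB ω) →
      MeasurableSet {p : Time × Ω | p.1 ∈ T p.2} → HasIntensity P F T ρ →
      IsCompensator o (ProbabilityTheory.cond P A) t T ρ := fun hs hm hI =>
    (IsJumpPart.mk mXB hp.xb fXB hs hm hI).isCompensator hY hA hPA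
  have sell : ∀ {T : Ω → Set Time} {ρ : Time → Ω → ℝ}, (∀ ω, T ω ⊆ jumpTimes o.XS ω) →
      MeasurableSet {p : Time × Ω | p.1 ∈ T p.2} → HasIntensity P F T ρ →
      IsCompensator o (ProbabilityTheory.cond P A) t T ρ := fun hs hm hI =>
    (IsJumpPart.mk mXS hp.xs fXS hs hm hI).isCompensator hY hA hPA
  exact
    { ZB := (IsJumpPart.mk hnoise.buy.measurable hp.zb hnoise.buy.lintegral_one_lt_top
        (fun _ => le_rfl) gZB iZ.1).isCompensator hY hA hPA
      ZS := (IsJumpPart.mk hnoise.sell.measurable hp.zs hnoise.sell.lintegral_one_lt_top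
        (fun _ => le_rfl) gZS iZ.2).isCompensator hY hA hPA
      BB := buy (fun _ _ h => h.1) (gXB.diff (gZB.union gZS)) hθ.BB
      BT := buy (fun _ _ h => h.1) (gXB.inter gZB) hθ.BT
      BS := buy (fun _ _ h => h.1) (gXB.inter gZS) hθ.BS
      SS := sell (fun _ _ h => h.1) (gXS.diff (gZB.union gZS)) hθ.SS
      ST := sell (fun _ _ h => h.1) (gXS.inter gZS) hθ.ST
      SB := sell (fun _ _ h => h.1) (gXS.inter gZB) hθ.SB }

/-- The conditioning event is known to the insider at time `t`. -/
lemma OrderFlow.IsAdmissible.measurableSet_value_demand (hadm : o.IsAdmissible P v a β vt F)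
    (n : Fin N) (y : ℤ) (t : Time) : MeasurableSet[F t] {ω | vt ω = v n ∧ o.Y t ω = y} := by
  have h1 := value_measurable hadm.filtration t
  have h2 := noise_adapted hadm.filtration t
  have h3 := hadm.buy.adapted t
  have h4 := hadm.sell.adapted t
  have hc : Measurable fun k : ℕ => (k : ℤ) := Measurable.of_discrete
  have hY : Measurable[F t] (o.Y t) :=
    (measurable_const.add ((hc.comp h2.1).sub (hc.comp h2.2))).add ((hc.comp h3).sub (hc.comp h4))
  exact (h1 (measurableSet_singleton (v n))).inter (hY (measurableSet_singleton y))

end Admissible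

end GlostenMilgrom

theorem mainTheorem5 {Ω : Type*} [mΩ : MeasurableSpace Ω] (P : Measure Ω) [IsProbabilityMeasure P]
    {N : ℕ} (hN : 2 ≤ N) (v : Fin N → ℝ) (hv : StrictMono v) (β : ℝ≥0) (hβ : 0 < β)
    (vt : Ω → ℝ) (hvt : Measurable vt) (a : Fin (N + 1) → EReal)
    (ha : GlostenMilgrom.MiddleLevelAssumption P v a β vt)
    (o : GlostenMilgrom.OrderFlow Ω) (hnoise : o.IsNoise P β vt)
    (F : Filtration GlostenMilgrom.Time mΩ) (hadm : o.IsAdmissible P v a β vt F)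
    (θ : GlostenMilgrom.Rates Ω) (hθ : o.HasRates P F θ)
    (n : Fin N) (y : ℤ) (t : GlostenMilgrom.Time)
    (hpos : 0 < P {ω | vt ω = v n ∧ o.Y t ω = y}) :
    Integrable (o.profit v a β vt t) (o.condLaw P v vt n y t) ∧
    Integrable (o.lossUp v a β θ n t) (o.condLaw P v vt n y t) ∧
    Integrable (o.lossDown v a β θ n t) (o.condLaw P v vt n y t) ∧
    o.expectedProfit P v a β vt n y t ≤
      GlostenMilgrom.U v a β n y t - o.L P v a β vt θ n y t ∧
    (o.LandsInInterval P v a vt n y t → o.TradesTowardsMiddle P v a vt θ n y t →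
      o.expectedProfit P v a β vt n y t =
        GlostenMilgrom.U v a β n y t - o.L P v a β vt θ n y t) := by
  have hA := hadm.measurableSet_value_demand n y t
  have h := hadm.areCompensators hvt hnoise hθ hA hpos.ne'
  have hprob : IsProbabilityMeasure (o.condLaw P v vt n y t) :=
    ProbabilityTheory.cond_isProbabilityMeasure hpos.ne'
  have habs : o.condLaw P v vt n y t ≪ P := ProbabilityTheory.cond_absolutelyContinuous
  have hmem : ∀ᵐ ω ∂(o.condLaw P v vt n y t), vt ω = v n ∧ o.Y t ω = y :=
    ProbabilityTheory.ae_cond_mem (F.le t _ hA)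
  change GlostenMilgrom.AreCompensators o β θ (o.condLaw P v vt n y t) t at h
  have hid := h.expectation_identity ha hN (hadm.hasPaths hnoise)
    (hmem.mono fun _ hω => hω.1) (hmem.mono fun _ hω => hω.2)
    (habs.ae_le (GlostenMilgrom.ae_disjoint_jumpTimes hnoise.buy hnoise.sell hnoise.indep))
    (habs.ae_le hadm.disjoint)
  refine ⟨h.integrable_profit (hmem.mono fun _ hω => hω.1), h.integrable_lossUp ha hN,
    h.integrable_lossDown ha hN, ?_, fun hland htrade => ?_⟩
  · have h1 : 0 ≤ ∫ ω, GlostenMilgrom.terminalU v a n (o.Y 1 ω) ∂(o.condLaw P v vt n y t) :=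
      integral_nonneg fun ω => ha.terminalU_nonneg hN hv n _
    have h2 := integral_nonpos (μ := o.condLaw P v vt n y t) (h.totalGap_nonpos (n := n) ha hv)
    rw [GlostenMilgrom.OrderFlow.expectedProfit, GlostenMilgrom.OrderFlow.L, hid]
    linarith
  · have h1 : ∫ ω, GlostenMilgrom.terminalU v a n (o.Y 1 ω) ∂(o.condLaw P v vt n y t) = 0 :=
      integral_eq_zero_of_ae (hland.mono fun ω hω => ha.terminalU_eq_zero hN hω.1 hω.2)
    have h2 := h.integral_totalGap_eq_zero (n := n) ha hN htrade
    rw [GlostenMilgrom.OrderFlow.expectedProfit, GlostenMilgrom.OrderFlow.L, hid, h1, h2]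
    ring
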